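/- \textbf{Conventions.} All schemes and morphisms are over $\mathbb{C}$. For $n\geq 1$ and $r\geq 1$ let $Z_{n,r}$ be the scheme obtained by gluing $r$ copies $Z_1,\dots,Z_r$ of $\mathbb{C}^n=\mathrm{Spec}\,\mathbb{C}[x_1,\dots,x_n]$ by the identity along $(\mathbb{C}^*)^n$, and let $\delta:Z_{n,r}\to\mathbb{C}^n$ be the morphism which is the identity on every $Z_i$. A \emph{principal homogeneous $\mathbb{C}_+$-bundle structure} on a scheme $X$ over a scheme $Z$ is a pair $(\rho,\mu)$ of a morphism $\rho:X\to Z$ and an algebraic action $\mu:\mathbb{C}_+\times X\to X$ such that $Z$ has a covering by open subschemes $U$ for which $\rho^{-1}(U)$ is equivariantly isomorphic over $U$ to $U\times\mathbb{C}$, where $\mathbb{C}_+$ acts by translations on the second factor. The algebraic quotient morphism of a $\mathbb{C}_+$-action on an affine variety $X=\mathrm{Spec}(B)$ is the morphism $q:X\to X/\!/\mathbb{C}_+=\mathrm{Spec}(B^{\mathbb{C}_+})$ defined by the inclusion of the ring of invariant functions. \textbf{Theorem.} Let $n\geq 1$, let $r\geq 2$, and let $\sigma=\{\sigma_i\}_{i=1,\dots,r}$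 be polynomials in $\mathbb{C}[x_1,\dots,x_n]$ such that (1) $\sigma_i(0,\dots,0)\neq\sigma_j(0,\dots,0)$ for all $i\neq j$; (2) $\sigma_i-\sigma_i(0,\dots,0)$ is divisible by $x_1\cdots x_n$ for every $i$. Let $[m]=(m_1,\dots,m_n)$ be integers with $m_k>1$ for every $k$, write $x^{[m]}=x_1^{m_1}\cdots x_n^{m_n}$, and let $X=X_{[m],\sigma}\subset\mathbb{C}^{n+2}$ be the hypersurface $$x^{[m]}z-\prod_{i=1}^r\bigl(y-\sigma_i(x)\bigr)=0,$$ with the projection $\mathrm{pr}_x:X\to\mathbb{C}^n$, $(x,y,z)\mapsto x$. (a) There is a principal homogeneous $\mathbb{C}_+$-bundle structure $(\rho,\mu)$ on $X$ over $Z_{n,r}$ such that $\delta\circ\rho=\mathrm{pr}_x$, such that $\rho^{-1}(Z_i)=\mathrm{pr}_x^{-1}((\mathbb{C}^*)^n)\cup\{x_1\cdots x_n=0,\ y=\sigma_i(0)\}$ for every $i$, and such that $s\in\mathbb{C}_+$ acts by $x\mapsto x$, $y\mapsto y+s\,x^{[m]}$. It is the unique structure of principal homogeneous $\mathbb{C}_+$-bundle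 on $X$ over $Z_{n,r}$ up to the action of $\mathrm{Aut}(Z_{n,r})\times\mathrm{Aut}(\mathbb{C}_+)$: for every such structure $(\rho',\mu')$ there are an automorphism $\varphi$ of $Z_{n,r}$ and a constant $c\in\mathbb{C}^*$ with $\rho'=\varphi\circ\rho$ and $\mu'(s,p)=\mu(cs,p)$. (b) For every nontrivial algebraic $\mathbb{C}_+$-action on $X$ the algebraic quotient morphism $q:X\to X/\!/\mathbb{C}_+$ coincides with $\mathrm{pr}_x$: there is an isomorphism $e:X/\!/\mathbb{C}_+\to\mathbb{C}^n$ with $e\circ q=\mathrm{pr}_x$. -/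

import Mathlib

open CategoryTheory CategoryTheory.Limits AlgebraicGeometry

noncomputable section

namespace Danielewski

/-! ### Complex schemes -/

/-- The base scheme `Spec ℂ`. -/
abbrev SpecC : Scheme.{0} := Spec (CommRingCat.of ℂ)

/-- The category of complex schemes. -/
abbrev CScheme := Over SpecC

/-- The spectrum of a commutative `ℂ`-algebra, as a complex scheme. -/
def affineOver (A : Type) [CommRing A] [Algebra ℂ A] : CScheme :=
  Over.mk (Spec.map (CommRingCat.ofHom (algebraMap ℂ A)))

/-- The morphism of affine complex schemes defined by a homomorphism of `ℂ`-algebras. -/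
def affineMap {A B : Type} [CommRing A] [Algebra ℂ A] [CommRing B] [Algebra ℂ B]
    (f : A →ₐ[ℂ] B) : affineOver B ⟶ affineOver A :=
  Over.homMk (Spec.map (CommRingCat.ofHom f.toRingHom)) (by
    simp only [affineOver, Over.mk_hom, Over.mk_left]
    rw [← Spec.map_comp, ← CommRingCat.ofHom_comp]
    congr 2
    exact f.comp_algebraMap)

/-- The ring of regular functions `Γ(T, 𝒪_T)` of a complex scheme. -/
abbrev Fn (T : CScheme) : CommRingCat := Γ(T.left, ⊤)

/-- Pull-back of regular functions along a morphism of complex schemes. -/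
def pull {S T : CScheme} (f : S ⟶ T) : Fn T →+* Fn S := f.left.appTop.hom

/-- The complex numbers as constant regular functions on a complex scheme. -/
def const (T : CScheme) : ℂ →+* Fn T :=
  ((Scheme.ΓSpecIso (CommRingCat.of ℂ)).inv ≫ T.hom.appTop).hom

/-- An element of a `ℂ`-algebra as a regular function on its spectrum. -/
def toFn (A : Type) [CommRing A] [Algebra ℂ A] : A →+* Fn (affineOver A) :=
  (Scheme.ΓSpecIso (CommRingCat.of A)).inv.hom

lemma pull_const {S T : CScheme} (f : S ⟶ T) (c : ℂ) : pull f (const T c) = const S c := by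
  have h := Over.w f
  simp only [pull, const]
  rw [← h, Scheme.Hom.comp_appTop]
  rfl

/-! ### Actions of the additive group -/

/-- An algebraic action of the additive group `ℂ₊ = 𝔾ₐ` on a complex scheme `X`, given on points:
for every complex scheme `T`, an action of the group `ℂ₊(T) = (Γ(T, 𝒪_T), +)` on the set `X(T)`
of `T`-valued points of `X`, naturally in `T`. By the Yoneda lemma this is the same as a morphism
`ℂ₊ × X ⟶ X` satisfying the axioms of an action. -/
@[ext]
structure GaAction (X : CScheme) where
  /-- The translate `act s x` of a `T`-point `x` by `s ∈ ℂ₊(T)`. -/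
  act : ∀ {T : CScheme}, Fn T → (T ⟶ X) → (T ⟶ X)
  act_zero : ∀ {T : CScheme} (x : T ⟶ X), act 0 x = x
  act_add : ∀ {T : CScheme} (s t : Fn T) (x : T ⟶ X), act (s + t) x = act s (act t x)
  act_natural : ∀ {T T' : CScheme} (f : T' ⟶ T) (s : Fn T) (x : T ⟶ X),
    f ≫ act s x = act (pull f s) (f ≫ x)

namespace GaAction

variable {X : CScheme}

/-- The action is nontrivial: some point is moved. -/
def Nontrivial (a : GaAction X) : Prop :=
  ∃ (T : CScheme) (s : Fn T) (x : T ⟶ X), a.act s x ≠ x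

/-- The action obtained from `a` by means of the automorphism `s ↦ c s` of `ℂ₊`. -/
def rescale (a : GaAction X) (c : ℂˣ) : GaAction X where
  act {T} s x := a.act (const T c * s) x
  act_zero x := by rw [mul_zero, a.act_zero]
  act_add s t x := by rw [mul_add, a.act_add]
  act_natural f s x := by rw [a.act_natural, map_mul, pull_const]

/-- Equivariance of a morphism for two actions of the additive group. -/
def Equivariant {Y : CScheme} (a : GaAction X) (b : GaAction Y) (f : X ⟶ Y) : Prop :=
  ∀ (T : CScheme) (s : Fn T) (x : T ⟶ X), a.act s x ≫ f = b.act s (x ≫ f)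

/-- The ring of regular functions on `X` which are invariant under the action. -/
def invariants (a : GaAction X) : Subring (Fn X) where
  carrier := {f | ∀ (T : CScheme) (s : Fn T) (x : T ⟶ X), pull (a.act s x) f = pull x f}
  mul_mem' hf hg T s x := by rw [map_mul, map_mul, hf, hg]
  one_mem' T s x := by rw [map_one, map_one]
  add_mem' hf hg T s x := by rw [map_add, map_add, hf, hg]
  zero_mem' T s x := by rw [map_zero, map_zero]
  neg_mem' hf T s x := by rw [map_neg, map_neg, hf]

/-- The algebraic quotient `X // ℂ₊`: the spectrum of the ring of invariant functions. -/
def quotient (a : GaAction X) : Scheme.{0} := Spec (CommRingCat.of a.invariants)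

/-- The algebraic quotient morphism `X ⟶ X // ℂ₊`, defined by the inclusion of the ring of
invariant functions in the ring of regular functions. -/
def quotientMap (a : GaAction X) : X.left ⟶ a.quotient :=
  X.left.toSpecΓ ≫ Spec.map (CommRingCat.ofHom a.invariants.subtype)

end GaAction

/-! ### Principal homogeneous bundles -/

/-- The product `S × ℂ` of a complex scheme with the affine line. -/
def line (S : CScheme) : CScheme :=
  Over.mk ((AffineSpace Unit S.left ↘ S.left) ≫ S.hom)

/-- The projection `S × ℂ ⟶ S`. -/
def lineProj (S : CScheme) : line S ⟶ S :=
  Over.homMk (AffineSpace Unit S.left ↘ S.left) rfl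

/-- The `T`-point `(p, t)` of `S × ℂ` defined by a `T`-point `p` of `S` and a function `t`. -/
def linePair {S T : CScheme} (p : T ⟶ S) (t : Fn T) : T ⟶ line S :=
  Over.homMk (AffineSpace.homOfVector p.left (fun _ => t)) (by
    simp [line])

/-- The coordinate function on the second factor of `S × ℂ`. -/
def lineCoord (S : CScheme) : Fn (line S) := AffineSpace.coord S.left ()

lemma line_hom_ext {S T : CScheme} {f g : T ⟶ line S} (h₁ : f ≫ lineProj S = g ≫ lineProj S)
    (h₂ : pull f (lineCoord S) = pull g (lineCoord S)) : f = g := by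
  apply Over.OverMorphism.ext
  apply AffineSpace.hom_ext
  · exact congrArg CommaMorphism.left h₁
  · intro _
    exact h₂

lemma linePair_proj {S T : CScheme} (p : T ⟶ S) (t : Fn T) : linePair p t ≫ lineProj S = p := by
  apply Over.OverMorphism.ext
  exact AffineSpace.homOfVector_over _ _

lemma pull_linePair {S T : CScheme} (p : T ⟶ S) (t : Fn T) :
    pull (linePair p t) (lineCoord S) = t :=
  AffineSpace.homOfVector_appTop_coord _ _ _

lemma pull_comp {S T U : CScheme} (f : S ⟶ T) (g : T ⟶ U) (u : Fn U) :
    pull (f ≫ g) u = pull f (pull g u) := by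
  unfold pull
  rw [Over.comp_left, Scheme.Hom.comp_appTop]
  rfl

/-- The action of `ℂ₊` on `S × ℂ` by translations on the second factor. -/
def translation (S : CScheme) : GaAction (line S) where
  act s x := linePair (x ≫ lineProj S) (s + pull x (lineCoord S))
  act_zero x := by
    apply line_hom_ext
    · rw [linePair_proj]
    · rw [pull_linePair, zero_add]
  act_add s t x := by
    apply line_hom_ext
    · simp only [linePair_proj]
    · simp only [pull_linePair, add_assoc]
  act_natural f s x := by
    apply line_hom_ext
    · rw [Category.assoc, linePair_proj, linePair_proj, Category.assoc]
    · rw [pull_comp, pull_linePair, pull_linePair, map_add, pull_comp]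

/-- An open subscheme of a complex scheme. -/
def openSub (Z : CScheme) (U : Z.left.Opens) : CScheme := Over.mk (U.ι ≫ Z.hom)

/-- The inclusion of an open subscheme. -/
def openIncl (Z : CScheme) (U : Z.left.Opens) : openSub Z U ⟶ Z := Over.homMk U.ι rfl

/-- A principal homogeneous `ℂ₊`-bundle structure on `X` over `Z`: a morphism `proj : X ⟶ Z` and
an action of `ℂ₊` on `X` such that `Z` is covered by open subschemes `U` for which `proj⁻¹(U)` is
equivariantly isomorphic, over `U`, to `U × ℂ` on which `ℂ₊` acts by translations.
(The fibre square says that `e` is an isomorphism of `U × ℂ` onto `proj⁻¹(U)` over `U`.) -/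
@[ext]
structure PrincipalBundle (X Z : CScheme) where
  proj : X ⟶ Z
  action : GaAction X
  locally_trivial : ∀ z : Z.left, ∃ (U : Z.left.Opens) (e : line (openSub Z U) ⟶ X), z ∈ U ∧
    IsPullback e (lineProj (openSub Z U)) proj (openIncl Z U) ∧
    (translation (openSub Z U)).Equivariant action e

/-! ### The affine space with a multiple system of coordinate hyperplanes -/

/-- The polynomial ring `ℂ[x₁, …, xₙ]`. -/
abbrev Poly (n : ℕ) := MvPolynomial (Fin n) ℂ

/-- The affine space `ℂⁿ`. -/
abbrev affineN (n : ℕ) : CScheme := affineOver (Poly n)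

/-- The product `x₁ ⋯ xₙ` of the coordinates. -/
def coordProd (n : ℕ) : Poly n := ∏ k, MvPolynomial.X k

/-- The open subset `(ℂ*)ⁿ` of `ℂⁿ`, complement of the coordinate hyperplanes. -/
def torus (n : ℕ) : (affineN n).left.Opens := PrimeSpectrum.basicOpen (coordProd n)

/-- The open subset of the `i`-th copy of `ℂⁿ` which is identified with an open subset of the
`j`-th copy: `(ℂ*)ⁿ` if `i ≠ j`. -/
def overlap (n : ℕ) {r : ℕ} (i j : Fin r) : (affineN n).left.Opens := if i = j then ⊤ else torus n

lemma overlap_comm (n : ℕ) {r : ℕ} (i j : Fin r) : overlap n i j = overlap n j i := by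
  simp only [overlap, eq_comm]

lemma overlap_inf_le (n : ℕ) {r : ℕ} (i j k : Fin r) :
    overlap n i j ⊓ overlap n i k ≤ overlap n j k := by
  unfold overlap
  by_cases h₁ : i = j <;> by_cases h₂ : i = k <;> by_cases h₃ : j = k <;> simp_all

lemma range_overlap_subset (n : ℕ) {r : ℕ} (i j k : Fin r) :
    Set.range (pullback.fst (overlap n i j).ι (overlap n i k).ι ≫ (overlap n i j).ι) ⊆
      Set.range (overlap n j k).ι := by
  rintro _ ⟨p, rfl⟩
  rw [Scheme.Opens.range_ι]
  apply overlap_inf_le n i j k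
  refine ⟨?_, ?_⟩
  · rw [Scheme.Hom.comp_apply]
    exact (pullback.fst (overlap n i j).ι (overlap n i k).ι p).2
  · rw [pullback.condition, Scheme.Hom.comp_apply]
    exact (pullback.snd (overlap n i j).ι (overlap n i k).ι p).2

/-- The identification of triple overlaps, as a morphism compatible with the inclusions of the
overlaps in `ℂⁿ`. -/
def overlapMap (n : ℕ) {r : ℕ} (i j k : Fin r) :
    pullback (overlap n i j).ι (overlap n i k).ι ⟶ pullback (overlap n j k).ι (overlap n j i).ι :=
  pullback.lift
    (IsOpenImmersion.lift (overlap n j k).ι (pullback.fst _ _ ≫ (overlap n i j).ι)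
      (range_overlap_subset n i j k))
    (pullback.fst _ _ ≫ ((affineN n).left.isoOfEq (overlap_comm n i j)).hom) (by
      rw [IsOpenImmersion.lift_fac, Category.assoc, Scheme.isoOfEq_hom_ι])

lemma overlapMap_fst (n : ℕ) {r : ℕ} (i j k : Fin r) :
    overlapMap n i j k ≫ pullback.fst _ _ ≫ (overlap n j k).ι =
      pullback.fst _ _ ≫ (overlap n i j).ι := by
  rw [overlapMap, pullback.lift_fst_assoc, IsOpenImmersion.lift_fac]

/-- Gluing data for `r` copies of `ℂⁿ` along `(ℂ*)ⁿ` by the identity. -/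
def glueData (n r : ℕ) : Scheme.GlueData.{0} where
  J := Fin r
  U _ := (affineN n).left
  V ij := (overlap n ij.1 ij.2).toScheme
  f i j := (overlap n i j).ι
  t i j := ((affineN n).left.isoOfEq (overlap_comm n i j)).hom
  t_id i := by simp
  t' i j k := overlapMap n i j k
  t_fac i j k := pullback.lift_snd _ _ _
  cocycle i j k := by
    rw [← cancel_mono (pullback.fst _ _), ← cancel_mono (overlap n i j).ι]
    simp only [Category.assoc, Category.id_comp]
    rw [overlapMap_fst, overlapMap_fst, overlapMap_fst]
  f_id i := by
    have h : overlap n i i = ⊤ := if_pos rfl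
    rw [h]
    exact (Scheme.topIso _).isIso_hom
  f_open i j := inferInstance

/-- The morphism from the glued scheme to `ℂⁿ` which is the identity on every copy of `ℂⁿ`. -/
def gluedToAffine (n r : ℕ) : (glueData n r).glued ⟶ (affineN n).left :=
  Multicoequalizer.desc _ _ (fun _ => 𝟙 (affineN n).left) (by
    rintro ⟨i, j⟩
    change (overlap n i j).ι ≫ 𝟙 _ =
      (((affineN n).left.isoOfEq (overlap_comm n i j)).hom ≫ (overlap n j i).ι) ≫ 𝟙 _
    rw [Scheme.isoOfEq_hom_ι])

/-- The affine `n`-space with an `r`-fold system of coordinate hyperplanes `Z_{n,r}`. -/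
def multiSpace (n r : ℕ) : CScheme := Over.mk (gluedToAffine n r ≫ (affineN n).hom)

/-- The structural morphism `δ : Z_{n,r} ⟶ ℂⁿ`. -/
def delta (n r : ℕ) : multiSpace n r ⟶ affineN n := Over.homMk (gluedToAffine n r) rfl

/-- The open immersion of the `i`-th copy of `ℂⁿ` in `Z_{n,r}`. -/
def chart (n : ℕ) {r : ℕ} (i : Fin r) : affineN n ⟶ multiSpace n r :=
  Over.homMk ((glueData n r).ι i) (by
    change (glueData n r).ι i ≫ gluedToAffine n r ≫ (affineN n).hom = (affineN n).hom
    have h : (glueData n r).ι i ≫ gluedToAffine n r = 𝟙 (affineN n).left :=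
      Multicoequalizer.π_desc _ _ _ _ _
    rw [← Category.assoc, h]
    exact Category.id_comp _)

/-! ### The hypersurfaces `X_{[m],σ}` -/

/-- The coordinates `x₁, …, xₙ, y, z` of `ℂⁿ⁺²`. -/
inductive Coord (n : ℕ)
  | x (k : Fin n)
  | y
  | z

/-- The polynomial `x₁ ^ m₁ ⋯ xₙ ^ mₙ z - ∏ᵢ (y - σᵢ(x))`. -/
def equation {n r : ℕ} (m : Fin n → ℕ) (σ : Fin r → Poly n) : MvPolynomial (Coord n) ℂ :=
  (∏ k, MvPolynomial.X (Coord.x k) ^ m k) * MvPolynomial.X Coord.z -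
    ∏ i, (MvPolynomial.X Coord.y - MvPolynomial.rename Coord.x (σ i))

/-- The coordinate ring of `X_{[m],σ}`. -/
abbrev CoordRing {n r : ℕ} (m : Fin n → ℕ) (σ : Fin r → Poly n) : Type :=
  MvPolynomial (Coord n) ℂ ⧸ Ideal.span {equation m σ}

/-- The hypersurface `X_{[m],σ}` of `ℂⁿ⁺²`. -/
abbrev hypersurface {n r : ℕ} (m : Fin n → ℕ) (σ : Fin r → Poly n) : CScheme :=
  affineOver (CoordRing m σ)

/-- A coordinate as an element of the coordinate ring of `X_{[m],σ}`. -/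
def coord {n r : ℕ} (m : Fin n → ℕ) (σ : Fin r → Poly n) (v : Coord n) : CoordRing m σ :=
  Ideal.Quotient.mk _ (MvPolynomial.X v)

/-- The projection `pr_x : X_{[m],σ} ⟶ ℂⁿ`, `(x, y, z) ↦ x`. -/
def prX {n r : ℕ} (m : Fin n → ℕ) (σ : Fin r → Poly n) : hypersurface m σ ⟶ affineN n :=
  affineMap (MvPolynomial.aeval fun k => coord m σ (Coord.x k))

/-- The closed subset `{x₁ ⋯ xₙ = 0, y = σᵢ(0)}` of `X_{[m],σ}`. -/
def component {n r : ℕ} (m : Fin n → ℕ) (σ : Fin r → Poly n) (i : Fin r) :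
    Set (hypersurface m σ).left :=
  PrimeSpectrum.zeroLocus {∏ k, coord m σ (Coord.x k),
    coord m σ Coord.y - algebraMap ℂ (CoordRing m σ) (MvPolynomial.eval 0 (σ i))}

/-- The bundle structure `ρ : X_{[m],σ} ⟶ Z_{n,r}` given by the coordinates
`tᵢ = (y - σᵢ(x)) / (x₁ ^ m₁ ⋯ xₙ ^ mₙ)`. The morphism `ρ` factors `pr_x` and sends
`pr_x⁻¹((ℂ*)ⁿ) ∪ {x₁ ⋯ xₙ = 0, y = σᵢ(0)}`, and nothing else, to the `i`-th copy of `ℂⁿ`;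
`s ∈ ℂ₊` acts by `x ↦ x` and `y ↦ y + s x₁ ^ m₁ ⋯ xₙ ^ mₙ` (which is `tᵢ ↦ tᵢ + s`). -/
structure IsStandard {n r : ℕ} (m : Fin n → ℕ) (σ : Fin r → Poly n)
    (P : PrincipalBundle (hypersurface m σ) (multiSpace n r)) : Prop where
  proj_delta : P.proj ≫ delta n r = prX m σ
  preimage_chart : ∀ i, P.proj.left ⁻¹' Set.range (chart n i).left =
    (prX m σ).left ⁻¹' (torus n : Set (affineN n).left) ∪ component m σ i
  act_x : ∀ {T : CScheme} (s : Fn T) (p : T ⟶ hypersurface m σ) (k : Fin n),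
    pull (P.action.act s p) (toFn _ (coord m σ (Coord.x k))) =
      pull p (toFn _ (coord m σ (Coord.x k)))
  act_y : ∀ {T : CScheme} (s : Fn T) (p : T ⟶ hypersurface m σ),
    pull (P.action.act s p) (toFn _ (coord m σ Coord.y)) =
      pull p (toFn _ (coord m σ Coord.y)) +
        s * pull p (toFn _ (∏ k, coord m σ (Coord.x k) ^ m k))

end Danielewski

end

open CategoryTheory CategoryTheory.Limits AlgebraicGeometry

noncomputable section

namespace Danielewski

/-! ### Locally nilpotent derivations -/

section LocallyNilpotent

variable {R B : Type*} [CommRing R] [CommRing B] [Algebra R B]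

/-! Let B be the coordinate ring of X and K = ℂ(x₁, …, xₙ). Eliminating z embeds B in K[y]
(`toPoly`), and B has the ℂ[x]-basis y^b z^c with b < r, exactly one element in each y-degree b +
rc. All degrees below are degrees in y.

The core is that every nonzero locally nilpotent derivation D of B has kernel ℂ[x]. Suppose that the
kernel contains some f of positive degree. After D is multiplied by a power of f, the least amount e
≥ 0 by which it raises degrees is attained, and D induces a nonzero homogeneous locally nilpotent
derivation of the associated graded ring, in which x^[m] z = y^r. It kills the leading form of f,
hence y or z, because kernels are factorially closed. Since all m_k > 1, killing z forces killing y
(`map_y_eq_zero_of_map_z_eq_zero`); then all factors of y^r = x^[m] z are killed and the induced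
derivation is zero, a contradiction. So the kernel lies in ℂ[x]
(`natDegree_toPoly_eq_zero_of_map_eq_zero`), and a degree count with a local slice gives equality
(`map_xHom_eq_zero`). Actions of ℂ₊ are exponentials of such derivations, and invariants are
kernels, which gives (b).

For existence in (a), the function tᵢ = (y - σᵢ) / x^[m] = z / ∏_{j ≠ i} (y - σⱼ) is regular on the
open set Xᵢ obtained by removing from X all components of x₁⋯xₙ = 0 except the i-th, and (x, tᵢ)
identifies Xᵢ with ℂⁿ × ℂ. As the σᵢ(0) are distinct, different Xᵢ meet only over the torus, so the
projections glue to ρ : X → Z_{n,r}.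

For uniqueness, a bundle action is fixed point free. Its derivation satisfies D y = a x^[m] with a
in ℂ[x] (`exists_map_y_eq`), and a zero of a would produce a fixed point, so a is a nonzero constant
and the action is a rescaling of the standard one (`exists_action_eq_rescale`). The projection of a
bundle is a categorical quotient by its action, hence is determined up to an automorphism of the
base (`PrincipalBundle.exists_iso_of_action_eq_rescale`). -/

/-- A derivation is locally nilpotent if every element is killed by some iterate. -/
def LocallyNilpotent (D : Derivation R B B) : Prop := ∀ b, ∃ n, D^[n] b = 0

lemma iterate_eq_zero_of_le (D : Derivation R B B) {b : B} {i j : ℕ} (hij : i ≤ j)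
    (h : D^[i] b = 0) : D^[j] b = 0 := by
  obtain ⟨k, rfl⟩ := Nat.exists_eq_add_of_le' hij
  rw [Function.iterate_add_apply, h, iterate_map_zero]

lemma iterate_leibniz (D : Derivation R B B) (n : ℕ) (a b : B) :
    D^[n] (a * b) =
      ∑ ij ∈ Finset.HasAntidiagonal.antidiagonal n, (n.choose ij.1 : B) * (D^[ij.1] a * D^[ij.2] b) := by
  induction n with
  | zero => simp
  | succ n ih =>
    rw [Finset.sum_antidiagonal_choose_succ_mul (fun i j => D^[i] a * D^[j] b) n,
      Function.iterate_succ_apply', ih, map_sum, ← Finset.sum_add_distrib]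
    refine Finset.sum_congr rfl fun ij hij => ?_
    rw [Nat.choose_symm_of_eq_add (Finset.HasAntidiagonal.mem_antidiagonal.mp hij).symm,
      Derivation.leibniz, Derivation.leibniz, Derivation.map_natCast]
    simp only [smul_eq_mul, Function.iterate_succ_apply']
    ring

lemma LocallyNilpotent.exists_order {D : Derivation R B B} (hD : LocallyNilpotent D) {b : B}
    (hb : b ≠ 0) : ∃ n, D^[n] b ≠ 0 ∧ D^[n + 1] b = 0 := by
  classical
  have h := hD b
  obtain ⟨n, hn⟩ : ∃ n, Nat.find h = n + 1 :=
    Nat.exists_eq_succ_of_ne_zero fun h0 => hb (by simpa [h0] using Nat.find_spec h)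
  exact ⟨n, Nat.find_min h (by omega), hn ▸ Nat.find_spec h⟩

variable [IsDomain B] [CharZero B]

/-- Orders of nilpotency add up: in the Leibniz expansion every term other than (i, j)
differentiates a more than i times or b more than j times, and the binomial coefficient of the
remaining one is nonzero in characteristic zero. -/
lemma iterate_mul_ne_zero (D : Derivation R B B) {a b : B} {i j : ℕ} (ha : D^[i] a ≠ 0)
    (ha' : D^[i + 1] a = 0) (hb : D^[j] b ≠ 0) (hb' : D^[j + 1] b = 0) :
    D^[i + j] (a * b) ≠ 0 := by
  rw [iterate_leibniz, Finset.sum_eq_single (i, j)]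
  · simp [ha, hb, (Nat.choose_pos (Nat.le_add_right i j)).ne']
  · rintro ⟨k, l⟩ hkl hne
    rw [Finset.HasAntidiagonal.mem_antidiagonal] at hkl
    dsimp only at hkl ⊢
    rcases lt_trichotomy k i with h | rfl | h
    · rw [iterate_eq_zero_of_le D (by omega : j + 1 ≤ l) hb', mul_zero, mul_zero]
    · exact absurd (by rw [Nat.add_left_cancel hkl]) hne
    · rw [iterate_eq_zero_of_le D (by omega : i + 1 ≤ k) ha', zero_mul, mul_zero]
  · simp

/-- The order of nilpotency does not decrease when one passes to a multiple. -/
lemma LocallyNilpotent.iterate_ne_zero_of_dvd {D : Derivation R B B} (hD : LocallyNilpotent D)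
    {a b : B} (hab : a ∣ b) (hb : b ≠ 0) {n : ℕ} (h : D^[n] a ≠ 0) : D^[n] b ≠ 0 := by
  obtain ⟨c, rfl⟩ := hab
  obtain ⟨i, hi, hi'⟩ := hD.exists_order (left_ne_zero_of_mul hb)
  obtain ⟨j, hj, hj'⟩ := hD.exists_order (right_ne_zero_of_mul hb)
  intro h0
  refine iterate_mul_ne_zero D hi hi' hj hj' (iterate_eq_zero_of_le D ?_ h0)
  by_contra! hlt
  exact h (iterate_eq_zero_of_le D (by omega : i + 1 ≤ n) hi')

/-- Factorial closedness of the kernel, used throughout to pass from a product to its factors. -/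
lemma LocallyNilpotent.map_eq_zero_of_dvd {D : Derivation R B B} (hD : LocallyNilpotent D)
    {a b : B} (hab : a ∣ b) (hb : b ≠ 0) (h : D b = 0) : D a = 0 := by
  by_contra h1
  exact hD.iterate_ne_zero_of_dvd hab hb (n := 1) h1 h

/-- If `a` divides `D b` and `b` divides `D a`, then `D a = 0` or `D b = 0`. -/
lemma LocallyNilpotent.map_eq_zero_of_dvd_of_dvd {D : Derivation R B B}
    (hD : LocallyNilpotent D) {a b : B} (hab : a ∣ D b) (hba : b ∣ D a) (hb : D b ≠ 0) :
    D a = 0 := by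
  by_contra ha
  -- If D a has order n, then a has order n + 1, so D b, a multiple of a, has order at least n + 1
  -- and b at least n + 2. As D a is a multiple of b, its order would exceed n.
  obtain ⟨n, hn, hn'⟩ := hD.exists_order ha
  have h1 : D^[n + 1] a ≠ 0 := by rwa [Function.iterate_succ_apply]
  have h2 : D^[n + 2] b ≠ 0 := by
    rw [Function.iterate_succ_apply]
    exact hD.iterate_ne_zero_of_dvd hab hb h1
  exact hD.iterate_ne_zero_of_dvd hba ha
    (fun h => h2 (iterate_eq_zero_of_le D (Nat.le_succ (n + 1)) h)) hn'

lemma LocallyNilpotent.map_eq_zero_of_dvd_self {D : Derivation R B B}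
    (hD : LocallyNilpotent D) {a : B} (h : a ∣ D a) : D a = 0 := by
  by_contra ha
  exact ha (hD.map_eq_zero_of_dvd_of_dvd h h ha)

/-- Every element becomes, after multiplication by an element of the kernel, a polynomial in a
local slice with coefficients in the kernel. -/
lemma LocallyNilpotent.exists_polynomial {D : Derivation R B B} (hD : LocallyNilpotent D)
    {s : B} (hs : D s ≠ 0) (hs' : D (D s) = 0) (b : B) :
    ∃ (q : B) (Q : Polynomial B), q ≠ 0 ∧ D q = 0 ∧ (∀ i, D (Q.coeff i) = 0) ∧
      q * b = Q.eval s := by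
  -- Induction on the nilpotency order: the top term of b in the slice s is subtracted, as in a
  -- Taylor expansion, with the denominator n! (D s)ⁿ cleared.
  have key : ∀ n b, D^[n] b = 0 → ∃ (q : B) (Q : Polynomial B), q ≠ 0 ∧ D q = 0 ∧
      (∀ i, D (Q.coeff i) = 0) ∧ q * b = Q.eval s := by
    intro n
    induction n with
    | zero => exact fun b hb => ⟨1, 0, one_ne_zero, by simp, by simp, by simpa using hb⟩
    | succ n ih =>
      intro b hb
      have hp : ∀ i j, D ((D s) ^ i * D^[n] b ^ j) = 0 := fun i j => by
        rw [Function.iterate_succ_apply'] at hb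
        simp [Derivation.leibniz, Derivation.leibniz_pow, hs', hb]
      have hsn : ∀ i c, D c = 0 → D^[i] (c * s ^ i) = i.factorial * c * D s ^ i := by
        intro i
        induction i with
        | zero => intro c _; simp
        | succ i ih =>
          intro c hc
          have h1 : D (c * s ^ (i + 1)) = ((i + 1 : ℕ) * c * D s) * s ^ i := by
            simp only [Derivation.leibniz, Derivation.leibniz_pow, hc, smul_eq_mul,
              nsmul_eq_mul, mul_zero, add_zero, add_tsub_cancel_right]
            ring
          rw [Function.iterate_succ_apply, h1, ih]
          · rw [Nat.factorial_succ]
            push_cast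
            ring
          · simp [Derivation.leibniz, hc, hs']
      have hmul : ∀ i c b, D c = 0 → D^[i] (c * b) = c * D^[i] b := by
        intro i c b hc
        induction i with
        | zero => rfl
        | succ i ih => simp [Function.iterate_succ_apply', ih, Derivation.leibniz, hc]
      have hq : D (n.factorial * D s ^ n) = 0 := by
        simp [Derivation.leibniz, Derivation.leibniz_pow, hs']
      -- Both terms have n-th iterate n! (D s)ⁿ D^[n] b, so the difference is killed by D^[n].
      obtain ⟨q, Q, hq0, hDq, hQ, h⟩ := ih (n.factorial * D s ^ n * b - D^[n] b * s ^ n) (by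
        rw [iterate_map_sub, hmul _ _ _ hq, hsn _ _ (by simpa using hp 0 1)]
        ring)
      refine ⟨q * (n.factorial * D s ^ n), Q + Polynomial.monomial n (q * D^[n] b),
        mul_ne_zero hq0 (mul_ne_zero (by exact_mod_cast n.factorial_ne_zero) (pow_ne_zero _ hs)),
        by rw [Derivation.leibniz, hq, hDq]; simp, fun i => ?_, ?_⟩
      · rw [Polynomial.coeff_add, map_add, hQ, Polynomial.coeff_monomial, zero_add]
        split_ifs
        · have := hp 0 1
          simp only [pow_zero, pow_one, one_mul] at this
          rw [Derivation.leibniz, this, hDq]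
          simp
        · simp
      · rw [Polynomial.eval_add, ← h, Polynomial.eval_monomial]
        ring
  obtain ⟨n, hn⟩ := hD b
  exact key n b hn

end LocallyNilpotent

/-! ### The coordinate ring of the hypersurface -/

/-- The monomial `x₁ ^ m₁ ⋯ xₙ ^ mₙ`. -/
def monom {n : ℕ} (m : Fin n → ℕ) : Poly n := ∏ k, MvPolynomial.X k ^ m k

lemma monom_ne_zero {n : ℕ} (m : Fin n → ℕ) : monom m ≠ 0 :=
  Finset.prod_ne_zero_iff.mpr fun k _ => pow_ne_zero _ (MvPolynomial.X_ne_zero k)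

section CoordRing

variable {n r : ℕ} (m : Fin n → ℕ) (σ : Fin r → Poly n)

/-- The inclusion of `ℂ[x₁, …, xₙ]` in the coordinate ring. -/
def xHom : Poly n →ₐ[ℂ] CoordRing m σ :=
  MvPolynomial.aeval fun k => coord m σ (Coord.x k)

lemma xHom_X (k : Fin n) : xHom m σ (MvPolynomial.X k) = coord m σ (Coord.x k) :=
  MvPolynomial.aeval_X _ _

lemma mk_rename (p : Poly n) :
    Ideal.Quotient.mk (Ideal.span {equation m σ}) (MvPolynomial.rename Coord.x p) =
      xHom m σ p := by
  have h : ((Ideal.Quotient.mkₐ ℂ (Ideal.span {equation m σ})).comp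
      (MvPolynomial.rename Coord.x)) = xHom m σ := by
    apply MvPolynomial.algHom_ext
    intro k
    simp only [AlgHom.comp_apply, MvPolynomial.rename_X, xHom_X]
    rfl
  exact DFunLike.congr_fun h p

lemma xHom_monom : xHom m σ (monom m) = ∏ k, coord m σ (Coord.x k) ^ m k := by
  simp only [monom, map_prod, map_pow, xHom_X]

lemma xHom_coordProd : xHom m σ (coordProd n) = ∏ k, coord m σ (Coord.x k) := by
  simp only [coordProd, map_prod, xHom_X]

/-- The product of the factors `y - σᵢ(x)`, as an element of the coordinate ring. -/
lemma coord_relation : xHom m σ (monom m) * coord m σ Coord.z =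
    ∏ i, (coord m σ Coord.y - xHom m σ (σ i)) := by
  have h : Ideal.Quotient.mk (Ideal.span {equation m σ})
      ((∏ k, MvPolynomial.X (Coord.x k) ^ m k) * MvPolynomial.X Coord.z -
        ∏ i, (MvPolynomial.X Coord.y - MvPolynomial.rename Coord.x (σ i))) = 0 :=
    Ideal.Quotient.eq_zero_iff_mem.mpr (Ideal.mem_span_singleton_self _)
  rw [map_sub, sub_eq_zero] at h
  simp only [map_mul, map_prod, map_pow, map_sub, mk_rename] at h
  rw [xHom_monom]
  exact h

variable {m σ}

lemma coordRing_induction {p : CoordRing m σ → Prop} (b : CoordRing m σ)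
    (hx : ∀ a, p (xHom m σ a)) (hadd : ∀ b c, p b → p c → p (b + c))
    (hmx : ∀ b k, p b → p (b * coord m σ (Coord.x k)))
    (hmy : ∀ b, p b → p (b * coord m σ Coord.y))
    (hmz : ∀ b, p b → p (b * coord m σ Coord.z)) : p b := by
  obtain ⟨b, rfl⟩ := Ideal.Quotient.mk_surjective b
  induction b using MvPolynomial.induction_on with
  | C c =>
    have := hx (MvPolynomial.C c)
    rwa [← mk_rename, MvPolynomial.rename_C] at this
  | add b c hb hc => rw [map_add]; exact hadd _ _ hb hc
  | mul_X b v hb =>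
    rw [map_mul]
    cases v with
    | x k => exact hmx _ k hb
    | y => exact hmy _ hb
    | z => exact hmz _ hb

/-! ### Homomorphisms out of the coordinate ring -/

section Lift

variable {S : Type*} [CommRing S] [Algebra ℂ S]

/-- Ring homomorphisms out of the coordinate ring. -/
def coordLift (f : Poly n →ₐ[ℂ] S) (y z : S) (h : f (monom m) * z = ∏ i, (y - f (σ i))) :
    CoordRing m σ →ₐ[ℂ] S :=
  Ideal.Quotient.liftₐ _ (MvPolynomial.aeval fun v => match v with
    | Coord.x k => f (MvPolynomial.X k)
    | Coord.y => y
    | Coord.z => z) (by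
    intro a ha
    obtain ⟨c, rfl⟩ := Ideal.mem_span_singleton'.mp ha
    rw [map_mul]
    convert mul_zero _
    have hf : ∀ p : Poly n, MvPolynomial.aeval (fun v : Coord n => match v with
        | Coord.x k => f (MvPolynomial.X k)
        | Coord.y => y
        | Coord.z => z) (MvPolynomial.rename Coord.x p) = f p := by
      intro p
      rw [MvPolynomial.aeval_rename]
      exact DFunLike.congr_fun (MvPolynomial.algHom_ext
        (A := S) (f := MvPolynomial.aeval _) (g := f) fun k => by simp) p
    simp only [equation, map_sub, map_mul, map_prod, map_pow, MvPolynomial.aeval_X, hf, ← h]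
    rw [monom]
    simp only [map_prod, map_pow, sub_self])

variable (f : Poly n →ₐ[ℂ] S) (y z : S) (h : f (monom m) * z = ∏ i, (y - f (σ i)))

lemma coordLift_y : coordLift f y z h (coord m σ Coord.y) = y :=
  (Ideal.Quotient.lift_mk _ _ _).trans (MvPolynomial.aeval_X _ _)

lemma coordLift_z : coordLift f y z h (coord m σ Coord.z) = z :=
  (Ideal.Quotient.lift_mk _ _ _).trans (MvPolynomial.aeval_X _ _)

lemma coordLift_coord_x (k : Fin n) :
    coordLift f y z h (coord m σ (Coord.x k)) = f (MvPolynomial.X k) :=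
  (Ideal.Quotient.lift_mk _ _ _).trans (MvPolynomial.aeval_X _ _)

lemma coordLift_comp_xHom : (coordLift f y z h).comp (xHom m σ) = f := by
  apply MvPolynomial.algHom_ext
  intro k
  rw [AlgHom.comp_apply, xHom_X, coordLift_coord_x]

lemma coordLift_xHom (a : Poly n) : coordLift f y z h (xHom m σ a) = f a :=
  DFunLike.congr_fun (coordLift_comp_xHom f y z h) a

lemma coordRing_ringHom_ext {S : Type*} [CommRing S] {f g : CoordRing m σ →+* S}
    (hx : ∀ a, f (xHom m σ a) = g (xHom m σ a))
    (hy : f (coord m σ Coord.y) = g (coord m σ Coord.y))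
    (hz : f (coord m σ Coord.z) = g (coord m σ Coord.z)) : f = g := by
  refine RingHom.ext fun b => ?_
  induction b using coordRing_induction with
  | hx a => exact hx a
  | hadd b c hb hc => rw [map_add, map_add, hb, hc]
  | hmx b k hb => rw [map_mul, map_mul, hb, ← xHom_X, hx]
  | hmy b hb => rw [map_mul, map_mul, hb, hy]
  | hmz b hb => rw [map_mul, map_mul, hb, hz]

/-- Homomorphisms to a ring in which the monomial `x ^ [m]` is not a zero divisor are determined
by the images of `x` and `y`. -/
lemma coordRing_ringHom_ext_of_mem_nonZeroDivisors {S : Type*} [CommRing S]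
    {f g : CoordRing m σ →+* S} (hx : ∀ a, f (xHom m σ a) = g (xHom m σ a))
    (hy : f (coord m σ Coord.y) = g (coord m σ Coord.y))
    (hM : f (xHom m σ (monom m)) ∈ nonZeroDivisors S) : f = g := by
  refine coordRing_ringHom_ext hx hy ((mul_cancel_left_mem_nonZeroDivisors hM).mp ?_)
  have h := coord_relation m σ
  rw [← map_mul, h, hx, ← map_mul, h, map_prod, map_prod]
  simp only [map_sub, hx, hy]

end Lift

/-! ### The degree in `y` -/

variable (m σ) in
/-- The elements `y ^ b z ^ c` with `b < r`, indexed by `b + r c`. They form a basis of the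
coordinate ring over `ℂ[x₁, …, xₙ]`. -/
def basisElt (d : ℕ) : CoordRing m σ := coord m σ Coord.y ^ (d % r) * coord m σ Coord.z ^ (d / r)

variable (m σ) in
/-- Linear combinations of the elements `basisElt m σ d`. -/
def comb : (ℕ →₀ Poly n) →+ CoordRing m σ :=
  Finsupp.liftAddHom fun d =>
    (AddMonoidHom.mulRight (basisElt m σ d)).comp (xHom m σ : Poly n →+* _).toAddMonoidHom

lemma comb_single (d : ℕ) (a : Poly n) :
    comb m σ (Finsupp.single d a) = xHom m σ a * basisElt m σ d := by
  simp [comb]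

lemma comb_apply (c : ℕ →₀ Poly n) :
    comb m σ c = ∑ d ∈ c.support, xHom m σ (c d) * basisElt m σ d := by
  simp [comb, Finsupp.sum]

/-- The polynomial `∏ᵢ (Y - σᵢ(x))` in `Y` with coefficients in the fraction field. -/
def prodPoly (σ : Fin r → Poly n) : Polynomial (FractionRing (Poly n)) :=
  ∏ i, (Polynomial.X - Polynomial.C (algebraMap _ _ (σ i)))

lemma prodPoly_monic : (prodPoly σ).Monic := Polynomial.monic_prod_X_sub_C _ _

lemma natDegree_prodPoly : (prodPoly σ).natDegree = r := by
  simp [prodPoly]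

/-- With `coord_relation` this becomes the rewriting rule that replaces y^r by x^[m] z minus terms
of lower degree in y. -/
lemma exists_prod_eq : ∃ c : Fin r → Poly n, ∏ i, (coord m σ Coord.y - xHom m σ (σ i)) =
    coord m σ Coord.y ^ r + ∑ j : Fin r, xHom m σ (c j) * coord m σ Coord.y ^ (j : ℕ) := by
  let p : Polynomial (Poly n) := ∏ i, (Polynomial.X - Polynomial.C (σ i))
  have hp : p.Monic := Polynomial.monic_prod_X_sub_C _ _
  have hd : p.natDegree = r := by simp [p]
  refine ⟨fun j => p.coeff j, ?_⟩
  have h : ∏ i, (coord m σ Coord.y - xHom m σ (σ i)) =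
      p.eval₂ (xHom m σ : Poly n →+* _) (coord m σ Coord.y) := by
    simp [p, Polynomial.eval₂_finsetProd]
  rw [h, Polynomial.eval₂_eq_sum_range, hd, Finset.sum_range_succ, Finset.sum_range, add_comm]
  congr 1
  have : p.coeff r = 1 := by rw [← hd]; exact hp
  rw [this]
  simp

/-- The span of the basis elements contains ℂ[x] and is stable under multiplication by each
generator. Only y · y^(r-1) z^c leaves the list of basis elements and has to be rewritten by the
relation. -/
lemma comb_surjective (hr : 0 < r) : Function.Surjective (comb m σ) := by
  suffices h : ∀ b, b ∈ (comb m σ).range from h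
  have hw : ∀ a d, xHom m σ a * basisElt m σ d ∈ (comb m σ).range :=
    fun a d => ⟨_, comb_single d a⟩
  have hmul : ∀ t, (∀ a d, xHom m σ a * basisElt m σ d * t ∈ (comb m σ).range) →
      ∀ b ∈ (comb m σ).range, b * t ∈ (comb m σ).range := by
    rintro t ht _ ⟨c, rfl⟩
    rw [comb_apply, Finset.sum_mul]
    exact AddSubgroup.sum_mem _ fun d _ => ht _ _
  have hwz : ∀ d, basisElt m σ d * coord m σ Coord.z = basisElt m σ (d + r) := fun d => by
    rw [basisElt, basisElt, Nat.add_mod_right, Nat.add_div_right _ hr, pow_succ, mul_assoc]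
  intro b
  induction b using coordRing_induction with
  | hx a =>
    have := hw a 0
    rwa [basisElt, Nat.zero_mod, Nat.zero_div, pow_zero, pow_zero, mul_one, mul_one] at this
  | hadd b c hb hc => exact add_mem hb hc
  | hmx b k hb =>
    refine hmul _ (fun a d => ?_) b hb
    rw [mul_right_comm, ← xHom_X, ← map_mul]
    exact hw _ _
  | hmz b hb =>
    refine hmul _ (fun a d => ?_) b hb
    rw [mul_assoc, hwz]
    exact hw _ _
  | hmy b hb =>
    refine hmul _ (fun a d => ?_) b hb
    by_cases hd : d % r + 1 < r
    · have h1 : (d + 1) % r = d % r + 1 := by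
        rw [← Nat.mod_add_mod, Nat.mod_eq_of_lt hd]
      have h2 : (d + 1) / r = d / r := by
        have e1 := Nat.div_add_mod d r
        have e2 := Nat.div_add_mod (d + 1) r
        rw [h1] at e2
        exact Nat.eq_of_mul_eq_mul_left hr (by omega)
      have h3 : basisElt m σ d * coord m σ Coord.y = basisElt m σ (d + 1) := by
        rw [basisElt, basisElt, h1, h2, pow_succ]
        ring
      rw [mul_assoc, h3]
      exact hw _ _
    -- The carry case: y^r z^c is x^[m] z^(c+1) minus combinations of y^j z^c with j < r.
    · have h1 : d % r + 1 = r := by have := Nat.mod_lt d hr; omega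
      obtain ⟨c, hc⟩ := exists_prod_eq (m := m) (σ := σ)
      rw [← coord_relation, ← sub_eq_iff_eq_add] at hc
      have h2 : basisElt m σ d * coord m σ Coord.y =
          xHom m σ (monom m) * basisElt m σ (r * (d / r + 1)) -
            ∑ j : Fin r, xHom m σ (c j) * basisElt m σ (j + r * (d / r)) := by
        have e1 : ∀ j : Fin r, basisElt m σ (j + r * (d / r)) =
            coord m σ Coord.y ^ (j : ℕ) * coord m σ Coord.z ^ (d / r) := fun j => by
          rw [basisElt, Nat.add_mul_mod_self_left, Nat.mod_eq_of_lt j.2,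
            Nat.add_mul_div_left _ _ hr, Nat.div_eq_of_lt j.2, zero_add]
        have e2 : basisElt m σ (r * (d / r + 1)) = coord m σ Coord.z ^ (d / r + 1) := by
          rw [basisElt, Nat.mul_mod_right, Nat.mul_div_cancel_left _ hr, pow_zero, one_mul]
        simp only [e1, e2]
        rw [basisElt, mul_right_comm, ← pow_succ, h1, ← hc, sub_mul, Finset.sum_mul]
        simp only [mul_assoc, pow_succ']
      rw [mul_assoc, h2, mul_sub, Finset.mul_sum, ← mul_assoc, ← map_mul]
      refine sub_mem (hw _ _) (AddSubgroup.sum_mem _ fun j _ => ?_)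
      rw [← mul_assoc, ← map_mul]
      exact hw _ _

variable (m σ) in
/-- The embedding of the coordinate ring in the ring of polynomials in `y` over `ℂ(x₁, …, xₙ)`. -/
def toPoly : CoordRing m σ →ₐ[ℂ] Polynomial (FractionRing (Poly n)) :=
  coordLift ((Algebra.ofId (Poly n) (Polynomial (FractionRing (Poly n)))).restrictScalars ℂ)
    Polynomial.X (Polynomial.C (algebraMap _ _ (monom m))⁻¹ * prodPoly σ) (by
      rw [← mul_assoc]
      simp only [AlgHom.coe_restrictScalars', Algebra.ofId_apply, Polynomial.algebraMap_apply]
      rw [← Polynomial.C_mul, mul_inv_cancel₀, map_one, one_mul, prodPoly]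
      simpa using monom_ne_zero m)

lemma toPoly_xHom (a : Poly n) :
    toPoly m σ (xHom m σ a) = Polynomial.C (algebraMap _ _ a) :=
  coordLift_xHom _ _ _ _ _

lemma toPoly_y : toPoly m σ (coord m σ Coord.y) = Polynomial.X := coordLift_y _ _ _ _

lemma toPoly_z : toPoly m σ (coord m σ Coord.z) =
    Polynomial.C (algebraMap _ _ (monom m))⁻¹ * prodPoly σ := coordLift_z _ _ _ _

lemma algebraMap_ne_zero {a : Poly n} (ha : a ≠ 0) :
    algebraMap (Poly n) (FractionRing (Poly n)) a ≠ 0 := by simpa using ha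

/-- The reason for the indexing by b + rc: z has degree r in y, so the index is the degree and
distinct basis elements have distinct degrees. No cancellation of leading terms is then possible in
`comb`. -/
lemma natDegree_toPoly_basisElt (d : ℕ) : (toPoly m σ (basisElt m σ d)).natDegree = d := by
  have h := inv_ne_zero (algebraMap_ne_zero (monom_ne_zero m))
  rw [basisElt, map_mul, map_pow, map_pow, toPoly_y, toPoly_z, Polynomial.natDegree_mul,
    Polynomial.natDegree_pow, Polynomial.natDegree_pow, Polynomial.natDegree_C_mul h,
    natDegree_prodPoly, Polynomial.natDegree_X, mul_one]
  · exact Nat.mod_add_div' d r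
  · exact pow_ne_zero _ Polynomial.X_ne_zero
  · exact pow_ne_zero _ (mul_ne_zero (by simpa using h) prodPoly_monic.ne_zero)

lemma coeff_toPoly_basisElt_ne_zero (d : ℕ) : (toPoly m σ (basisElt m σ d)).coeff d ≠ 0 := by
  have h := inv_ne_zero (algebraMap_ne_zero (monom_ne_zero m))
  nth_rw 2 [← natDegree_toPoly_basisElt (m := m) (σ := σ) d]
  rw [Polynomial.coeff_natDegree, Polynomial.leadingCoeff_ne_zero, basisElt, map_mul, map_pow,
    map_pow, toPoly_y, toPoly_z]
  exact mul_ne_zero (pow_ne_zero _ Polynomial.X_ne_zero)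
    (pow_ne_zero _ (mul_ne_zero (by simpa using h) prodPoly_monic.ne_zero))

lemma coeff_toPoly_comb {c : ℕ →₀ Poly n} {d : ℕ} (hc : ∀ j, d < j → c j = 0) :
    (toPoly m σ (comb m σ c)).coeff d =
      algebraMap _ _ (c d) * (toPoly m σ (basisElt m σ d)).coeff d := by
  rw [comb_apply, map_sum, Polynomial.finsetSum_coeff]
  simp only [map_mul, toPoly_xHom, Polynomial.coeff_C_mul]
  rw [Finset.sum_eq_single d]
  · intro j hj hjd
    have : j ≤ d := by
      by_contra! h
      exact (Finsupp.mem_support_iff.mp hj) (hc j h)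
    rw [Polynomial.coeff_eq_zero_of_natDegree_lt, mul_zero]
    rw [natDegree_toPoly_basisElt]
    omega
  · intro h
    rw [Finsupp.notMem_support_iff.mp h, map_zero, zero_mul]

/-- The degree of a linear combination is the largest index which occurs. -/
lemma apply_eq_zero_of_natDegree_le {c : ℕ →₀ Poly n} {d : ℕ}
    (hd : (toPoly m σ (comb m σ c)).natDegree ≤ d) {j : ℕ} (hj : d < j) : c j = 0 := by
  by_contra hcj
  have hne : c.support.Nonempty := ⟨j, Finsupp.mem_support_iff.mpr hcj⟩
  have hle := c.support.le_max' j (Finsupp.mem_support_iff.mpr hcj)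
  have h := coeff_toPoly_comb (m := m) (σ := σ) (c := c) (d := c.support.max' hne)
    fun i hi => by
      by_contra h
      exact absurd (c.support.le_max' i (Finsupp.mem_support_iff.mpr h)) (by omega)
  rw [Polynomial.coeff_eq_zero_of_natDegree_lt (by omega)] at h
  exact mul_ne_zero (algebraMap_ne_zero
    (Finsupp.mem_support_iff.mp (c.support.max'_mem hne)))
    (coeff_toPoly_basisElt_ne_zero _) h.symm

/-- Linear independence by degrees: a combination of image zero has no coefficient in positive
index, and index 0 contributes an element of ℂ[x], which embeds in K. -/
lemma toPoly_injective (hr : 0 < r) : Function.Injective (toPoly m σ) := by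
  rw [injective_iff_map_eq_zero]
  intro b hb
  obtain ⟨c, rfl⟩ := comb_surjective hr b
  have h0 : ∀ j, 0 < j → c j = 0 :=
    fun j hj => apply_eq_zero_of_natDegree_le (m := m) (σ := σ) (by rw [hb]; simp) hj
  have h := coeff_toPoly_comb (m := m) (σ := σ) h0
  rw [hb, Polynomial.coeff_zero, zero_eq_mul,
    or_iff_left (coeff_toPoly_basisElt_ne_zero _)] at h
  have : c = 0 := by
    ext1 j
    rcases Nat.eq_zero_or_pos j with rfl | hj
    · exact (map_eq_zero_iff _ (IsFractionRing.injective _ _)).mp h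
    · exact h0 j hj
  rw [this, map_zero]

lemma coordRing_isDomain (hr : 0 < r) : IsDomain (CoordRing m σ) :=
  (toPoly_injective hr).isDomain (toPoly m σ).toRingHom

/-- The leading coefficient of an element of degree at most `d` is a multiple of that of the
basis element of degree `d`. -/
lemma exists_coeff_eq (hr : 0 < r) {b : CoordRing m σ} {d : ℕ}
    (hd : (toPoly m σ b).natDegree ≤ d) : ∃ a : Poly n, (toPoly m σ b).coeff d =
      algebraMap _ _ a * (toPoly m σ (basisElt m σ d)).coeff d := by
  obtain ⟨c, rfl⟩ := comb_surjective hr b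
  exact ⟨c d, coeff_toPoly_comb fun j hj => apply_eq_zero_of_natDegree_le hd hj⟩

/-- Degree zero only says that the image lies in K; the basis shows that it has no denominator,
since the basis element of index 0 is 1. -/
lemma exists_xHom_eq (hr : 0 < r) {b : CoordRing m σ} (hd : (toPoly m σ b).natDegree = 0) :
    ∃ a, xHom m σ a = b := by
  obtain ⟨a, ha⟩ := exists_coeff_eq hr hd.le
  refine ⟨a, toPoly_injective hr ?_⟩
  rw [toPoly_xHom, Polynomial.eq_C_of_natDegree_eq_zero hd, ha]
  simp [basisElt]

lemma xHom_injective : Function.Injective (xHom m σ) := by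
  intro a b h
  have := congrArg (toPoly m σ) h
  rw [toPoly_xHom, toPoly_xHom] at this
  exact IsFractionRing.injective _ (FractionRing (Poly n)) (Polynomial.C_injective this)

end CoordRing

/-! ### The associated graded derivation -/

section Graded

variable {B K : Type*} [CommRing B] [Algebra ℂ B] [CommRing K] [Algebra ℂ K]

/-- The derivation of `B[T]` which acts as `T ^ e D` on the coefficients. -/
def coeffDerivation (D : Derivation ℂ B B) (e : ℕ) :
    Derivation ℂ (Polynomial B) (Polynomial B) :=
  (Polynomial.X ^ e : Polynomial B) •
    PolynomialModule.equivPolynomialSelf.compDer D.mapCoeffs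

lemma coeff_coeffDerivation (D : Derivation ℂ B B) (e d : ℕ) (p : Polynomial B) :
    (coeffDerivation D e p).coeff (d + e) = D (p.coeff d) := by
  change (Polynomial.X ^ e * PolynomialModule.equivPolynomialSelf (D.mapCoeffs p)).coeff (d + e) = _
  rw [Polynomial.coeff_X_pow_mul]
  rfl

lemma coeff_coeffDerivation_of_lt (D : Derivation ℂ B B) {e d : ℕ} (h : d < e)
    (p : Polynomial B) : (coeffDerivation D e p).coeff d = 0 := by
  change (Polynomial.X ^ e * PolynomialModule.equivPolynomialSelf (D.mapCoeffs p)).coeff d = _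
  rw [Polynomial.coeff_X_pow_mul', if_neg (by omega)]

lemma coeff_iterate_coeffDerivation (D : Derivation ℂ B B) (e k d : ℕ) (p : Polynomial B)
    (h : ∀ j, D^[k] (p.coeff j) = 0) : ((coeffDerivation D e)^[k] p).coeff d = 0 := by
  induction k generalizing p with
  | zero => exact h d
  | succ k ih =>
    rw [Function.iterate_succ_apply]
    refine ih _ fun j => ?_
    by_cases hj : j < e
    · rw [coeff_coeffDerivation_of_lt D hj, iterate_map_zero]
    · obtain ⟨i, rfl⟩ := Nat.exists_eq_add_of_le' (not_lt.mp hj)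
      rw [coeff_coeffDerivation, ← Function.iterate_succ_apply]
      exact h i

lemma LocallyNilpotent.coeffDerivation {D : Derivation ℂ B B} (hD : LocallyNilpotent D) (e : ℕ) :
    LocallyNilpotent (coeffDerivation D e) := by
  intro p
  choose N hN using hD
  refine ⟨p.support.sup fun j => N (p.coeff j), Polynomial.ext fun d => ?_⟩
  rw [Polynomial.coeff_zero]
  refine coeff_iterate_coeffDerivation D e _ d p fun j => ?_
  by_cases hj : j ∈ p.support
  · exact iterate_eq_zero_of_le D (Finset.le_sup (f := fun j => N (p.coeff j)) hj) (hN _)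
  · rw [Polynomial.notMem_support_iff.mp hj, iterate_map_zero]

variable (ι : B →ₐ[ℂ] Polynomial K)

/-- The Rees algebra of the filtration by the degree. -/
def rees : Subalgebra ℂ (Polynomial B) where
  carrier := {p | ∀ d, (ι (p.coeff d)).natDegree ≤ d}
  mul_mem' {p q} hp hq d := by
    rw [Polynomial.coeff_mul, map_sum]
    refine Polynomial.natDegree_sum_le_of_forall_le _ _ fun ij hij => ?_
    rw [map_mul, ← Finset.HasAntidiagonal.mem_antidiagonal.mp hij]
    exact Polynomial.natDegree_mul_le.trans (add_le_add (hp _) (hq _))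
  add_mem' {p q} hp hq d := by
    rw [Polynomial.coeff_add, map_add]
    exact Polynomial.natDegree_add_le_of_degree_le (hp d) (hq d)
  algebraMap_mem' c d := by
    rw [Polynomial.algebraMap_apply, Polynomial.coeff_C]
    split_ifs
    · simp [IsScalarTower.algebraMap_apply ℂ K (Polynomial K)]
    · simp

/-- The leading terms of an element of the Rees algebra. -/
def leadingTermsFun (p : Polynomial B) : Polynomial K :=
  ∑ d ∈ p.support, Polynomial.monomial d ((ι (p.coeff d)).coeff d)

lemma coeff_leadingTermsFun (p : Polynomial B) (d : ℕ) :
    (leadingTermsFun ι p).coeff d = (ι (p.coeff d)).coeff d := by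
  rw [leadingTermsFun, Polynomial.finsetSum_coeff]
  simp only [Polynomial.coeff_monomial, Finset.sum_ite_eq', Polynomial.mem_support_iff]
  split_ifs with h
  · rfl
  · rw [Polynomial.notMem_support_iff.mp h, map_zero, Polynomial.coeff_zero]

/-- The homomorphism which sends an element of the Rees algebra to its leading terms. -/
def leadingTerms : rees ι →ₐ[ℂ] Polynomial K where
  toFun p := leadingTermsFun ι p
  map_one' := by
    ext d
    rw [coeff_leadingTermsFun, OneMemClass.coe_one, Polynomial.coeff_one, Polynomial.coeff_one]
    split_ifs with h
    · simp [h]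
    · simp
  map_mul' p q := by
    ext d
    rw [coeff_leadingTermsFun, MulMemClass.coe_mul, Polynomial.coeff_mul, map_sum,
      Polynomial.finsetSum_coeff, Polynomial.coeff_mul]
    refine Finset.sum_congr rfl fun ij hij => ?_
    rw [map_mul, ← Finset.HasAntidiagonal.mem_antidiagonal.mp hij, coeff_leadingTermsFun,
      coeff_leadingTermsFun, Polynomial.coeff_mul_add_eq_of_natDegree_le (p.2 _) (q.2 _)]
  map_zero' := by
    ext d
    rw [coeff_leadingTermsFun]
    simp
  map_add' p q := by
    ext d
    simp [coeff_leadingTermsFun]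
  commutes' c := by
    ext d
    rw [coeff_leadingTermsFun, Subalgebra.coe_algebraMap, Polynomial.algebraMap_apply,
      Polynomial.algebraMap_apply, Polynomial.coeff_C, Polynomial.coeff_C]
    split_ifs with h
    · simp [h, IsScalarTower.algebraMap_apply ℂ K (Polynomial K)]
    · simp

lemma coeff_leadingTerms (p : rees ι) (d : ℕ) :
    (leadingTerms ι p).coeff d = (ι (p.1.coeff d)).coeff d := coeff_leadingTermsFun ι p d

lemma monomial_mem_rees {b : B} {d : ℕ} (h : (ι b).natDegree ≤ d) :
    Polynomial.monomial d b ∈ rees ι := fun j => by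
  rw [Polynomial.coeff_monomial]
  split_ifs with hj
  · exact hj ▸ h
  · simp

lemma leadingTerms_monomial {b : B} {d : ℕ} (h : (ι b).natDegree ≤ d) :
    leadingTerms ι ⟨_, monomial_mem_rees ι h⟩ = Polynomial.monomial d ((ι b).coeff d) := by
  ext j
  rw [coeff_leadingTerms, Polynomial.coeff_monomial, Polynomial.coeff_monomial]
  split_ifs with hj
  · rw [hj]
  · simp

variable {ι} in
lemma coeffDerivation_mem_rees {D : Derivation ℂ B B} {e : ℕ}
    (he : ∀ b, (ι (D b)).natDegree ≤ (ι b).natDegree + e) {p : Polynomial B} (hp : p ∈ rees ι) :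
    coeffDerivation D e p ∈ rees ι := by
  intro d
  by_cases hd : d < e
  · rw [coeff_coeffDerivation_of_lt D hd]
    simp
  · obtain ⟨i, rfl⟩ := Nat.exists_eq_add_of_le' (not_lt.mp hd)
    rw [coeff_coeffDerivation]
    exact (he _).trans (Nat.add_le_add_right (hp i) e)

/-- A derivation which raises degrees by at most `e` on the Rees algebra. -/
def reesDerivation (D : Derivation ℂ B B) (e : ℕ)
    (he : ∀ b, (ι (D b)).natDegree ≤ (ι b).natDegree + e) : Derivation ℂ (rees ι) (rees ι) :=
  Derivation.mk' ((coeffDerivation D e : Polynomial B →ₗ[ℂ] Polynomial B).restrict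
    (p := (rees ι).toSubmodule) (q := (rees ι).toSubmodule)
    fun _ => coeffDerivation_mem_rees he) fun p q =>
      Subtype.ext ((coeffDerivation D e).leibniz p.1 q.1)

lemma coe_iterate_reesDerivation (D : Derivation ℂ B B) (e : ℕ)
    (he : ∀ b, (ι (D b)).natDegree ≤ (ι b).natDegree + e) (k : ℕ) (p : rees ι) :
    ((reesDerivation ι D e he)^[k] p : Polynomial B) = (coeffDerivation D e)^[k] p := by
  induction k generalizing p with
  | zero => rfl
  | succ k ih => rw [Function.iterate_succ_apply, Function.iterate_succ_apply, ih]; rfl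

/-- The associated graded ring, as the ring of leading terms. -/
abbrev gradedRing : Subalgebra ℂ (Polynomial K) := (leadingTerms ι).range

/-- A vanishing leading term in degree i means that the coefficient has degree below i; since D
raises degrees by at most e, its image stays below i + e. This makes the derivation descend to
leading terms. -/
lemma leadingTerms_reesDerivation_eq_zero (hι : Function.Injective ι) (D : Derivation ℂ B B) (e : ℕ)
    (he : ∀ b, (ι (D b)).natDegree ≤ (ι b).natDegree + e)
    (p : rees ι) (hp : (leadingTerms ι).rangeRestrict p = 0) :
    (leadingTerms ι).rangeRestrict (reesDerivation ι D e he p) = 0 := by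
  have hp' : leadingTerms ι p = 0 := congrArg Subtype.val hp
  refine Subtype.ext (Polynomial.ext fun d => ?_)
  change (leadingTerms ι (reesDerivation ι D e he p)).coeff d = 0
  rw [coeff_leadingTerms]
  change (ι ((coeffDerivation D e p.1).coeff d)).coeff d = 0
  by_cases hd : d < e
  · rw [coeff_coeffDerivation_of_lt D hd, map_zero, Polynomial.coeff_zero]
  · obtain ⟨i, rfl⟩ := Nat.exists_eq_add_of_le' (not_lt.mp hd)
    rw [coeff_coeffDerivation]
    have h0 : (ι (p.1.coeff i)).coeff i = 0 := by rw [← coeff_leadingTerms, hp']; simp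
    rcases (p.2 i).lt_or_eq with h | h
    · exact Polynomial.coeff_eq_zero_of_natDegree_lt
        (lt_of_le_of_lt (he _) (Nat.add_lt_add_right h e))
    -- Degree exactly i with vanishing i-th coefficient: only the zero element does this, because
    -- `natDegree` of 0 is 0.
    · have h1 : (ι (p.1.coeff i)).leadingCoeff = 0 := by rwa [Polynomial.leadingCoeff, h]
      rw [Polynomial.leadingCoeff_eq_zero, map_eq_zero_iff ι hι] at h1
      rw [h1, map_zero, map_zero, Polynomial.coeff_zero]

/-- The derivation of the associated graded ring induced by a derivation which raises degrees by
at most `e`. -/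
def gradedDerivation (hι : Function.Injective ι) (D : Derivation ℂ B B) (e : ℕ)
    (he : ∀ b, (ι (D b)).natDegree ≤ (ι b).natDegree + e) :
    Derivation ℂ (gradedRing ι) (gradedRing ι) :=
  Derivation.liftOfSurjective (leadingTerms ι).rangeRestrict_surjective
    (leadingTerms_reesDerivation_eq_zero ι hι D e he)

lemma gradedDerivation_apply (hι : Function.Injective ι) (D : Derivation ℂ B B) (e : ℕ)
    (he : ∀ b, (ι (D b)).natDegree ≤ (ι b).natDegree + e) (p : rees ι) :
    gradedDerivation ι hι D e he ((leadingTerms ι).rangeRestrict p) =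
      (leadingTerms ι).rangeRestrict (reesDerivation ι D e he p) :=
  Derivation.liftOfSurjective_apply (leadingTerms ι).rangeRestrict_surjective
    (leadingTerms_reesDerivation_eq_zero ι hι D e he) p

/-- Iterates of the induced derivation are images of iterates on the Rees algebra, where nilpotency
can be read on coefficients. -/
lemma LocallyNilpotent.gradedDerivation (hι : Function.Injective ι) {D : Derivation ℂ B B}
    (hD : LocallyNilpotent D) (e : ℕ)
    (he : ∀ b, (ι (D b)).natDegree ≤ (ι b).natDegree + e) :
    LocallyNilpotent (gradedDerivation ι hι D e he) := by
  intro g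
  obtain ⟨p, rfl⟩ := (leadingTerms ι).rangeRestrict_surjective g
  obtain ⟨k, hk⟩ := hD.coeffDerivation e p.1
  refine ⟨k, ?_⟩
  have h : ∀ k (p : rees ι), (Danielewski.gradedDerivation ι hι D e he)^[k]
      ((leadingTerms ι).rangeRestrict p) =
        (leadingTerms ι).rangeRestrict ((reesDerivation ι D e he)^[k] p) := by
    intro k
    induction k with
    | zero => exact fun _ => rfl
    | succ k ih =>
      intro p
      rw [Function.iterate_succ_apply, gradedDerivation_apply, ih, Function.iterate_succ_apply]
  rw [h, show (reesDerivation ι D e he)^[k] p = 0 from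
    Subtype.ext ((coe_iterate_reesDerivation ι D e he k p).trans hk), map_zero]

/-- The homogeneous element of degree `d` of the associated graded ring defined by an element of
degree at most `d`. -/
def symbol (d : ℕ) (b : B) (h : (ι b).natDegree ≤ d) : gradedRing ι :=
  (leadingTerms ι).rangeRestrict ⟨_, monomial_mem_rees ι h⟩

lemma coe_symbol {d : ℕ} {b : B} (h : (ι b).natDegree ≤ d) :
    (symbol ι d b h : Polynomial K) = Polynomial.monomial d ((ι b).coeff d) :=
  leadingTerms_monomial ι h

lemma gradedDerivation_symbol (hι : Function.Injective ι) {D : Derivation ℂ B B} {e : ℕ}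
    (he : ∀ b, (ι (D b)).natDegree ≤ (ι b).natDegree + e) {d : ℕ} {b : B}
    (h : (ι b).natDegree ≤ d) :
    gradedDerivation ι hι D e he (symbol ι d b h) =
      symbol ι (d + e) (D b) ((he b).trans (Nat.add_le_add_right h e)) := by
  rw [symbol, gradedDerivation_apply]
  congr 1
  refine Subtype.ext (Polynomial.ext fun j => ?_)
  change (coeffDerivation D e (Polynomial.monomial d b)).coeff j = _
  by_cases hj : j < e
  · rw [coeff_coeffDerivation_of_lt D hj, Polynomial.coeff_monomial, if_neg (by omega)]
  · obtain ⟨i, rfl⟩ := Nat.exists_eq_add_of_le' (not_lt.mp hj)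
    rw [coeff_coeffDerivation, Polynomial.coeff_monomial, Polynomial.coeff_monomial]
    split_ifs with h1 h2 h2
    · rfl
    · omega
    · omega
    · exact map_zero _

end Graded


/-! ### Derivations of the associated graded ring of the coordinate ring -/

section Monomials

variable {n : ℕ} {G : Type*} [CommRing G] [Algebra ℂ G]

/-- The additivity of logarithmic derivatives, D(x_k^m q) / (x_k^m q) = m D(x_k) / x_k + D(q) / q,
with denominators cleared; `hu` expresses D(q) / q as u w / p. -/
lemma X_mul_mul_derivation (D : Derivation ℂ G G) (α : Poly n →ₐ[ℂ] G) {a : Poly n} {w : G}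
    {k : Fin n} (hx : D (α (MvPolynomial.X k)) = α a * w) (m : ℕ) {p q u : Poly n}
    (hu : α p * D (α q) = α (q * u) * w) :
    α (MvPolynomial.X k * p) * D (α (MvPolynomial.X k ^ m * q)) =
      α (MvPolynomial.X k ^ m * q * ((m : Poly n) * p * a + MvPolynomial.X k * u)) * w := by
  have hpow : α (MvPolynomial.X k) * D (α (MvPolynomial.X k) ^ m) =
      m * α (MvPolynomial.X k) ^ m * (α a * w) := by
    rw [Derivation.leibniz_pow, ← hx]
    cases m with
    | zero => simp
    | succ m =>
      simp only [smul_eq_mul, nsmul_eq_mul, pow_succ, Nat.add_sub_cancel]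
      ring
  rw [map_mul, map_mul α (_ ^ m), map_pow, Derivation.leibniz]
  simp only [map_mul, map_add, map_pow, map_natCast, smul_eq_mul] at hu ⊢
  linear_combination (α p * α q) * hpow + α (MvPolynomial.X k) ^ (m + 1) * hu

lemma exists_prod_mul_derivation (D : Derivation ℂ G G) (α : Poly n →ₐ[ℂ] G) (m : Fin n → ℕ)
    (g : Fin n → Poly n) (w : G) (hx : ∀ k, D (α (MvPolynomial.X k)) = α (g k) * w)
    (s : Finset (Fin n)) :
    ∃ u : Poly n, α (∏ j ∈ s, MvPolynomial.X j) * D (α (∏ j ∈ s, MvPolynomial.X j ^ m j)) =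
      α ((∏ j ∈ s, MvPolynomial.X j ^ m j) * u) * w := by
  classical
  induction s using Finset.induction_on with
  | empty => exact ⟨0, by simp⟩
  | insert k s hk ih =>
    obtain ⟨u, hu⟩ := ih
    rw [Finset.prod_insert hk, Finset.prod_insert hk]
    exact ⟨_, X_mul_mul_derivation D α (hx k) (m k) hu⟩

lemma mul_prod_erase_X (k : Fin n) :
    MvPolynomial.X k * ∏ j ∈ Finset.univ.erase k, MvPolynomial.X j = coordProd n :=
  Finset.mul_prod_erase _ _ (Finset.mem_univ k)

/-- The logarithmic derivative of x^[m] with the contribution of x_k set apart: modulo x_k, only the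
term in `g k` is left of its numerator. -/
lemma exists_coordProd_mul_derivation (D : Derivation ℂ G G) (α : Poly n →ₐ[ℂ] G)
    (m : Fin n → ℕ) (g : Fin n → Poly n) (w : G)
    (hx : ∀ k, D (α (MvPolynomial.X k)) = α (g k) * w) (k : Fin n) :
    ∃ u : Poly n, α (coordProd n) * D (α (monom m)) =
      α (monom m * ((m k : Poly n) * (∏ j ∈ Finset.univ.erase k, MvPolynomial.X j) * g k +
        MvPolynomial.X k * u)) * w := by
  classical
  obtain ⟨u, hu⟩ := exists_prod_mul_derivation D α m g w hx (Finset.univ.erase k)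
  have h := X_mul_mul_derivation D α (hx k) (m k) hu
  rw [mul_prod_erase_X, Finset.mul_prod_erase Finset.univ
    (fun j => (MvPolynomial.X j : Poly n) ^ m j) (Finset.mem_univ k)] at h
  exact ⟨u, h⟩

lemma not_X_dvd (k : Fin n) {c : ℕ} (hc : c ≠ 0) :
    ¬ MvPolynomial.X k ∣ ((c : Poly n) * ∏ j ∈ Finset.univ.erase k, MvPolynomial.X j) := by
  classical
  rintro ⟨a, ha⟩
  -- The left side does not vanish at the point with x_k = 0 and all other coordinates equal to 1.
  have h := congrArg (MvPolynomial.eval fun j => if j = k then (0 : ℂ) else 1) ha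
  simp only [map_mul, map_natCast, map_prod, MvPolynomial.eval_X, if_true, zero_mul,
    mul_eq_zero, Nat.cast_eq_zero, hc, false_or] at h
  rw [Finset.prod_congr rfl fun j hj => if_neg (Finset.ne_of_mem_erase hj)] at h
  simp at h

lemma coordProd_ne_zero : coordProd n ≠ 0 :=
  Finset.prod_ne_zero_iff.mpr fun k _ => MvPolynomial.X_ne_zero k

/-- The form in which m_k > 1 matters: one factor x₁⋯xₙ cancels the denominator of the logarithmic
derivative, and the other one remains to give divisibility by x_k. -/
lemma coordProd_sq_dvd_monom {m : Fin n → ℕ} (hm : ∀ k, 1 < m k) :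
    coordProd n ^ 2 ∣ monom m := by
  rw [coordProd, monom, ← Finset.prod_pow]
  exact Finset.prod_dvd_prod_of_dvd _ _ fun k _ => pow_dvd_pow _ (hm k)

variable [IsDomain G] [CharZero G]

/-- On the ring `x ^ [m] z = y ^ r`, a homogeneous locally nilpotent derivation which kills `z`
also kills `y`. -/
lemma map_y_eq_zero_of_map_z_eq_zero {D : Derivation ℂ G G} (hD : LocallyNilpotent D)
    (α : Poly n →ₐ[ℂ] G) (hα : Function.Injective α) {m : Fin n → ℕ} (hm : ∀ k, 1 < m k)
    {r : ℕ} (hr : 2 ≤ r) {y z : G} (hy : y ≠ 0) (hz : z ≠ 0) (hyz : α (monom m) * z = y ^ r)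
    (hDz : D z = 0) (e : ℕ) (g : Fin n → Poly n) (h : Poly n)
    (hx : ∀ k, D (α (MvPolynomial.X k)) = α (g k) * (y ^ (e % r) * z ^ (e / r)))
    (hDy : D y = α h * (y ^ ((e + 1) % r) * z ^ ((e + 1) / r))) : D y = 0 := by
  by_contra hne
  have hDM : z * D (α (monom m)) = r * y ^ (r - 1) * D y := by
    have := congrArg D hyz
    rw [Derivation.leibniz, Derivation.leibniz_pow, hDz] at this
    simpa [mul_assoc] using this
  have hα0 : ∀ {a}, a ≠ 0 → α a ≠ 0 := fun ha => by
    rwa [Ne, map_eq_zero_iff α hα]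
  have hr0 : (r : ℂ) ≠ 0 := by exact_mod_cast (by omega : r ≠ 0)
  -- Once all x_k are killed, so is x^[m], and `hDM` contradicts D y ≠ 0.
  have hXk : ∀ k, D (α (MvPolynomial.X k)) = 0 := by
    intro k
    obtain ⟨u, hu⟩ := exists_coordProd_mul_derivation D α m g _ hx k
    set p : Poly n := ∏ j ∈ Finset.univ.erase k, MvPolynomial.X j
    set s : Poly n := (m k : Poly n) * p * g k + MvPolynomial.X k * u with hs
    -- As D z = 0, the logarithmic derivatives of y^r and x^[m] agree: r D y / y = s w / (x₁⋯xₙ)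
    -- with w = y^(e % r) z^(e / r).
    have hmain : r * α (coordProd n) * D y = α s * (y * (y ^ (e % r) * z ^ (e / r))) := by
      refine mul_left_cancel₀ (pow_ne_zero r hy) ?_
      have hyr : y ^ r = y ^ (r - 1) * y := by rw [← pow_succ, Nat.sub_add_cancel (by omega)]
      rw [map_mul] at hu
      linear_combination (-α (coordProd n) * y) * hDM + z * y * hu +
        (r * α (coordProd n) * D y) * hyr + (y ^ (e % r) * z ^ (e / r) * α s * y) * hyz
    -- Without a carry D y = h y w, so s is a multiple of x₁⋯xₙ; reducing modulo x_k gives x_k ∣ `g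
    -- k`, and x_k divides its own derivative.
    by_cases he : e % r + 1 < r
    · have h1 : (e + 1) % r = e % r + 1 := by rw [← Nat.mod_add_mod, Nat.mod_eq_of_lt he]
      have h2 : (e + 1) / r = e / r := by
        have e1 := Nat.div_add_mod e r
        have e2 := Nat.div_add_mod (e + 1) r
        rw [h1] at e2
        exact Nat.eq_of_mul_eq_mul_left (by omega : 0 < r) (by omega)
      have hA : (r : Poly n) * coordProd n * h = s := by
        apply hα
        refine mul_right_cancel₀ (mul_ne_zero hy (mul_ne_zero (pow_ne_zero (e % r) hy)
          (pow_ne_zero (e / r) hz))) ?_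
        rw [← hmain, hDy, h1, h2]
        simp only [map_mul, map_natCast]
        ring
      have hdvd : MvPolynomial.X k ∣ (m k : Poly n) * p * g k := by
        rw [← dvd_add_left (Dvd.intro u rfl : MvPolynomial.X k ∣ MvPolynomial.X k * u), ← hs, ← hA,
          ← mul_prod_erase_X k]
        exact ⟨r * p * h, by ring⟩
      have hg : MvPolynomial.X k ∣ g k :=
        ((MvPolynomial.X_prime (i := k)).dvd_or_dvd hdvd).resolve_left
          (not_X_dvd k (by have := hm k; omega))
      refine hD.map_eq_zero_of_dvd_self ?_
      rw [hx]
      exact Dvd.dvd.mul_right (map_dvd α hg) _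
    -- With a carry y w = x^[m] z^(e / r + 1), so r h x₁⋯xₙ = s x^[m].
    · have h0 : e % r + 1 = r := by have := Nat.mod_lt e (by omega : 0 < r); omega
      have h1 : (e + 1) % r = 0 := by rw [← Nat.mod_add_mod, h0, Nat.mod_self]
      have h2 : (e + 1) / r = e / r + 1 := by
        have e1 := Nat.div_add_mod e r
        have e2 := Nat.div_add_mod (e + 1) r
        rw [h1] at e2
        exact Nat.eq_of_mul_eq_mul_left (by omega : 0 < r) (by rw [mul_add]; omega)
      have hA : (r : Poly n) * coordProd n * h = s * monom m := by
        apply hα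
        refine mul_right_cancel₀ (pow_ne_zero (e / r + 1) hz) ?_
        have : y * (y ^ (e % r) * z ^ (e / r)) = α (monom m) * z ^ (e / r + 1) := by
          rw [← mul_assoc, ← pow_succ', h0, ← hyz, pow_succ]
          ring
        rw [this, hDy, h1, h2] at hmain
        simp only [map_mul, map_natCast]
        linear_combination hmain
      obtain ⟨N, hN⟩ := coordProd_sq_dvd_monom hm
      have hh : (r : Poly n) * h = coordProd n * (s * N) := by
        refine mul_left_cancel₀ (coordProd_ne_zero (n := n)) ?_
        rw [hN] at hA
        linear_combination hA
      have hdvd : MvPolynomial.X k ∣ h := by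
        have h3 : h = MvPolynomial.C (r : ℂ)⁻¹ * ((r : Poly n) * h) := by
          rw [← mul_assoc, ← map_natCast (MvPolynomial.C (σ := Fin n)) r, ← MvPolynomial.C_mul,
            inv_mul_cancel₀ hr0, map_one, one_mul]
        rw [h3, hh, ← mul_prod_erase_X k]
        exact ⟨MvPolynomial.C (r : ℂ)⁻¹ * (p * (s * N)), by ring⟩
      -- Here x_k divides D y through h, and y divides D x_k because e % r = r - 1 ≥ 1.
      refine hD.map_eq_zero_of_dvd_of_dvd (b := y) ?_ ?_ hne
      · rw [hDy]
        exact Dvd.dvd.mul_right (map_dvd α hdvd) _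
      · rw [hx]
        exact Dvd.dvd.mul_left (Dvd.dvd.mul_right (dvd_pow_self y (by omega)) _) _
  have hM : D (α (monom m)) = 0 := by
    have : ∀ s : Finset (Fin n), D (α (∏ j ∈ s, MvPolynomial.X j ^ m j)) = 0 := by
      intro s
      induction s using Finset.induction_on with
      | empty => simp
      | insert k s hk ih =>
        rw [Finset.prod_insert hk, map_mul, Derivation.leibniz, ih, map_pow,
          Derivation.leibniz_pow, hXk]
        simp
    exact this _
  rw [hM, mul_zero] at hDM
  have : (r : G) ≠ 0 := by exact_mod_cast (by omega : r ≠ 0)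
  exact mul_ne_zero (mul_ne_zero this (pow_ne_zero _ hy)) hne hDM.symm

end Monomials

/-! ### Locally nilpotent derivations of the coordinate ring -/

section CoordRing

variable {n r : ℕ} {m : Fin n → ℕ} {σ : Fin r → Poly n}

/-- As f is a constant of D, iterates of f D are f^k D^k. This permits multiplying D by elements of
its kernel to raise degrees. -/
lemma LocallyNilpotent.smul {B : Type*} [CommRing B] [Algebra ℂ B] {D : Derivation ℂ B B}
    (hD : LocallyNilpotent D) {f : B} (hf : D f = 0) : LocallyNilpotent (f • D) := by
  intro b
  obtain ⟨k, hk⟩ := hD b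
  refine ⟨k, ?_⟩
  have h : ∀ k, (f • D)^[k] b = f ^ k * D^[k] b := by
    intro k
    induction k with
    | zero => simp
    | succ k ih =>
      rw [Function.iterate_succ_apply', ih, Function.iterate_succ_apply', Derivation.smul_apply,
        Derivation.leibniz, Derivation.leibniz_pow, hf]
      simp only [smul_eq_mul, mul_zero, nsmul_zero, add_zero, pow_succ]
      ring
  rw [h, hk, mul_zero]

lemma natDegree_toPoly_y : (toPoly m σ (coord m σ Coord.y)).natDegree ≤ 1 := by
  rw [toPoly_y]
  exact Polynomial.natDegree_X_le

lemma natDegree_toPoly_z : (toPoly m σ (coord m σ Coord.z)).natDegree ≤ r := by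
  rw [toPoly_z]
  exact (Polynomial.natDegree_C_mul_le _ _).trans natDegree_prodPoly.le

lemma natDegree_toPoly_xHom (a : Poly n) : (toPoly m σ (xHom m σ a)).natDegree ≤ 0 := by
  rw [toPoly_xHom, Polynomial.natDegree_C]

/-- A derivation of the coordinate ring raises the degrees by a bounded amount. -/
lemma exists_natDegree_le (hr : 0 < r) (D : Derivation ℂ (CoordRing m σ) (CoordRing m σ)) :
    ∃ e, ∀ b, (toPoly m σ (D b)).natDegree ≤ (toPoly m σ b).natDegree + e := by
  obtain ⟨e, hx, hy, hz⟩ : ∃ e, (∀ k, (toPoly m σ (D (coord m σ (Coord.x k)))).natDegree ≤ e) ∧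
      (toPoly m σ (D (coord m σ Coord.y))).natDegree ≤ e ∧
      (toPoly m σ (D (coord m σ Coord.z))).natDegree ≤ e :=
    ⟨∑ k, (toPoly m σ (D (coord m σ (Coord.x k)))).natDegree +
      ((toPoly m σ (D (coord m σ Coord.y))).natDegree +
        (toPoly m σ (D (coord m σ Coord.z))).natDegree),
      fun k => (Finset.single_le_sum (f := fun k =>
        (toPoly m σ (D (coord m σ (Coord.x k)))).natDegree) (fun _ _ => Nat.zero_le _)
        (Finset.mem_univ k)).trans (Nat.le_add_right _ _), by omega, by omega⟩
  -- A joint bound for the degrees of b and D b, which is multiplicative by the Leibniz rule and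
  -- hence passes from the generators to the basis elements.
  let p : CoordRing m σ → ℕ → Prop := fun b d =>
    (toPoly m σ b).natDegree ≤ d ∧ (toPoly m σ (D b)).natDegree ≤ d + e
  have hmul : ∀ {b c i j}, p b i → p c j → p (b * c) (i + j) := by
    rintro b c i j ⟨hb, hb'⟩ ⟨hc, hc'⟩
    refine ⟨?_, ?_⟩
    · rw [map_mul]
      exact Polynomial.natDegree_mul_le_of_le hb hc
    · rw [Derivation.leibniz, map_add, smul_eq_mul, smul_eq_mul, map_mul, map_mul]
      refine Polynomial.natDegree_add_le_of_degree_le ?_ ?_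
      · exact (Polynomial.natDegree_mul_le_of_le hb hc').trans (by omega)
      · exact (Polynomial.natDegree_mul_le_of_le hc hb').trans (by omega)
  have hpow : ∀ {b i} j, p b i → p (b ^ j) (j * i) := by
    intro b i j hb
    induction j with
    | zero => simp [p]
    | succ j ih =>
      rw [pow_succ, add_mul, one_mul]
      exact hmul ih hb
  have hxa : ∀ a, p (xHom m σ a) 0 := by
    intro a
    induction a using MvPolynomial.induction_on with
    | C c =>
      refine ⟨natDegree_toPoly_xHom _, ?_⟩
      rw [← MvPolynomial.algebraMap_eq, AlgHom.commutes, Derivation.map_algebraMap, map_zero]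
      simp
    | add a b ha hb =>
      refine ⟨natDegree_toPoly_xHom _, ?_⟩
      rw [map_add, map_add, map_add]
      exact Polynomial.natDegree_add_le_of_degree_le ha.2 hb.2
    | mul_X a k ha =>
      rw [map_mul]
      refine hmul ha ⟨natDegree_toPoly_xHom _, ?_⟩
      rw [xHom_X]
      simpa using hx k
  have hw : ∀ d, p (basisElt m σ d) d := by
    intro d
    have h := hmul (hpow (d % r) ⟨natDegree_toPoly_y, hy.trans (Nat.le_add_left e 1)⟩)
      (hpow (d / r) ⟨natDegree_toPoly_z, hz.trans (Nat.le_add_left e r)⟩)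
    rwa [mul_one, Nat.mod_add_div'] at h
  refine ⟨e, fun b => ?_⟩
  obtain ⟨c, rfl⟩ := comb_surjective hr b
  set d := (toPoly m σ (comb m σ c)).natDegree with hd
  rw [comb_apply, map_sum, map_sum]
  refine Polynomial.natDegree_sum_le_of_forall_le _ _ fun j hj => ?_
  -- The terms of a combination have distinct degrees, so none has degree above that of the sum.
  have hjd : j ≤ d := by
    by_contra! h
    exact Finsupp.mem_support_iff.mp hj (apply_eq_zero_of_natDegree_le hd.ge h)
  exact (hmul (hxa (c j)) (hw j)).2.trans (by omega)

/-- The least amount by which a derivation raises the degrees is attained, provided that the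
degree of some element does not drop. -/
lemma exists_natDegree_eq (hr : 0 < r) (D : Derivation ℂ (CoordRing m σ) (CoordRing m σ))
    {b : CoordRing m σ} (hb : D b ≠ 0)
    (hb' : (toPoly m σ b).natDegree ≤ (toPoly m σ (D b)).natDegree) :
    ∃ e, (∀ b, (toPoly m σ (D b)).natDegree ≤ (toPoly m σ b).natDegree + e) ∧
      ∃ b, D b ≠ 0 ∧ (toPoly m σ (D b)).natDegree = (toPoly m σ b).natDegree + e := by
  classical
  have h := exists_natDegree_le hr D
  refine ⟨Nat.find h, Nat.find_spec h, ?_⟩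
  -- If the least bound is 0, minimality among natural numbers gives nothing and the given b is the
  -- witness. Otherwise an element violating the bound e - 1 works; its image is nonzero because
  -- `natDegree` of 0 is 0.
  rcases Nat.eq_zero_or_pos (Nat.find h) with h0 | h0
  · refine ⟨b, hb, ?_⟩
    have := Nat.find_spec h b
    omega
  · have h1 := Nat.find_min h (Nat.sub_one_lt h0.ne')
    push Not at h1
    obtain ⟨b, hb⟩ := h1
    have h2 := Nat.find_spec h b
    refine ⟨b, fun h3 => ?_, by omega⟩
    rw [h3, map_zero, Polynomial.natDegree_zero] at hb
    omega

lemma coeff_toPoly_basisElt (d : ℕ) : (toPoly m σ (basisElt m σ d)).coeff d =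
    (algebraMap _ _ (monom m))⁻¹ ^ (d / r) := by
  nth_rw 2 [← natDegree_toPoly_basisElt (m := m) (σ := σ) d]
  rw [Polynomial.coeff_natDegree, basisElt, map_mul, map_pow, map_pow, toPoly_y, toPoly_z,
    Polynomial.leadingCoeff_mul, Polynomial.leadingCoeff_pow, Polynomial.leadingCoeff_pow,
    Polynomial.leadingCoeff_mul, prodPoly_monic.leadingCoeff]
  simp

lemma coeff_toPoly_z : (toPoly m σ (coord m σ Coord.z)).coeff r =
    (algebraMap _ _ (monom m))⁻¹ := by
  have h : (prodPoly σ).coeff r = 1 := by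
    nth_rw 2 [← natDegree_prodPoly (σ := σ)]
    exact prodPoly_monic
  rw [toPoly_z, Polynomial.coeff_C_mul, h, mul_one]

/-- An element of the kernel of a nonzero locally nilpotent derivation does not depend on `y`. -/
lemma natDegree_toPoly_eq_zero_of_map_eq_zero (hr : 2 ≤ r) (hm : ∀ k, 1 < m k)
    {D : Derivation ℂ (CoordRing m σ) (CoordRing m σ)} (hD : LocallyNilpotent D) (hne : D ≠ 0)
    {f : CoordRing m σ} (hf : D f = 0) : (toPoly m σ f).natDegree = 0 := by
  have hr0 : 0 < r := by omega
  have := coordRing_isDomain (m := m) (σ := σ) hr0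
  have hι := toPoly_injective (m := m) (σ := σ) hr0
  by_contra hf0
  have hfne : f ≠ 0 := by
    rintro rfl
    simp at hf0
  obtain ⟨b, hb⟩ : ∃ b, D b ≠ 0 := by
    by_contra! h
    exact hne (Derivation.ext h)
  -- The exponent deg b outweighs any drop of degree: f has degree at least 1, so f^(deg b) D b has
  -- degree at least deg b.
  have hfN : D (f ^ (toPoly m σ b).natDegree) = 0 := by
    rw [Derivation.leibniz_pow, hf, smul_zero, smul_zero]
  have hD' := hD.smul hfN
  set D' := f ^ (toPoly m σ b).natDegree • D with hD'def
  have hb' : D' b = f ^ (toPoly m σ b).natDegree * D b := rfl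
  have hfD' : D' f = 0 := by rw [hD'def, Derivation.smul_apply, hf, smul_zero]
  obtain ⟨e, he, b₀, hb₀, hb₀'⟩ := exists_natDegree_eq hr0 D' (b := b)
    (by rw [hb']; exact mul_ne_zero (pow_ne_zero _ hfne) hb) (by
      rw [hb', map_mul, map_pow, Polynomial.natDegree_mul, Polynomial.natDegree_pow]
      · nlinarith [Nat.pos_of_ne_zero hf0]
      · exact pow_ne_zero _ ((map_ne_zero_iff _ hι).mpr hfne)
      · exact (map_ne_zero_iff _ hι).mpr hb)
  have hDg := hD'.gradedDerivation _ hι e he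
  set G := gradedRing (toPoly m σ)
  set Dg := gradedDerivation _ hι D' e he
  have : CharZero G := charZero_of_injective_algebraMap (algebraMap ℂ G).injective
  have hDsymb : ∀ d b h, Dg (symbol _ d b h) = symbol _ (d + e) (D' b) _ :=
    fun d b h => gradedDerivation_symbol _ hι he h
  let α : Poly n →ₐ[ℂ] G := ((toPoly m σ).comp (xHom m σ)).codRestrict G fun a => by
    have h := (symbol (toPoly m σ) 0 _ (natDegree_toPoly_xHom a)).2
    rw [coe_symbol, toPoly_xHom, Polynomial.coeff_C_zero, Polynomial.monomial_zero_left] at h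
    rw [AlgHom.comp_apply, toPoly_xHom]
    exact h
  have hαs : ∀ a, α a = symbol _ 0 (xHom m σ a) (natDegree_toPoly_xHom a) := fun a => by
    refine Subtype.ext ?_
    rw [coe_symbol, toPoly_xHom, Polynomial.coeff_C_zero]
    exact toPoly_xHom a
  have hα : Function.Injective α := fun a b h =>
    xHom_injective (hι (congrArg Subtype.val h))
  let y : G := symbol _ 1 _ natDegree_toPoly_y
  let z : G := symbol _ r _ natDegree_toPoly_z
  have hyv : (y : Polynomial (FractionRing (Poly n))) = Polynomial.X := by
    rw [coe_symbol, toPoly_y, Polynomial.coeff_X_one]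
    rfl
  have hzv : (z : Polynomial (FractionRing (Poly n))) =
      Polynomial.C (algebraMap _ _ (monom m))⁻¹ * Polynomial.X ^ r := by
    rw [coe_symbol, coeff_toPoly_z, Polynomial.C_mul_X_pow_eq_monomial]
  have hαv : ∀ a, (α a : Polynomial (FractionRing (Poly n))) =
      Polynomial.C (algebraMap _ _ a) := toPoly_xHom
  have hM0 := algebraMap_ne_zero (monom_ne_zero m)
  -- Every homogeneous component of the graded ring is free of rank one over ℂ[x], so a homogeneous
  -- element is visibly a product of powers of y and z and a polynomial in x.
  have hsymb : ∀ d b (h : (toPoly m σ b).natDegree ≤ d), ∃ a : Poly n,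
      symbol (toPoly m σ) d b h = α a * (y ^ (d % r) * z ^ (d / r)) := by
    intro d b h
    obtain ⟨a, ha⟩ := exists_coeff_eq hr0 h
    refine ⟨a, Subtype.ext ?_⟩
    simp only [MulMemClass.coe_mul, SubmonoidClass.coe_pow]
    rw [coe_symbol, ha, coeff_toPoly_basisElt, hyv, hzv, hαv, mul_pow, ← pow_mul,
      mul_left_comm (Polynomial.X ^ _), ← pow_add, Nat.mod_add_div, ← mul_assoc,
      ← Polynomial.C_pow, ← Polynomial.C_mul, Polynomial.C_mul_X_pow_eq_monomial]
  have hy : y ≠ 0 := fun h => Polynomial.X_ne_zero (hyv.symm.trans (congrArg Subtype.val h))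
  have hyz : α (monom m) * z = y ^ r := by
    refine Subtype.ext ?_
    simp only [MulMemClass.coe_mul, SubmonoidClass.coe_pow]
    rw [hαv, hzv, hyv, ← mul_assoc, ← Polynomial.C_mul, mul_inv_cancel₀ hM0, map_one, one_mul]
  have hz : z ≠ 0 := right_ne_zero_of_mul (hyz ▸ pow_ne_zero r hy)
  -- The leading form of f is killed and has positive degree. It is a multiple of y unless r divides
  -- that degree; in that case it is a multiple of z.
  have hy0 : Dg y = 0 := by
    have h1 : Dg (symbol _ _ f le_rfl) = 0 := by
      rw [hDsymb]
      refine Subtype.ext ?_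
      rw [coe_symbol, hfD']
      simp
    have h2 : symbol (toPoly m σ) _ f le_rfl ≠ 0 := fun h => by
      have := congrArg Subtype.val h
      rw [coe_symbol, ZeroMemClass.coe_zero, Polynomial.monomial_eq_zero_iff,
        Polynomial.coeff_natDegree, Polynomial.leadingCoeff_eq_zero,
        map_eq_zero_iff _ hι] at this
      exact hfne this
    obtain ⟨a, ha⟩ := hsymb _ f le_rfl
    rw [ha] at h1 h2
    by_cases hmod : (toPoly m σ f).natDegree % r = 0
    · have hdiv : (toPoly m σ f).natDegree / r ≠ 0 := fun h => by
        have := Nat.mod_add_div (toPoly m σ f).natDegree r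
        rw [hmod, h] at this
        omega
      have hz0 : Dg z = 0 := hDg.map_eq_zero_of_dvd
        (((dvd_pow_self z hdiv).mul_left _).mul_left _) h2 h1
      choose g hg using fun k => hsymb _ _
        ((he (xHom m σ (MvPolynomial.X k))).trans
          (Nat.add_le_add_right (natDegree_toPoly_xHom _) e))
      obtain ⟨h, hh⟩ := hsymb _ _ ((he (coord m σ Coord.y)).trans
          (Nat.add_le_add_right natDegree_toPoly_y e))
      refine map_y_eq_zero_of_map_z_eq_zero hDg α hα hm hr hy hz hyz hz0 e g h (fun k => ?_) ?_
      · rw [hαs, hDsymb, hg, zero_add]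
      · rw [hDsymb, hh, add_comm 1 e]
    · exact hDg.map_eq_zero_of_dvd (((dvd_pow_self y hmod).mul_right _).mul_left _) h2 h1
  -- From y the vanishing spreads to all factors of y^r = x^[m] z, that is, to all generators.
  have hyr : Dg (α (monom m) * z) = 0 := by
    rw [hyz, Derivation.leibniz_pow, hy0, smul_zero, smul_zero]
  have hyr0 : α (monom m) * z ≠ 0 := hyz ▸ pow_ne_zero r hy
  have hz0 : Dg z = 0 := hDg.map_eq_zero_of_dvd (Dvd.intro_left _ rfl) hyr0 hyr
  have hx0 : ∀ k, Dg (α (MvPolynomial.X k)) = 0 := fun k =>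
    hDg.map_eq_zero_of_dvd (Dvd.dvd.mul_right (map_dvd α
      ((dvd_pow_self _ (by have := hm k; omega)).trans
        (Finset.dvd_prod_of_mem (fun k => (MvPolynomial.X k : Poly n) ^ m k)
          (Finset.mem_univ k)))) _) hyr0 hyr
  have ha0 : ∀ a, Dg (α a) = 0 := by
    intro a
    induction a using MvPolynomial.induction_on with
    | C c => rw [← MvPolynomial.algebraMap_eq, AlgHom.commutes, Derivation.map_algebraMap]
    | add a b ha hb => rw [map_add, map_add, ha, hb, add_zero]
    | mul_X a k ha => rw [map_mul, Derivation.leibniz, ha, hx0, smul_zero, smul_zero, add_zero]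
  -- The induced derivation is now zero, but the leading form of D' b₀ is its value at the leading
  -- form of b₀, since the shift e is attained at b₀.
  obtain ⟨a, ha⟩ := hsymb _ b₀ le_rfl
  have h := hDsymb _ b₀ le_rfl
  rw [ha, Derivation.leibniz, ha0, Derivation.leibniz, Derivation.leibniz_pow,
    Derivation.leibniz_pow, hy0, hz0] at h
  simp only [smul_zero, add_zero] at h
  have h' := congrArg Subtype.val h
  rw [coe_symbol, ← hb₀', Polynomial.coeff_natDegree, ZeroMemClass.coe_zero, eq_comm,
    Polynomial.monomial_eq_zero_iff, Polynomial.leadingCoeff_eq_zero,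
    map_eq_zero_iff _ hι] at h'
  exact hb₀ h'

end CoordRing

/-! ### The kernel of a locally nilpotent derivation, and its value at y -/

section Kernel

variable {n r : ℕ} {m : Fin n → ℕ} {σ : Fin r → Poly n}

/-- A nonzero locally nilpotent derivation of the coordinate ring kills `x₁, …, xₙ`. -/
lemma map_xHom_eq_zero (hr : 2 ≤ r) (hm : ∀ k, 1 < m k)
    {D : Derivation ℂ (CoordRing m σ) (CoordRing m σ)} (hD : LocallyNilpotent D) (hne : D ≠ 0)
    (a : Poly n) : D (xHom m σ a) = 0 := by
  have hr0 : 0 < r := by omega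
  have := coordRing_isDomain (m := m) (σ := σ) hr0
  have hι := toPoly_injective (m := m) (σ := σ) hr0
  have : CharZero (CoordRing m σ) :=
    charZero_of_injective_algebraMap (algebraMap ℂ _).injective
  have hker : ∀ {f}, D f = 0 → (toPoly m σ f).natDegree = 0 :=
    natDegree_toPoly_eq_zero_of_map_eq_zero hr hm hD hne
  -- A local slice: the last iterate of b which is not in the kernel.
  obtain ⟨s, hs, hs'⟩ : ∃ s, D s ≠ 0 ∧ D (D s) = 0 := by
    obtain ⟨b, hb⟩ : ∃ b, D b ≠ 0 := by
      by_contra! h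
      exact hne (Derivation.ext h)
    obtain ⟨k, hk, hk'⟩ := hD.exists_order hb
    rw [← Function.iterate_succ_apply, Function.iterate_succ_apply'] at hk
    rw [Function.iterate_succ_apply', ← Function.iterate_succ_apply D k b,
      Function.iterate_succ_apply'] at hk'
    exact ⟨_, hk, hk'⟩
  -- Kernel elements have degree 0, so q b = Q(s) makes every degree a multiple of deg s. The
  -- element y shows deg s ≠ 0; an element of ℂ[x] then has deg Q = 0, so it divides a kernel
  -- element.
  have hdeg : ∀ b, ∃ (q : CoordRing m σ) (Q : Polynomial (CoordRing m σ)), q ≠ 0 ∧ D q = 0 ∧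
      (∀ i, D (Q.coeff i) = 0) ∧ q * b = Q.eval s ∧
      (b ≠ 0 → (toPoly m σ b).natDegree = Q.natDegree * (toPoly m σ s).natDegree) := by
    intro b
    obtain ⟨q, Q, hq, hDq, hQ, h⟩ := hD.exists_polynomial hs hs' b
    refine ⟨q, Q, hq, hDq, hQ, h, fun hb => ?_⟩
    -- The coefficients of Q lie in K after the embedding, so Q(s) is a composition of polynomials
    -- over a field and degrees multiply.
    let φ := (Polynomial.constantCoeff (R := FractionRing (Poly n))).comp (toPoly m σ).toRingHom
    have h1 : (Q.map φ).map Polynomial.C = Q.map (toPoly m σ).toRingHom := by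
      ext1 i
      rw [Polynomial.coeff_map, Polynomial.coeff_map, Polynomial.coeff_map]
      exact (Polynomial.eq_C_of_natDegree_eq_zero (hker (hQ i))).symm
    have h2 : (Q.map φ).natDegree = Q.natDegree := by
      rw [← Polynomial.natDegree_map_eq_of_injective (Polynomial.C_injective) (Q.map φ), h1,
        Polynomial.natDegree_map_eq_of_injective hι]
    have h3 : toPoly m σ (q * b) = (Q.map φ).comp (toPoly m σ s) := by
      rw [h, Polynomial.comp, ← Polynomial.eval_map, h1, Polynomial.eval_map, Polynomial.eval]
      exact Polynomial.hom_eval₂ Q (RingHom.id _) (toPoly m σ).toRingHom s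
    rw [← h2, ← Polynomial.natDegree_comp, ← h3, map_mul, Polynomial.natDegree_mul, hker hDq,
      zero_add]
    · exact (map_ne_zero_iff _ hι).mpr hq
    · exact (map_ne_zero_iff _ hι).mpr hb
  have hs0 : (toPoly m σ s).natDegree ≠ 0 := by
    intro h0
    obtain ⟨q, Q, -, -, -, -, h⟩ := hdeg (coord m σ Coord.y)
    rw [h0, mul_zero, toPoly_y, Polynomial.natDegree_X] at h
    refine one_ne_zero (h fun hy => ?_)
    have := congrArg (toPoly m σ) hy
    rw [toPoly_y, map_zero] at this
    exact Polynomial.X_ne_zero this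
  by_cases ha : xHom m σ a = 0
  · rw [ha, map_zero]
  obtain ⟨q, Q, hq, hDq, hQ, h, h'⟩ := hdeg (xHom m σ a)
  have h0 : Q.natDegree = 0 := by
    have := h' ha
    rw [Nat.eq_zero_of_le_zero (natDegree_toPoly_xHom a)] at this
    exact (mul_eq_zero.mp this.symm).resolve_right hs0
  rw [Polynomial.eq_C_of_natDegree_eq_zero h0, Polynomial.eval_C] at h
  exact hD.map_eq_zero_of_dvd (Dvd.intro_left q rfl) (mul_ne_zero hq ha) (h ▸ hQ 0)

lemma map_eq_zero_iff_mem_range (hr : 2 ≤ r) (hm : ∀ k, 1 < m k)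
    {D : Derivation ℂ (CoordRing m σ) (CoordRing m σ)} (hD : LocallyNilpotent D) (hne : D ≠ 0)
    (b : CoordRing m σ) : D b = 0 ↔ ∃ a, xHom m σ a = b := by
  constructor
  · intro h
    exact exists_xHom_eq (by omega) (natDegree_toPoly_eq_zero_of_map_eq_zero hr hm hD hne h)
  · rintro ⟨a, rfl⟩
    exact map_xHom_eq_zero hr hm hD hne a

/-- A derivation which kills `x₁, …, xₙ` is a multiple of the derivative with respect to `y`. -/
lemma toPoly_map {D : Derivation ℂ (CoordRing m σ) (CoordRing m σ)}
    (hx : ∀ a, D (xHom m σ a) = 0) (b : CoordRing m σ) :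
    toPoly m σ (D b) = Polynomial.derivative (toPoly m σ b) *
      toPoly m σ (D (coord m σ Coord.y)) := by
  let p : CoordRing m σ → Prop := fun b => toPoly m σ (D b) =
    Polynomial.derivative (toPoly m σ b) * toPoly m σ (D (coord m σ Coord.y))
  have hmul : ∀ {b c}, p b → p c → p (b * c) := by
    intro b c hb hc
    simp only [p, Derivation.leibniz, smul_eq_mul, map_add, map_mul, Polynomial.derivative_mul]
      at hb hc ⊢
    rw [hb, hc]
    ring
  have hpx : ∀ a, p (xHom m σ a) := fun a => by simp [p, hx, toPoly_xHom]
  have hpy : p (coord m σ Coord.y) := by simp [p, toPoly_y]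
  -- The chain rule for z follows from that for x^[m] z = ∏ (y - σᵢ), by cancelling x^[m].
  have hpr : p (xHom m σ (monom m) * coord m σ Coord.z) := by
    rw [coord_relation]
    refine Finset.prod_induction _ p (fun _ _ => hmul) (by simp [p]) fun i _ => ?_
    simp only [p, map_sub, hx, toPoly_xHom, toPoly_y, Polynomial.derivative_X,
      Polynomial.derivative_C, sub_zero, one_mul]
  have hpz : p (coord m σ Coord.z) := by
    refine mul_left_cancel₀ (a := toPoly m σ (xHom m σ (monom m))) ?_ ?_
    · rw [toPoly_xHom]
      simpa using monom_ne_zero m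
    · have h := hpr
      simp only [p, Derivation.leibniz, hx, smul_eq_mul, mul_zero, add_zero, map_mul,
        Polynomial.derivative_mul] at h
      rw [h, toPoly_xHom, Polynomial.derivative_C]
      ring
  change p b
  induction b using coordRing_induction with
  | hx a => exact hpx a
  | hadd b c hb hc =>
    simp only [p, map_add] at hb hc ⊢
    rw [hb, hc]
    ring
  | hmx b k hb => exact hmul hb (xHom_X m σ k ▸ hpx _)
  | hmy b hb => exact hmul hb hpy
  | hmz b hb => exact hmul hb hpz

/-- A locally nilpotent derivation which kills `x₁, …, xₙ` sends `y` to a multiple of the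
monomial `x ^ [m]`. -/
lemma exists_map_y_eq (hr : 0 < r) {D : Derivation ℂ (CoordRing m σ) (CoordRing m σ)}
    (hD : LocallyNilpotent D) (hx : ∀ a, D (xHom m σ a) = 0) :
    ∃ a, D (coord m σ Coord.y) = xHom m σ (a * monom m) := by
  have hι := toPoly_injective (m := m) (σ := σ) hr
  have h0 : (toPoly m σ (D (coord m σ Coord.y))).natDegree = 0 := by
    by_contra h0
    -- By the chain rule D changes a positive degree by deg (D y) - 1 ≥ 0, so no iterate of y would
    -- vanish.
    have h : ∀ k, 1 ≤ (toPoly m σ (D^[k] (coord m σ Coord.y))).natDegree := by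
      intro k
      induction k with
      | zero => rw [Function.iterate_zero_apply, toPoly_y, Polynomial.natDegree_X]
      | succ k ih =>
        rw [Function.iterate_succ_apply', toPoly_map hx, Polynomial.natDegree_mul,
          Polynomial.natDegree_derivative]
        · omega
        · rw [Polynomial.derivative_ne_zero]
          omega
        · intro h
          simp [h] at h0
    obtain ⟨k, hk⟩ := hD (coord m σ Coord.y)
    have := h k
    rw [hk, map_zero, Polynomial.natDegree_zero] at this
    omega
  obtain ⟨f, hf⟩ := exists_xHom_eq hr h0
  have hz : Polynomial.C (algebraMap _ _ (monom m)) * toPoly m σ (D (coord m σ Coord.z)) =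
      Polynomial.derivative (prodPoly σ) * Polynomial.C (algebraMap _ _ f) := by
    have hM0 := algebraMap_ne_zero (monom_ne_zero m)
    rw [toPoly_map hx, toPoly_z, ← hf, toPoly_xHom, Polynomial.derivative_C_mul, mul_assoc,
      ← mul_assoc, ← Polynomial.C_mul, mul_inv_cancel₀ hM0, Polynomial.C_1, one_mul]
  have hdeg : (toPoly m σ (D (coord m σ Coord.z))).natDegree ≤ r - 1 := by
    rw [← Polynomial.natDegree_C_mul (algebraMap_ne_zero (monom_ne_zero m)), hz]
    refine (Polynomial.natDegree_mul_C_le _ _).trans ?_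
    refine (Polynomial.natDegree_derivative_le _).trans ?_
    rw [natDegree_prodPoly]
  -- In degree r - 1 the basis element is y^(r-1), so this coefficient of D z has no denominator.
  -- Comparing it in x^[m] D z = P'(y) D y, with P = ∏ (y - σᵢ), gives x^[m] a = r D y.
  obtain ⟨a, ha⟩ := exists_coeff_eq hr hdeg
  have hc := congrArg (fun p => p.coeff (r - 1)) hz
  have hP : (prodPoly σ).coeff r = 1 := by
    nth_rw 2 [← natDegree_prodPoly (σ := σ)]
    exact prodPoly_monic
  simp only [Polynomial.coeff_C_mul, Polynomial.coeff_mul_C] at hc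
  rw [ha, coeff_toPoly_basisElt, Nat.div_eq_of_lt (by omega), pow_zero, mul_one,
    Polynomial.coeff_derivative, Nat.sub_add_cancel hr, hP, one_mul, ← map_mul] at hc
  have hc' : monom m * a = (r : Poly n) * f := by
    apply IsFractionRing.injective _ (FractionRing (Poly n))
    rw [hc, map_mul, map_natCast]
    congr 1
    rw [← Nat.cast_add_one, Nat.sub_add_cancel hr]
  refine ⟨MvPolynomial.C (r : ℂ)⁻¹ * a, ?_⟩
  rw [← hf]
  congr 1
  have hr0 : (r : ℂ) ≠ 0 := by exact_mod_cast hr.ne'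
  have : MvPolynomial.C (r : ℂ)⁻¹ * (r : Poly n) = 1 := by
    rw [← map_natCast (MvPolynomial.C (σ := Fin n)) r, ← MvPolynomial.C_mul,
      inv_mul_cancel₀ hr0, map_one]
  linear_combination (-MvPolynomial.C (r : ℂ)⁻¹) * hc' - f * this

end Kernel

/-! ### Points of affine schemes -/

section AffinePoints

variable {A : Type} [CommRing A] [Algebra ℂ A] {S T : CScheme}

lemma pull_id (T : CScheme) (f : Fn T) : pull (𝟙 T) f = f := by
  simp [pull]

/-- The homomorphism of rings which corresponds to a point of an affine scheme. -/
def comorphism (p : T ⟶ affineOver A) : A →+* Fn T := (pull p).comp (toFn A)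

lemma comorphism_apply (p : T ⟶ affineOver A) (a : A) : comorphism p a = pull p (toFn A a) := rfl

lemma comorphism_comp (f : S ⟶ T) (p : T ⟶ affineOver A) (a : A) :
    comorphism (f ≫ p) a = pull f (comorphism p a) := pull_comp f p _

lemma toFn_bijective : Function.Bijective (toFn A) :=
  (ConcreteCategory.bijective_of_isIso (Scheme.ΓSpecIso (CommRingCat.of A)).inv)

lemma comorphism_id (a : A) : comorphism (𝟙 (affineOver A)) a = toFn A a := pull_id _ _

lemma const_affineOver (c : ℂ) : const (affineOver A) c = toFn A (algebraMap ℂ A c) := by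
  have h := Scheme.ΓSpecIso_inv_naturality (CommRingCat.ofHom (algebraMap ℂ A))
  exact (ConcreteCategory.congr_hom h c).symm

lemma comorphism_algebraMap (p : T ⟶ affineOver A) (c : ℂ) :
    comorphism p (algebraMap ℂ A c) = const T c := by
  rw [comorphism_apply, ← const_affineOver, pull_const]

lemma affine_hom_ext {p q : T ⟶ affineOver A} (h : ∀ a, comorphism p a = comorphism q a) :
    p = q := by
  apply Over.OverMorphism.ext
  have : IsAffine (affineOver A).left := inferInstanceAs (IsAffine (Spec _))
  apply ext_of_isAffine
  ext f
  obtain ⟨a, rfl⟩ := (toFn_bijective (A := A)).2 f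
  exact h a

omit [Algebra ℂ A] in
lemma appTop_toSpecΓ_map (X : Scheme.{0}) (f : CommRingCat.of A ⟶ Γ(X, ⊤)) :
    (Scheme.ΓSpecIso (CommRingCat.of A)).inv ≫ (X.toSpecΓ ≫ Spec.map f).appTop = f := by
  rw [Scheme.Hom.comp_appTop, ← Category.assoc, ← Scheme.ΓSpecIso_inv_naturality, Category.assoc,
    Scheme.toSpecΓ_appTop, Iso.inv_hom_id, Category.comp_id]

/-- The point of an affine scheme which corresponds to a homomorphism of rings. -/
def affinePoint (f : A →+* Fn T) (hf : ∀ c, f (algebraMap ℂ A c) = const T c) :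
    T ⟶ affineOver A :=
  Over.homMk (T.left.toSpecΓ ≫ Spec.map (CommRingCat.ofHom f)) (by
    have : IsAffine SpecC := inferInstanceAs (IsAffine (Spec _))
    apply ext_of_isAffine
    rw [← cancel_epi (Scheme.ΓSpecIso (CommRingCat.of ℂ)).inv]
    change _ ≫ ((T.left.toSpecΓ ≫ Spec.map _) ≫ Spec.map _).appTop = _
    rw [Category.assoc, ← Spec.map_comp, appTop_toSpecΓ_map]
    ext c
    exact hf c)

lemma comorphism_affinePoint (f : A →+* Fn T) (hf) (a : A) :
    comorphism (affinePoint f hf) a = f a :=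
  ConcreteCategory.congr_hom (appTop_toSpecΓ_map T.left (CommRingCat.ofHom f)) a

variable {B : Type} [CommRing B] [Algebra ℂ B]

lemma comorphism_affineMap (f : A →ₐ[ℂ] B) (a : A) :
    comorphism (affineMap f) a = toFn B (f a) := by
  have h := Scheme.ΓSpecIso_inv_naturality (CommRingCat.ofHom f.toRingHom)
  exact (ConcreteCategory.congr_hom h a).symm

lemma comorphism_comp_affineMap (p : T ⟶ affineOver B) (f : A →ₐ[ℂ] B) (a : A) :
    comorphism (p ≫ affineMap f) a = comorphism p (f a) := by
  rw [comorphism_comp, comorphism_affineMap, comorphism_apply]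

end AffinePoints

/-! ### Actions on affine schemes and coactions -/

section Coaction

variable {B : Type} [CommRing B] [Algebra ℂ B]

/-- The coaction of a `ℂ₊`-action on an affine scheme, as a ring homomorphism. -/
def GaAction.coactionHom (a : GaAction (affineOver B)) : B →+* Polynomial B :=
  (RingEquiv.ofBijective _ (toFn_bijective (A := Polynomial B))).symm.toRingHom.comp
    (comorphism (a.act (toFn (Polynomial B) Polynomial.X)
      (affineMap (Algebra.ofId B (Polynomial B) |>.restrictScalars ℂ))))

lemma GaAction.toFn_coactionHom (a : GaAction (affineOver B)) (b : B) :
    toFn (Polynomial B) (a.coactionHom b) =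
      comorphism (a.act (toFn (Polynomial B) Polynomial.X)
        (affineMap (Algebra.ofId B (Polynomial B) |>.restrictScalars ℂ))) b :=
  (RingEquiv.ofBijective _ (toFn_bijective (A := Polynomial B))).apply_symm_apply _

/-- Every pair (s, p) is the pull-back of the universal pair on Spec B[X], where the coaction is
defined; naturality does the rest. -/
lemma GaAction.comorphism_act (a : GaAction (affineOver B)) {T : CScheme} (s : Fn T)
    (p : T ⟶ affineOver B) (b : B) :
    comorphism (a.act s p) b = (a.coactionHom b).eval₂ (comorphism p) s := by
  let q : T ⟶ affineOver (Polynomial B) := affinePoint (Polynomial.eval₂RingHom (comorphism p) s)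
    fun c => by
      rw [Polynomial.algebraMap_apply, Polynomial.coe_eval₂RingHom, Polynomial.eval₂_C,
        comorphism_algebraMap]
  have hq : ∀ f, comorphism q f = f.eval₂ (comorphism p) s := fun f =>
    comorphism_affinePoint _ _ _
  have h1 : p = q ≫ affineMap (Algebra.ofId B (Polynomial B) |>.restrictScalars ℂ) := by
    apply affine_hom_ext
    intro b
    rw [comorphism_comp_affineMap, hq]
    exact (Polynomial.eval₂_C _ _).symm
  have h2 : s = pull q (toFn (Polynomial B) Polynomial.X) := by
    rw [← comorphism_apply, hq, Polynomial.eval₂_X]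
  rw [← hq, comorphism_apply q, toFn_coactionHom, ← comorphism_comp, a.act_natural, ← h1, ← h2]

lemma GaAction.coaction_algebraMap (a : GaAction (affineOver B)) (c : ℂ) :
    a.coactionHom (algebraMap ℂ B c) = algebraMap ℂ _ c := by
  apply (toFn_bijective (A := Polynomial B)).1
  rw [toFn_coactionHom, comorphism_algebraMap, const_affineOver]

/-- Two actions with the same coaction are equal. -/
lemma GaAction.ext_coactionHom {a a' : GaAction (affineOver B)}
    (h : a.coactionHom = a'.coactionHom) : a = a' := by
  apply GaAction.ext
  funext T s p
  apply affine_hom_ext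
  intro b
  rw [comorphism_act, comorphism_act, h]

lemma GaAction.coeff_zero_coactionHom (a : GaAction (affineOver B)) (b : B) :
    (a.coactionHom b).coeff 0 = b := by
  apply (toFn_bijective (A := B)).1
  have h := a.comorphism_act 0 (𝟙 (affineOver B)) b
  rw [a.act_zero, Polynomial.eval₂_at_zero, comorphism_id, comorphism_id] at h
  exact h.symm

lemma GaAction.coaction_coaction (a : GaAction (affineOver B)) {R : Type} [CommRing R]
    [Algebra ℂ R] (f : B →ₐ[ℂ] R) (s t : R) (b : B) :
    (a.coactionHom b).eval₂ (f : B →+* R) (s + t) =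
      (a.coactionHom b).eval₂
        ((Polynomial.eval₂RingHom (f : B →+* R) t).comp a.coactionHom) s := by
  apply (toFn_bijective (A := R)).1
  have hf : comorphism (affineMap f) = (toFn R).comp (f : B →+* R) :=
    RingHom.ext (comorphism_affineMap f)
  have h := congrArg (fun p => comorphism p b) (a.act_add (toFn R s) (toFn R t) (affineMap f))
  simp only [comorphism_act, ← map_add] at h
  rw [Polynomial.hom_eval₂, ← hf, h, Polynomial.hom_eval₂]
  congr 1
  ext b'
  rw [comorphism_act, RingHom.comp_apply, RingHom.comp_apply, Polynomial.coe_eval₂RingHom,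
    Polynomial.hom_eval₂, ← hf]

/-- The derivation which corresponds to a `ℂ₊`-action on an affine scheme. -/
def GaAction.derivation (a : GaAction (affineOver B)) : Derivation ℂ B B :=
  Derivation.mk'
    { toFun := fun b => (a.coactionHom b).coeff 1
      map_add' := fun b c => by rw [map_add, Polynomial.coeff_add]
      map_smul' := fun c b => by
        rw [Algebra.smul_def, map_mul, a.coaction_algebraMap, Polynomial.algebraMap_apply,
          Polynomial.coeff_C_mul, RingHom.id_apply, Algebra.smul_def] } (fun b c => by
    change (a.coactionHom (b * c)).coeff 1 = _
    rw [map_mul, Polynomial.mul_coeff_one, a.coeff_zero_coactionHom, a.coeff_zero_coactionHom]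
    change b * (a.coactionHom c).coeff 1 + _ = b * (a.coactionHom c).coeff 1 +
      c * (a.coactionHom b).coeff 1
    ring)

lemma GaAction.derivation_apply (a : GaAction (affineOver B)) (b : B) :
    a.derivation b = (a.coactionHom b).coeff 1 := rfl

/-- The part of the group law φ(b)(s + t) linear in s: the derivative of φ(b) is φ(D b). Thus the
coaction is the exponential of t D. -/
lemma GaAction.coeff_coactionHom_succ (a : GaAction (affineOver B)) (b : B) (j : ℕ) :
    (j + 1) * (a.coactionHom b).coeff (j + 1) = (a.coactionHom (a.derivation b)).coeff j := by
  let f : B →ₐ[ℂ] Polynomial (Polynomial B) :=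
    ((Algebra.ofId (Polynomial B) (Polynomial (Polynomial B))).restrictScalars ℂ).comp
      ((Algebra.ofId B (Polynomial B)).restrictScalars ℂ)
  have h := a.coaction_coaction f Polynomial.X (Polynomial.C Polynomial.X) b
  have h1 : (a.coactionHom b).eval₂ (f : B →+* Polynomial (Polynomial B))
      (Polynomial.X + Polynomial.C Polynomial.X) =
        Polynomial.taylor Polynomial.X ((a.coactionHom b).map Polynomial.C) := by
    rw [Polynomial.taylor_apply, Polynomial.comp, Polynomial.eval₂_map]
    rfl
  have h2 : (Polynomial.eval₂RingHom (f : B →+* Polynomial (Polynomial B))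
      (Polynomial.C Polynomial.X)).comp a.coactionHom = Polynomial.C.comp a.coactionHom := by
    refine RingHom.ext fun b => ?_
    rw [RingHom.comp_apply, RingHom.comp_apply, Polynomial.coe_eval₂RingHom]
    exact (Polynomial.hom_eval₂ _ Polynomial.C Polynomial.C Polynomial.X).symm.trans (by
      rw [Polynomial.eval₂_C_X])
  have h3 : (a.coactionHom b).eval₂ (Polynomial.C.comp a.coactionHom) Polynomial.X =
      (a.coactionHom b).map a.coactionHom := by
    rw [← Polynomial.eval₂_map, Polynomial.eval₂_C_X]
  rw [h1, h2, h3] at h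
  have h4 := congrArg (fun p => (p.coeff 1).coeff j) h
  rw [Polynomial.taylor_coeff_one, Polynomial.derivative_map, Polynomial.eval_map,
    Polynomial.eval₂_C_X, Polynomial.coeff_derivative, Polynomial.coeff_map] at h4
  rw [mul_comm]
  exact h4

/-- The k-th iterate of D is k! times the k-th coefficient of the coaction, which is a polynomial.
-/
lemma GaAction.locallyNilpotent (a : GaAction (affineOver B)) : LocallyNilpotent a.derivation := by
  intro b
  have h : ∀ k b, (k.factorial : B) * (a.coactionHom b).coeff k = a.derivation^[k] b := by
    intro k
    induction k with
    | zero => intro b; simp [a.coeff_zero_coactionHom]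
    | succ k ih =>
      intro b
      rw [Function.iterate_succ_apply, ← ih, ← a.coeff_coactionHom_succ, Nat.factorial_succ]
      push_cast
      ring
  refine ⟨(a.coactionHom b).natDegree + 1, ?_⟩
  rw [← h, Polynomial.coeff_eq_zero_of_natDegree_lt (Nat.lt_succ_self _), mul_zero]

lemma GaAction.coactionHom_eq_C_iff (a : GaAction (affineOver B)) (b : B) :
    a.coactionHom b = Polynomial.C b ↔ a.derivation b = 0 := by
  constructor
  · intro h
    rw [a.derivation_apply, h, Polynomial.coeff_C_of_ne_zero one_ne_zero]
  · intro h
    ext j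
    cases j with
    | zero => rw [a.coeff_zero_coactionHom, Polynomial.coeff_C_zero]
    | succ j =>
      have h1 := a.coeff_coactionHom_succ b j
      rw [h, map_zero, Polynomial.coeff_zero] at h1
      rw [Polynomial.coeff_C_of_ne_zero (Nat.succ_ne_zero j)]
      have h2 : algebraMap ℂ B ((j + 1 : ℂ)⁻¹) * (j + 1) = 1 := by
        rw [← map_natCast (algebraMap ℂ B), ← map_one (algebraMap ℂ B), ← map_add, ← map_mul,
          inv_mul_cancel₀ (by exact_mod_cast Nat.succ_ne_zero j)]
      rw [← one_mul ((a.coactionHom b).coeff _), ← h2, mul_assoc, h1, mul_zero]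

/-- Invariance needs testing only at the universal point, where it says that the coaction is
constant. -/
lemma GaAction.toFn_mem_invariants_iff (a : GaAction (affineOver B)) (b : B) :
    toFn B b ∈ a.invariants ↔ a.derivation b = 0 := by
  rw [← a.coactionHom_eq_C_iff]
  constructor
  · intro h
    apply (toFn_bijective (A := Polynomial B)).1
    rw [a.toFn_coactionHom]
    refine (h _ _ _).trans ?_
    exact comorphism_affineMap _ b
  · intro h T s p
    change comorphism (a.act s p) b = comorphism p b
    rw [a.comorphism_act, h, Polynomial.eval₂_C]

lemma GaAction.derivation_ne_zero {a : GaAction (affineOver B)} (ha : a.Nontrivial) :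
    a.derivation ≠ 0 := by
  intro h
  obtain ⟨T, s, p, hp⟩ := ha
  refine hp (affine_hom_ext fun b => ?_)
  rw [a.comorphism_act, (a.coactionHom_eq_C_iff b).mpr (by rw [h]; rfl), Polynomial.eval₂_C]

/-- The action defined by a coaction. -/
def actionOfCoaction (φ : B →ₐ[ℂ] Polynomial B) (h0 : ∀ b, (φ b).eval 0 = b)
    (hadd : ∀ b, (φ b).eval₂ (Polynomial.C.comp Polynomial.C)
        (Polynomial.X + Polynomial.C Polynomial.X) =
      (φ b).eval₂ ((Polynomial.C : Polynomial B →+* _).comp (φ : B →+* Polynomial B))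
        Polynomial.X) : GaAction (affineOver B) where
  act {T} s p := affinePoint
    ((Polynomial.eval₂RingHom (comorphism p) s).comp (φ : B →+* Polynomial B)) fun c => by
      rw [RingHom.comp_apply, AlgHom.coe_toRingHom, AlgHom.commutes, Polynomial.algebraMap_apply,
        Polynomial.coe_eval₂RingHom, Polynomial.eval₂_C, comorphism_algebraMap]
  act_zero p := by
    apply affine_hom_ext
    intro b
    rw [comorphism_affinePoint]
    change (φ b).eval₂ _ _ = _
    rw [Polynomial.eval₂_at_zero, Polynomial.coeff_zero_eq_eval_zero, h0]
  act_add s t p := by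
    apply affine_hom_ext
    intro b
    rw [comorphism_affinePoint, comorphism_affinePoint]
    change (φ b).eval₂ _ _ = (φ b).eval₂ _ _
    have h := congrArg (Polynomial.eval₂ (Polynomial.eval₂RingHom (comorphism p) t) s) (hadd b)
    rw [← Polynomial.coe_eval₂RingHom, Polynomial.hom_eval₂, Polynomial.hom_eval₂] at h
    simp only [Polynomial.coe_eval₂RingHom, Polynomial.eval₂_add, Polynomial.eval₂_X,
      Polynomial.eval₂_C] at h
    convert h using 2
    · ext b
      simp
    · ext b
      rw [comorphism_affinePoint]
      simp
  act_natural f s p := by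
    apply affine_hom_ext
    intro b
    rw [comorphism_comp, comorphism_affinePoint, comorphism_affinePoint]
    change pull f ((φ b).eval₂ _ _) = (φ b).eval₂ _ _
    rw [Polynomial.hom_eval₂]
    congr 1

lemma comorphism_act_actionOfCoaction (φ : B →ₐ[ℂ] Polynomial B) (h0) (hadd) {T : CScheme}
    (s : Fn T) (p : T ⟶ affineOver B) (b : B) :
    comorphism ((actionOfCoaction φ h0 hadd).act s p) b = (φ b).eval₂ (comorphism p) s := by
  simp only [actionOfCoaction]
  rw [comorphism_affinePoint]
  rfl

lemma coactionHom_actionOfCoaction (φ : B →ₐ[ℂ] Polynomial B) (h0) (hadd) (b : B) :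
    (actionOfCoaction φ h0 hadd).coactionHom b = φ b := by
  apply (toFn_bijective (A := Polynomial B)).1
  rw [GaAction.toFn_coactionHom, comorphism_act_actionOfCoaction]
  have h : comorphism (affineMap (Algebra.ofId B (Polynomial B) |>.restrictScalars ℂ)) =
      (toFn (Polynomial B)).comp Polynomial.C := RingHom.ext (comorphism_affineMap _)
  rw [h, ← Polynomial.hom_eval₂, Polynomial.eval₂_C_X]

end Coaction

/-! ### The algebraic quotient -/

section Quotient

variable {n r : ℕ} {m : Fin n → ℕ} {σ : Fin r → Poly n}

/-- The ring of invariants of a nontrivial action on the hypersurface is `ℂ[x₁, …, xₙ]`. -/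
def invariantsEquiv (hr : 2 ≤ r) (hm : ∀ k, 1 < m k) (a : GaAction (hypersurface m σ))
    (ha : a.Nontrivial) : Poly n ≃+* a.invariants :=
  have h := map_eq_zero_iff_mem_range hr hm a.locallyNilpotent (a.derivation_ne_zero ha)
  RingEquiv.ofBijective
    (((toFn (CoordRing m σ)).comp (xHom m σ : Poly n →+* CoordRing m σ)).codRestrict a.invariants
      fun p => (a.toFn_mem_invariants_iff _).mpr ((h _).mpr ⟨p, rfl⟩)) (by
    constructor
    · intro p q hpq
      exact xHom_injective (toFn_bijective.1 (congrArg Subtype.val hpq))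
    · rintro ⟨f, hf⟩
      obtain ⟨b, rfl⟩ := (toFn_bijective (A := CoordRing m σ)).2 f
      obtain ⟨p, rfl⟩ := (h b).mp ((a.toFn_mem_invariants_iff b).mp hf)
      exact ⟨p, rfl⟩)

lemma toSpecΓ_comp_map {R S : CommRingCat.{0}} (f : S ⟶ Γ(Spec R, ⊤)) :
    (Spec R).toSpecΓ ≫ Spec.map f = Spec.map (f ≫ (Scheme.ΓSpecIso R).hom) := by
  rw [Spec.map_comp, SpecMap_ΓSpecIso_hom]

lemma quotientMap_eq {B : Type} [CommRing B] [Algebra ℂ B] (a : GaAction (affineOver B)) :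
    a.quotientMap = Spec.map (CommRingCat.ofHom a.invariants.subtype ≫
      (Scheme.ΓSpecIso (CommRingCat.of B)).hom) :=
  toSpecΓ_comp_map (R := CommRingCat.of B) _

theorem exists_quotient_iso (hr : 2 ≤ r) (hm : ∀ k, 1 < m k) (a : GaAction (hypersurface m σ))
    (ha : a.Nontrivial) :
    ∃ e : a.quotient ≅ (affineN n).left, a.quotientMap ≫ e.hom = (prX m σ).left := by
  refine ⟨Scheme.Spec.mapIso (invariantsEquiv hr hm a ha).toCommRingCatIso.op, ?_⟩
  rw [quotientMap_eq]
  refine (Spec.map_comp _ _).symm.trans (congrArg Spec.map ?_)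
  refine CommRingCat.hom_ext (RingHom.ext fun p => ?_)
  exact ConcreteCategory.congr_hom (Scheme.ΓSpecIso (CommRingCat.of (CoordRing m σ))).inv_hom_id _

end Quotient

/-! ### The standard action and the trivializations -/

section Standard

variable {n r : ℕ} {m : Fin n → ℕ} {σ : Fin r → Poly n}

instance : CommRing (CoordRing m σ) := Ideal.Quotient.commRing _

lemma xHom_monom_ne_zero : xHom m σ (monom m) ≠ 0 :=
  (map_ne_zero_iff _ xHom_injective).mpr (monom_ne_zero m)

/-- The image of z is forced: with w = x^[m] t, the difference of ∏ (y + w - σᵢ) and ∏ (y - σᵢ) is w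
R for some R, so z must go to z + t R. -/
lemma exists_standardCoaction : ∃ φ : CoordRing m σ →ₐ[ℂ] Polynomial (CoordRing m σ),
    (∀ a, φ (xHom m σ a) = Polynomial.C (xHom m σ a)) ∧
    φ (coord m σ Coord.y) = Polynomial.C (coord m σ Coord.y) +
      Polynomial.C (xHom m σ (monom m)) * Polynomial.X := by
  let w : Polynomial (CoordRing m σ) := Polynomial.C (xHom m σ (monom m)) * Polynomial.X
  let Q : Polynomial (Polynomial (CoordRing m σ)) :=
    ∏ i, (Polynomial.X - Polynomial.C (Polynomial.C (xHom m σ (σ i))))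
  obtain ⟨R, hR⟩ := Polynomial.sub_dvd_eval_sub (Polynomial.C (coord m σ Coord.y) + w)
    (Polynomial.C (coord m σ Coord.y)) Q
  have hQ : ∀ v, Q.eval v = ∏ i, (v - Polynomial.C (xHom m σ (σ i))) := fun v => by
    simp [Q, Polynomial.eval_prod]
  let f : Poly n →ₐ[ℂ] Polynomial (CoordRing m σ) :=
    ((Algebra.ofId _ (Polynomial (CoordRing m σ))).restrictScalars ℂ).comp (xHom m σ)
  have hf : ∀ a, f a = Polynomial.C (xHom m σ a) := fun _ => rfl
  refine ⟨coordLift f (Polynomial.C (coord m σ Coord.y) + w)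
    (Polynomial.C (coord m σ Coord.z) + Polynomial.X * R) ?_, coordLift_xHom _ _ _ _,
    coordLift_y _ _ _ _⟩
  have h := coord_relation m σ
  have h' : Q.eval (Polynomial.C (coord m σ Coord.y)) =
      Polynomial.C (xHom m σ (monom m)) * Polynomial.C (coord m σ Coord.z) := by
    rw [hQ, ← Polynomial.C_mul, h, map_prod]
    simp only [map_sub]
  rw [hQ (_ + w), h', add_sub_cancel_left] at hR
  simp only [hf]
  linear_combination -hR

/-- The coaction `y ↦ y + x ^ [m] t`. -/
def standardCoaction (m : Fin n → ℕ) (σ : Fin r → Poly n) :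
    CoordRing m σ →ₐ[ℂ] Polynomial (CoordRing m σ) := exists_standardCoaction.choose

lemma standardCoaction_xHom (a : Poly n) :
    standardCoaction m σ (xHom m σ a) = Polynomial.C (xHom m σ a) :=
  exists_standardCoaction.choose_spec.1 a

lemma standardCoaction_y : standardCoaction m σ (coord m σ Coord.y) =
    Polynomial.C (coord m σ Coord.y) + Polynomial.C (xHom m σ (monom m)) * Polynomial.X :=
  exists_standardCoaction.choose_spec.2

lemma eval_zero_standardCoaction (hr : 0 < r) (b : CoordRing m σ) :
    (standardCoaction m σ b).eval 0 = b := by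
  have := coordRing_isDomain (m := m) (σ := σ) hr
  have h : (Polynomial.evalRingHom (0 : CoordRing m σ)).comp
      (standardCoaction m σ).toRingHom = RingHom.id _ := by
    refine coordRing_ringHom_ext_of_mem_nonZeroDivisors (fun a => ?_) ?_ ?_
    · simp [standardCoaction_xHom]
    · simp [standardCoaction_y]
    · simpa [standardCoaction_xHom] using xHom_monom_ne_zero
  exact RingHom.congr_fun h b

lemma standardCoaction_add (hr : 0 < r) (b : CoordRing m σ) :
    (standardCoaction m σ b).eval₂ (Polynomial.C.comp Polynomial.C)
        (Polynomial.X + Polynomial.C Polynomial.X) =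
      (standardCoaction m σ b).eval₂ ((Polynomial.C : Polynomial (CoordRing m σ) →+* _).comp
        (standardCoaction m σ : CoordRing m σ →+* _)) Polynomial.X := by
  have := coordRing_isDomain (m := m) (σ := σ) hr
  have h : (Polynomial.eval₂RingHom (S := Polynomial (Polynomial (CoordRing m σ)))
        (Polynomial.C.comp (Polynomial.C : CoordRing m σ →+* Polynomial (CoordRing m σ)))
        (Polynomial.X + Polynomial.C Polynomial.X)).comp (standardCoaction m σ).toRingHom =
      (Polynomial.eval₂RingHom (S := Polynomial (Polynomial (CoordRing m σ)))
        ((Polynomial.C : Polynomial (CoordRing m σ) →+* _).comp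
          (standardCoaction m σ).toRingHom) Polynomial.X).comp
            (standardCoaction m σ).toRingHom := by
    refine coordRing_ringHom_ext_of_mem_nonZeroDivisors
      (S := Polynomial (Polynomial (CoordRing m σ))) (fun a => ?_) ?_ ?_
    · simp [standardCoaction_xHom]
    · simp [standardCoaction_y, standardCoaction_xHom]
      ring
    · simpa [standardCoaction_xHom] using xHom_monom_ne_zero
  exact RingHom.congr_fun h b

/-- The action `y ↦ y + s x ^ [m]` of the additive group on the hypersurface. -/
def standardAction (hr : 0 < r) (m : Fin n → ℕ) (σ : Fin r → Poly n) :
    GaAction (hypersurface m σ) :=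
  actionOfCoaction (standardCoaction m σ) (eval_zero_standardCoaction hr)
    (standardCoaction_add hr)

lemma comorphism_standardAction (hr : 0 < r) {T : CScheme} (s : Fn T)
    (p : T ⟶ hypersurface m σ) (b : CoordRing m σ) :
    comorphism ((standardAction hr m σ).act s p) b =
      (standardCoaction m σ b).eval₂ (comorphism p) s := by
  rw [standardAction, comorphism_act_actionOfCoaction]

variable (m σ) in
/-- The product of the factors `y - σⱼ(x)` with `j ≠ i`. -/
def cofactor (i : Fin r) : CoordRing m σ :=
  ∏ j ∈ Finset.univ.erase i, (coord m σ Coord.y - xHom m σ (σ j))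

lemma mul_cofactor (i : Fin r) : (coord m σ Coord.y - xHom m σ (σ i)) * cofactor m σ i =
    xHom m σ (monom m) * coord m σ Coord.z :=
  (Finset.mul_prod_erase _ (fun j => coord m σ Coord.y - xHom m σ (σ j))
    (Finset.mem_univ i)).trans (coord_relation m σ).symm

variable (m σ) in
/-- The homomorphism which corresponds to `(x, t) ↦ (x, σᵢ(x) + x ^ [m] t, …)`. -/
def chartHom (i : Fin r) : CoordRing m σ →ₐ[ℂ] Polynomial (Poly n) :=
  coordLift ((Algebra.ofId (Poly n) (Polynomial (Poly n))).restrictScalars ℂ)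
    (Polynomial.C (σ i) + Polynomial.C (monom m) * Polynomial.X)
    (Polynomial.X * ∏ j ∈ Finset.univ.erase i,
      (Polynomial.C (σ i) + Polynomial.C (monom m) * Polynomial.X - Polynomial.C (σ j))) (by
    change Polynomial.C (monom m) * (Polynomial.X * _) =
      ∏ j, (Polynomial.C (σ i) + Polynomial.C (monom m) * Polynomial.X - Polynomial.C (σ j))
    rw [← Finset.mul_prod_erase _ _ (Finset.mem_univ i), add_sub_cancel_left, ← mul_assoc])

lemma chartHom_xHom (i : Fin r) (a : Poly n) : chartHom m σ i (xHom m σ a) = Polynomial.C a :=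
  coordLift_xHom _ _ _ _ _

lemma chartHom_y (i : Fin r) : chartHom m σ i (coord m σ Coord.y) =
    Polynomial.C (σ i) + Polynomial.C (monom m) * Polynomial.X := coordLift_y _ _ _ _

lemma chartHom_cofactor (i : Fin r) : chartHom m σ i (cofactor m σ i) =
    ∏ j ∈ Finset.univ.erase i,
      (Polynomial.C (σ i) + Polynomial.C (monom m) * Polynomial.X - Polynomial.C (σ j)) := by
  rw [cofactor, map_prod]
  simp only [map_sub, chartHom_xHom, chartHom_y]

lemma chartHom_z (i : Fin r) : chartHom m σ i (coord m σ Coord.z) =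
    Polynomial.X * chartHom m σ i (cofactor m σ i) := by
  rw [chartHom_cofactor]
  exact coordLift_z _ _ _ _

/-- In the chart (x, t) the standard action is the translation of t. It suffices to compare x and y,
because x^[m] is not a zero divisor. -/
lemma chartHom_coaction (i : Fin r) (b : CoordRing m σ) :
    (standardCoaction m σ b).eval₂ (Polynomial.C.comp (chartHom m σ i : CoordRing m σ →+* _))
        Polynomial.X =
      (chartHom m σ i b).eval₂ (Polynomial.C.comp Polynomial.C)
        (Polynomial.X + Polynomial.C Polynomial.X) := by
  have h : (Polynomial.eval₂RingHom (S := Polynomial (Polynomial (Poly n)))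
        (Polynomial.C.comp (chartHom m σ i).toRingHom)
        Polynomial.X).comp (standardCoaction m σ).toRingHom =
      (Polynomial.eval₂RingHom (S := Polynomial (Polynomial (Poly n)))
        (Polynomial.C.comp (Polynomial.C : Poly n →+* Polynomial (Poly n)))
        (Polynomial.X + Polynomial.C Polynomial.X)).comp (chartHom m σ i).toRingHom := by
    refine coordRing_ringHom_ext_of_mem_nonZeroDivisors
      (S := Polynomial (Polynomial (Poly n))) (fun a => ?_) ?_ ?_
    · simp [standardCoaction_xHom, chartHom_xHom]
    · simp [standardCoaction_y, chartHom_y, chartHom_xHom]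
      ring
    · simpa [standardCoaction_xHom, chartHom_xHom] using monom_ne_zero m
  exact RingHom.congr_fun h b

/-! #### The trivializations on points -/

/-- The point `(p, t)` of `ℂⁿ × ℂ`. -/
def pairPoint {A : Type} [CommRing A] [Algebra ℂ A] {T : CScheme} (p : T ⟶ affineOver A)
    (t : Fn T) : T ⟶ affineOver (Polynomial A) :=
  affinePoint (Polynomial.eval₂RingHom (comorphism p) t) fun c => by
    rw [Polynomial.algebraMap_apply, Polynomial.coe_eval₂RingHom, Polynomial.eval₂_C,
      comorphism_algebraMap]

lemma comorphism_pairPoint {A : Type} [CommRing A] [Algebra ℂ A] {T : CScheme}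
    (p : T ⟶ affineOver A) (t : Fn T) (f : Polynomial A) :
    comorphism (pairPoint p t) f = f.eval₂ (comorphism p) t :=
  comorphism_affinePoint _ _ _

variable (m σ) in
/-- The point `(x, σᵢ(x) + x ^ [m] t, …)` of the hypersurface. -/
def chartPoint (i : Fin r) {T : CScheme} (p : T ⟶ affineN n) (t : Fn T) : T ⟶ hypersurface m σ :=
  pairPoint p t ≫ affineMap (chartHom m σ i)

variable {T : CScheme} (i : Fin r) (p : T ⟶ affineN n) (t : Fn T)

lemma comorphism_chartPoint (b : CoordRing m σ) : comorphism (chartPoint m σ i p t) b =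
    (chartHom m σ i b).eval₂ (comorphism p) t := by
  rw [chartPoint, comorphism_comp_affineMap, comorphism_pairPoint]

lemma comp_chartPoint {T' : CScheme} (f : T' ⟶ T) :
    f ≫ chartPoint m σ i p t = chartPoint m σ i (f ≫ p) (pull f t) := by
  apply affine_hom_ext
  intro b
  rw [comorphism_comp, comorphism_chartPoint, comorphism_chartPoint, Polynomial.hom_eval₂]
  rfl

lemma comorphism_chartPoint_xHom (a : Poly n) :
    comorphism (chartPoint m σ i p t) (xHom m σ a) = comorphism p a := by
  rw [comorphism_chartPoint, chartHom_xHom, Polynomial.eval₂_C]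

lemma comorphism_chartPoint_y : comorphism (chartPoint m σ i p t) (coord m σ Coord.y) =
    comorphism p (σ i) + comorphism p (monom m) * t := by
  rw [comorphism_chartPoint, chartHom_y]
  simp

lemma comorphism_chartPoint_z : comorphism (chartPoint m σ i p t) (coord m σ Coord.z) =
    t * comorphism (chartPoint m σ i p t) (cofactor m σ i) := by
  rw [comorphism_chartPoint, comorphism_chartPoint, chartHom_z, Polynomial.eval₂_mul,
    Polynomial.eval₂_X]

lemma comorphism_comp_prX (q : T ⟶ hypersurface m σ) (a : Poly n) :
    comorphism (q ≫ prX m σ) a = comorphism q (xHom m σ a) :=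
  comorphism_comp_affineMap q _ a

lemma chartPoint_prX : chartPoint m σ i p t ≫ prX m σ = p := by
  apply affine_hom_ext
  intro a
  rw [comorphism_comp_prX, comorphism_chartPoint_xHom]

lemma act_chartPoint (hr : 0 < r) (s : Fn T) :
    (standardAction hr m σ).act s (chartPoint m σ i p t) = chartPoint m σ i p (s + t) := by
  apply affine_hom_ext
  intro b
  rw [comorphism_standardAction, comorphism_chartPoint]
  have h := congrArg (Polynomial.eval₂ (Polynomial.eval₂RingHom (comorphism p) t) s)
    (chartHom_coaction i b)
  rw [← Polynomial.coe_eval₂RingHom, Polynomial.hom_eval₂, Polynomial.hom_eval₂] at h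
  simp only [Polynomial.coe_eval₂RingHom, Polynomial.eval₂_add, Polynomial.eval₂_X,
    Polynomial.eval₂_C] at h
  have h1 : (Polynomial.eval₂RingHom (Polynomial.eval₂RingHom (comorphism p) t) s).comp
      (Polynomial.C.comp (chartHom m σ i : CoordRing m σ →+* Polynomial (Poly n))) =
        comorphism (chartPoint m σ i p t) := by
    refine RingHom.ext fun b => ?_
    rw [comorphism_chartPoint]
    simp
  have h2 : (Polynomial.eval₂RingHom (Polynomial.eval₂RingHom (comorphism p) t) s).comp
      (Polynomial.C.comp Polynomial.C) = comorphism p := RingHom.ext fun b => by simp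
  rw [h1, h2] at h
  exact h

/-- A point which has the form `(x, σᵢ(x) + x ^ [m] t, …)`. -/
lemma eq_chartPoint_iff (q : T ⟶ hypersurface m σ) :
    q = chartPoint m σ i (q ≫ prX m σ) t ↔
      t * comorphism q (xHom m σ (monom m)) =
          comorphism q (coord m σ Coord.y - xHom m σ (σ i)) ∧
        t * comorphism q (cofactor m σ i) = comorphism q (coord m σ Coord.z) := by
  constructor
  · intro h
    rw [h]
    simp only [← comorphism_chartPoint_z, map_sub, comorphism_chartPoint_xHom,
      comorphism_chartPoint_y, and_true]
    ring
  · rintro ⟨h1, h2⟩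
    have hy : comorphism q (coord m σ Coord.y) =
        comorphism (chartPoint m σ i (q ≫ prX m σ) t) (coord m σ Coord.y) := by
      rw [comorphism_chartPoint_y, comorphism_comp_prX, comorphism_comp_prX, mul_comm, h1, map_sub,
        add_sub_cancel]
    have hx : ∀ a, comorphism q (xHom m σ a) =
        comorphism (chartPoint m σ i (q ≫ prX m σ) t) (xHom m σ a) := fun a => by
      rw [comorphism_chartPoint_xHom, comorphism_comp_prX]
    apply affine_hom_ext
    refine RingHom.congr_fun (coordRing_ringHom_ext hx hy ?_)
    rw [comorphism_chartPoint_z, ← h2]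
    simp only [cofactor, map_prod, map_sub, hx, hy]

end Standard

/-! ### The open subsets `X_i` of the hypersurface -/

section ChartOpen

variable {n r : ℕ} {m : Fin n → ℕ} {σ : Fin r → Poly n}

/-! ### The polynomials σᵢ along the coordinate hyperplanes -/

section Ideal

variable {S : Type} [CommRing S] [Algebra ℂ S] {f : Poly n →ₐ[ℂ] S} {I : Ideal S}

lemma map_sub_mem_of_dvd {a : Poly n}
    (ha : coordProd n ∣ a - MvPolynomial.C (MvPolynomial.eval 0 a)) (hI : f (coordProd n) ∈ I) :
    f a - algebraMap ℂ S (MvPolynomial.eval 0 a) ∈ I := by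
  have h := I.mem_of_dvd (map_dvd f ha) hI
  rwa [map_sub, ← MvPolynomial.algebraMap_eq, AlgHom.commutes] at h

lemma map_monom_mem (hm : ∀ k, 1 < m k) (hI : f (coordProd n) ∈ I) : f (monom m) ∈ I :=
  I.mem_of_dvd (map_dvd f ((dvd_pow_self _ two_ne_zero).trans (coordProd_sq_dvd_monom hm))) hI

/-- Where x₁⋯xₙ vanishes every σᵢ equals the constant σᵢ(0), so the difference is a nonzero
constant, hence a unit. -/
lemma map_sub_map_notMem [hI : I.IsPrime] {i j : Fin r}
    (hσ₁ : MvPolynomial.eval 0 (σ i) ≠ MvPolynomial.eval 0 (σ j))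
    (hσ₂ : ∀ i, coordProd n ∣ σ i - MvPolynomial.C (MvPolynomial.eval 0 (σ i)))
    (hπ : f (coordProd n) ∈ I) : f (σ i) - f (σ j) ∉ I := by
  intro h
  have h1 : algebraMap ℂ S (MvPolynomial.eval 0 (σ i) - MvPolynomial.eval 0 (σ j)) ∈ I := by
    have := I.sub_mem (I.add_mem h (map_sub_mem_of_dvd (hσ₂ j) hπ))
      (map_sub_mem_of_dvd (hσ₂ i) hπ)
    convert this using 1
    rw [map_sub]
    ring
  exact hI.ne_top (I.eq_top_of_isUnit_mem h1 ((sub_ne_zero.mpr hσ₁).isUnit.map _))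

end Ideal

variable (m σ) in
/-- The open subset of the hypersurface on which `x₁ ⋯ xₙ` and the cofactor of `y - σᵢ(x)` do not
vanish simultaneously. -/
def chartOpen (i : Fin r) : (hypersurface m σ).left.Opens :=
  PrimeSpectrum.basicOpen (xHom m σ (coordProd n)) ⊔ PrimeSpectrum.basicOpen (cofactor m σ i)

lemma mem_chartOpen_iff {i : Fin r} {p : PrimeSpectrum (CoordRing m σ)} :
    p ∈ chartOpen m σ i ↔ xHom m σ (coordProd n) ∉ p.asIdeal ∨ cofactor m σ i ∉ p.asIdeal :=
  Iff.rfl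

/-- Over x₁⋯xₙ = 0 the product of the y - σⱼ is zero and no two of its factors vanish at the same
point, so exactly one does. -/
lemma cofactor_notMem_iff (hσ₁ : ∀ i j, i ≠ j → MvPolynomial.eval 0 (σ i) ≠
      MvPolynomial.eval 0 (σ j))
    (hσ₂ : ∀ i, coordProd n ∣ σ i - MvPolynomial.C (MvPolynomial.eval 0 (σ i)))
    (hm : ∀ k, 1 < m k) {I : Ideal (CoordRing m σ)} [hI : I.IsPrime]
    (hπ : xHom m σ (coordProd n) ∈ I) (i : Fin r) :
    cofactor m σ i ∉ I ↔ coord m σ Coord.y - xHom m σ (σ i) ∈ I := by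
  constructor
  · intro h
    have h1 : (coord m σ Coord.y - xHom m σ (σ i)) * cofactor m σ i ∈ I := by
      rw [mul_cofactor]
      exact I.mul_mem_right _ (map_monom_mem hm hπ)
    exact (hI.mem_or_mem h1).resolve_right h
  · intro h h1
    obtain ⟨j, hj, hj'⟩ := (hI.prod_mem_iff).mp h1
    refine map_sub_map_notMem (hσ₁ j i (Finset.ne_of_mem_erase hj)) hσ₂ hπ ?_
    convert I.sub_mem h hj' using 1
    ring

lemma mem_preimage_torus_iff {p : PrimeSpectrum (CoordRing m σ)} :
    p ∈ (prX m σ).left ⁻¹' (torus n : Set (affineN n).left) ↔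
      xHom m σ (coordProd n) ∉ p.asIdeal := Iff.rfl

lemma mem_component_iff {i : Fin r}
    (hσ₂ : ∀ i, coordProd n ∣ σ i - MvPolynomial.C (MvPolynomial.eval 0 (σ i)))
    {p : PrimeSpectrum (CoordRing m σ)} :
    p ∈ component m σ i ↔ xHom m σ (coordProd n) ∈ p.asIdeal ∧
      coord m σ Coord.y - xHom m σ (σ i) ∈ p.asIdeal := by
  rw [component, xHom_coordProd]
  refine (PrimeSpectrum.mem_zeroLocus _ _).trans ?_
  rw [Set.insert_subset_iff, Set.singleton_subset_iff, SetLike.mem_coe, SetLike.mem_coe]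
  refine and_congr_right fun hπ => ?_
  rw [← xHom_coordProd] at hπ
  have h := p.asIdeal.add_mem_iff_left (a := coord m σ Coord.y - xHom m σ (σ i))
    (map_sub_mem_of_dvd (hσ₂ i) hπ)
  rwa [sub_add_sub_cancel] at h

lemma coe_chartOpen (hσ₁ : ∀ i j, i ≠ j → MvPolynomial.eval 0 (σ i) ≠ MvPolynomial.eval 0 (σ j))
    (hσ₂ : ∀ i, coordProd n ∣ σ i - MvPolynomial.C (MvPolynomial.eval 0 (σ i)))
    (hm : ∀ k, 1 < m k) (i : Fin r) : (chartOpen m σ i : Set (hypersurface m σ).left) =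
      (prX m σ).left ⁻¹' (torus n : Set (affineN n).left) ∪ component m σ i := by
  ext p
  have h1 := mem_chartOpen_iff (m := m) (σ := σ) (i := i) (p := p)
  have h2 := mem_preimage_torus_iff (m := m) (σ := σ) (p := p)
  have h3 := mem_component_iff (m := m) (σ := σ) (i := i) hσ₂ (p := p)
  refine h1.trans (Iff.trans ?_ (or_congr h2 h3).symm)
  by_cases hπ : xHom m σ (coordProd n) ∈ p.asIdeal
  · have h4 := cofactor_notMem_iff hσ₁ hσ₂ hm (hI := p.2) hπ i
    tauto
  · tauto

lemma iSup_chartOpen (hr : 0 < r)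
    (hσ₁ : ∀ i j, i ≠ j → MvPolynomial.eval 0 (σ i) ≠ MvPolynomial.eval 0 (σ j))
    (hσ₂ : ∀ i, coordProd n ∣ σ i - MvPolynomial.C (MvPolynomial.eval 0 (σ i)))
    (hm : ∀ k, 1 < m k) : TopologicalSpace.IsOpenCover (chartOpen m σ) := by
  refine TopologicalSpace.Opens.ext (Set.eq_univ_of_forall fun p => ?_)
  rw [SetLike.mem_coe, TopologicalSpace.Opens.mem_iSup]
  by_cases hπ : xHom m σ (coordProd n) ∈ p.asIdeal
  · have h1 : ∏ i, (coord m σ Coord.y - xHom m σ (σ i)) ∈ p.asIdeal := by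
      rw [← coord_relation]
      exact p.asIdeal.mul_mem_right _ (map_monom_mem hm hπ)
    obtain ⟨i, -, hi⟩ := (p.2.prod_mem_iff).mp h1
    exact ⟨i, mem_chartOpen_iff.mpr
      (Or.inr ((cofactor_notMem_iff hσ₁ hσ₂ hm (hI := p.2) hπ i).mpr hi))⟩
  · exact ⟨⟨0, hr⟩, mem_chartOpen_iff.mpr (Or.inl hπ)⟩

/-- This matches the gluing of Z_{n,r}: a common point over the hyperplanes would have y equal to
both σᵢ(0) and σⱼ(0). -/
lemma chartOpen_inf_le (hσ₁ : ∀ i j, i ≠ j → MvPolynomial.eval 0 (σ i) ≠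
      MvPolynomial.eval 0 (σ j))
    (hσ₂ : ∀ i, coordProd n ∣ σ i - MvPolynomial.C (MvPolynomial.eval 0 (σ i)))
    (hm : ∀ k, 1 < m k) {i j : Fin r} (hij : i ≠ j) {p : PrimeSpectrum (CoordRing m σ)}
    (hi : p ∈ chartOpen m σ i) (hj : p ∈ chartOpen m σ j) :
    xHom m σ (coordProd n) ∉ p.asIdeal := by
  intro hπ
  rw [mem_chartOpen_iff] at hi hj
  have h1 := (cofactor_notMem_iff hσ₁ hσ₂ hm hπ i).mp (hi.resolve_left (not_not.mpr hπ))
  have h2 := (cofactor_notMem_iff hσ₁ hσ₂ hm hπ j).mp (hj.resolve_left (not_not.mpr hπ))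
  refine map_sub_map_notMem (hσ₁ j i hij.symm) hσ₂ hπ ?_
  convert p.asIdeal.sub_mem h1 h2 using 1
  ring

lemma affineMap_chartHom_mem
    (hσ₁ : ∀ i j, i ≠ j → MvPolynomial.eval 0 (σ i) ≠ MvPolynomial.eval 0 (σ j))
    (hσ₂ : ∀ i, coordProd n ∣ σ i - MvPolynomial.C (MvPolynomial.eval 0 (σ i)))
    (hm : ∀ k, 1 < m k) (i : Fin r) (p : PrimeSpectrum (Polynomial (Poly n))) :
    (affineMap (chartHom m σ i)).left p ∈ chartOpen m σ i := by
  refine mem_chartOpen_iff.mpr ?_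
  change chartHom m σ i (xHom m σ (coordProd n)) ∉ p.asIdeal ∨
    chartHom m σ i (cofactor m σ i) ∉ p.asIdeal
  rw [chartHom_xHom, chartHom_cofactor]
  by_contra! h
  let f : Poly n →ₐ[ℂ] Polynomial (Poly n) :=
    (Algebra.ofId (Poly n) (Polynomial (Poly n))).restrictScalars ℂ
  have hf : f (coordProd n) ∈ p.asIdeal := h.1
  obtain ⟨j, hj, hj'⟩ := (p.2.prod_mem_iff).mp h.2
  refine map_sub_map_notMem (hI := p.2) (hσ₁ i j (Finset.ne_of_mem_erase hj).symm) hσ₂ hf ?_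
  -- On this locus x^[m] = 0, so the chart has y = σᵢ and each factor of the cofactor reduces to σᵢ
  -- - σⱼ.
  convert p.asIdeal.sub_mem hj' (p.asIdeal.mul_mem_right Polynomial.X (map_monom_mem hm hf))
    using 1
  change Polynomial.C (σ i) - Polynomial.C (σ j) =
    (Polynomial.C (σ i) + Polynomial.C (monom m) * Polynomial.X - Polynomial.C (σ j)) -
      Polynomial.C (monom m) * Polynomial.X
  ring

end ChartOpen

/-! ### The glued space -/

section Glued

variable {n r : ℕ}

instance (i : Fin r) : IsOpenImmersion (chart n i).left :=
  (glueData n r).ι_isOpenImmersion i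

lemma overlap_chart (i j : Fin r) :
    (overlap n i j).ι ≫ (chart n i).left = (overlap n i j).ι ≫ (chart n j).left := by
  have h1 : ((affineN n).left.isoOfEq (overlap_comm n i j)).hom ≫ (overlap n j i).ι ≫
      (chart n j).left = (overlap n i j).ι ≫ (chart n i).left :=
    (glueData n r).glue_condition i j
  rw [← h1, Scheme.isoOfEq_hom_ι_assoc]

lemma comp_chart_eq {T : Scheme.{0}} (g : T ⟶ (affineN n).left) {i j : Fin r}
    (h : Set.range g ⊆ overlap n i j) : g ≫ (chart n i).left = g ≫ (chart n j).left := by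
  have hr : Set.range g ⊆ Set.range (overlap n i j).ι := by rwa [Scheme.Opens.range_ι]
  rw [← IsOpenImmersion.lift_fac (overlap n i j).ι g hr, Category.assoc, Category.assoc,
    overlap_chart]

lemma chart_delta (i : Fin r) : chart n i ≫ delta n r = 𝟙 _ :=
  Over.OverMorphism.ext (Multicoequalizer.π_desc _ _ _ _ _)

/-- The image of the `i`-th copy of `ℂⁿ` in the glued space. -/
def chartRange (n : ℕ) {r : ℕ} (i : Fin r) : (multiSpace n r).left.Opens :=
  (chart n i).left.opensRange

lemma exists_mem_chartRange (z : (multiSpace n r).left) : ∃ i : Fin r, z ∈ chartRange n i := by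
  obtain ⟨i, p, hp⟩ := (glueData n r).ι_jointly_surjective z
  exact ⟨i, p, hp⟩

lemma chart_mem_chartRange_iff {i j : Fin r} {p : (affineN n).left} :
    (chart n j).left p ∈ chartRange n i ↔ p ∈ overlap n j i := by
  constructor
  · rintro ⟨q, hq⟩
    obtain ⟨v, hv1, hv2⟩ := ((glueData n r).ι_eq_iff j i p q).mp hq.symm
    have hv : (overlap n j i).ι v = p := hv1
    rw [← hv]
    exact Subtype.property v
  · intro h
    refine ⟨p, ?_⟩
    exact (congrArg (fun f : (overlap n j i).toScheme ⟶ _ => f ⟨p, h⟩) (overlap_chart j i)).symm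

/-- A point of the `i`-th copy of `ℂⁿ` is determined by its image in `ℂⁿ`. -/
lemma eq_comp_delta_comp_chart {T : CScheme} {u : T ⟶ multiSpace n r} {i : Fin r}
    (hu : ∀ t, u.left t ∈ chartRange n i) : u = (u ≫ delta n r) ≫ chart n i := by
  have hr : Set.range u.left ⊆ Set.range (chart n i).left := by
    rintro _ ⟨t, rfl⟩
    exact hu t
  let v := IsOpenImmersion.lift (chart n i).left u.left hr
  have h1 : v ≫ (chart n i).left = u.left := IsOpenImmersion.lift_fac _ _ _
  have h2 : (chart n i).left ≫ (delta n r).left = 𝟙 _ := congrArg CommaMorphism.left (chart_delta i)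
  apply Over.OverMorphism.ext
  rw [Over.comp_left, Over.comp_left, ← h1, Category.assoc v, h2, Category.comp_id]

end Glued

/-! ### Division of functions on a scheme -/

section Division

variable {X : Scheme.{0}} {ι : Type}

lemma eq_of_eq_on_basicOpen {f : ι → Γ(X, ⊤)} (hf : ⨆ i, X.basicOpen (f i) = ⊤) {s t : Γ(X, ⊤)}
    (h : ∀ i, X.presheaf.map (homOfLE le_top : X.basicOpen (f i) ⟶ ⊤).op s =
      X.presheaf.map (homOfLE le_top : X.basicOpen (f i) ⟶ ⊤).op t) : s = t :=
  X.sheaf.eq_of_locally_eq' (fun i => X.basicOpen (f i)) ⊤ (fun _ => homOfLE le_top) hf.ge s t h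

lemma isUnit_map_basicOpen (f : Γ(X, ⊤)) :
    IsUnit (X.presheaf.map (homOfLE le_top : X.basicOpen f ⟶ ⊤).op f) :=
  X.toRingedSpace.isUnit_res_basicOpen f

lemma eq_of_mul_eq_mul {f : ι → Γ(X, ⊤)} (hf : ⨆ i, X.basicOpen (f i) = ⊤) {s t : Γ(X, ⊤)}
    (h : ∀ i, s * f i = t * f i) : s = t := by
  refine eq_of_eq_on_basicOpen hf fun i => (isUnit_map_basicOpen (f i)).mul_right_cancel ?_
  rw [← map_mul, ← map_mul, h]

/-- The fractions aᵢ / fᵢ exist where fᵢ is invertible, agree on overlaps by cross multiplication,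
and glue. No fᵢ has to be a non zero divisor, so this applies to points with values in any scheme.
-/
lemma exists_mul_eq {f a : ι → Γ(X, ⊤)} (hf : ⨆ i, X.basicOpen (f i) = ⊤)
    (h : ∀ i j, f i * a j = f j * a i) : ∃ t, ∀ i, t * f i = a i := by
  let res : ∀ i, Γ(X, ⊤) ⟶ Γ(X, X.basicOpen (f i)) := fun i =>
    X.presheaf.map (homOfLE le_top : X.basicOpen (f i) ⟶ ⊤).op
  have hu : ∀ i, ∃ s, s * res i (f i) = res i (a i) := fun i => by
    obtain ⟨v, hv⟩ := (isUnit_map_basicOpen (f i)).exists_left_inv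
    exact ⟨res i (a i) * v, by rw [mul_assoc]; exact (congrArg _ hv).trans (mul_one _)⟩
  choose s hs using hu
  obtain ⟨t, ht⟩ : ∃ t : Γ(X, ⊤), ∀ i, res i t = s i := by
    refine (X.sheaf.existsUnique_gluing' (fun i => X.basicOpen (f i)) ⊤
      (fun _ => homOfLE le_top) hf.ge s ?_).exists
    intro i j
    let l : Γ(X, X.basicOpen (f i)) ⟶ Γ(X, X.basicOpen (f i) ⊓ X.basicOpen (f j)) :=
      X.presheaf.map (homOfLE inf_le_left).op
    let l' : Γ(X, X.basicOpen (f j)) ⟶ Γ(X, X.basicOpen (f i) ⊓ X.basicOpen (f j)) :=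
      X.presheaf.map (homOfLE inf_le_right).op
    change l (s i) = l' (s j)
    have hl : ∀ x, l (res i x) = l' (res j x) := fun x => by
      have : res i ≫ l = res j ≫ l' := by
        simp only [res, l, l', ← Functor.map_comp]
        rfl
      exact ConcreteCategory.congr_hom this x
    have h1 : IsUnit (l (res i (f i))) := (isUnit_map_basicOpen (f i)).map l.hom
    have h2 : IsUnit (l (res i (f j))) := by
      rw [hl]
      exact (isUnit_map_basicOpen (f j)).map l'.hom
    have h3 : l (s i) * l (res i (f i)) = l (res i (a i)) := by rw [← map_mul, hs]
    have h4 : l' (s j) * l (res i (f j)) = l (res i (a j)) := by rw [hl, hl, ← map_mul, hs]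
    have h5 : l (res i (f i)) * l (res i (a j)) = l (res i (f j)) * l (res i (a i)) := by
      rw [← map_mul, ← map_mul, h, map_mul, map_mul]
    apply (h1.mul h2).mul_right_cancel
    linear_combination l (res i (f j)) * h3 - l (res i (f i)) * h4 - h5
  refine ⟨t, fun i => eq_of_eq_on_basicOpen hf fun j => ?_⟩
  apply (isUnit_map_basicOpen (f j)).mul_right_cancel
  change res j _ * res j _ = res j _ * res j _
  rw [map_mul, ht, mul_right_comm, hs, ← map_mul, ← map_mul, mul_comm _ (f j), h j i, mul_comm]

end Division

/-! ### The standard bundle -/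

section StandardBundle

variable {n r : ℕ} {m : Fin n → ℕ} {σ : Fin r → Poly n}

lemma mem_basicOpen_comorphism_iff {A : Type} [CommRing A] [Algebra ℂ A] {T : CScheme}
    (q : T ⟶ affineOver A) (a : A) (t : T.left) :
    t ∈ T.left.basicOpen (comorphism q a) ↔ q.left t ∈ PrimeSpectrum.basicOpen a := by
  have h : q.left ⁻¹ᵁ (affineOver A).left.basicOpen (toFn A a) =
      T.left.basicOpen (comorphism q a) := Scheme.preimage_basicOpen_top q.left (toFn A a)
  have h2 : (affineOver A).left.basicOpen (toFn A a) = PrimeSpectrum.basicOpen a :=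
    basicOpen_eq_of_affine (R := CommRingCat.of A) a
  rw [← h, h2]
  rfl

lemma basicOpen_coordProd_le (p : PrimeSpectrum (CoordRing m σ))
    (hp : xHom m σ (coordProd n) ∉ p.asIdeal) : xHom m σ (monom m) ∉ p.asIdeal := by
  contrapose! hp
  rw [xHom_monom, p.2.prod_mem_iff] at hp
  obtain ⟨k, hk, h⟩ := hp
  rw [xHom_coordProd]
  exact p.2.prod_mem_iff.mpr ⟨k, hk, p.2.mem_of_pow_mem _ h⟩

/-- The fibre coordinate is (y - σᵢ) / x^[m] where x^[m] is invertible and z / cofactor where the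
cofactor is; `mul_cofactor` makes the two agree. -/
lemma existsUnique_eq_chartPoint {T : CScheme} (q : T ⟶ hypersurface m σ) (i : Fin r)
    (hq : ∀ t, q.left t ∈ chartOpen m σ i) :
    ∃! t, q = chartPoint m σ i (q ≫ prX m σ) t := by
  let f : Bool → Fn T := fun b =>
    comorphism q (cond b (xHom m σ (monom m)) (cofactor m σ i))
  let a : Bool → Fn T := fun b =>
    comorphism q (cond b (coord m σ Coord.y - xHom m σ (σ i)) (coord m σ Coord.z))
  have hf : ⨆ b, T.left.basicOpen (f b) = ⊤ := by
    refine top_le_iff.mp fun t _ => TopologicalSpace.Opens.mem_iSup.mpr ?_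
    obtain h | h := mem_chartOpen_iff.mp (hq t)
    · exact ⟨true, (mem_basicOpen_comorphism_iff q _ t).mpr (basicOpen_coordProd_le _ h)⟩
    · exact ⟨false, (mem_basicOpen_comorphism_iff q _ t).mpr h⟩
  have hfa : ∀ b c, f b * a c = f c * a b := by
    have h := congrArg (comorphism q) (mul_cofactor (m := m) (σ := σ) i)
    rw [map_mul, map_mul] at h
    have h' : f true * a false = f false * a true := h.symm.trans (mul_comm _ _)
    rintro (_ | _) (_ | _)
    · rfl
    · exact h'.symm
    · exact h'
    · rfl
  obtain ⟨t, ht⟩ := exists_mul_eq hf hfa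
  refine ⟨t, (eq_chartPoint_iff i t q).mpr ⟨ht true, ht false⟩, fun s hs => ?_⟩
  obtain ⟨h1, h2⟩ := (eq_chartPoint_iff i s q).mp hs
  refine eq_of_mul_eq_mul hf fun b => ?_
  rw [ht]
  cases b
  · exact h2
  · exact h1

variable (hr : 0 < r)
  (hσ₁ : ∀ i j, i ≠ j → MvPolynomial.eval 0 (σ i) ≠ MvPolynomial.eval 0 (σ j))
  (hσ₂ : ∀ i, coordProd n ∣ σ i - MvPolynomial.C (MvPolynomial.eval 0 (σ i)))
  (hm : ∀ k, 1 < m k)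

-- The maps pr_x from Xᵢ to the i-th copy of ℂⁿ agree on overlaps, which lie over the torus, where
-- the copies are identified.
include hr hσ₁ hσ₂ hm in
lemma exists_standardProj : ∃ ρ : hypersurface m σ ⟶ multiSpace n r,
    ρ ≫ delta n r = prX m σ ∧ ∀ i, ρ.left ⁻¹ᵁ chartRange n i = chartOpen m σ i := by
  let 𝒰 := (hypersurface m σ).left.openCoverOfIsOpenCover _ (iSup_chartOpen hr hσ₁ hσ₂ hm)
  let f : ∀ i : Fin r, (chartOpen m σ i).toScheme ⟶ (multiSpace n r).left := fun i =>
    (chartOpen m σ i).ι ≫ (prX m σ).left ≫ (chart n i).left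
  have hf : ∀ i j : Fin r, pullback.fst (chartOpen m σ i).ι (chartOpen m σ j).ι ≫ f i =
      pullback.snd (chartOpen m σ i).ι (chartOpen m σ j).ι ≫ f j := by
    intro i j
    simp only [f]
    rw [← pullback.condition_assoc]
    simp only [← Category.assoc]
    refine comp_chart_eq _ ?_
    rintro _ ⟨t, rfl⟩
    by_cases hij : i = j
    · rw [overlap, if_pos hij]
      trivial
    · rw [overlap, if_neg hij]
      have h1 := (pullback.fst (chartOpen m σ i).ι (chartOpen m σ j).ι t).2
      have h2 := (pullback.snd (chartOpen m σ i).ι (chartOpen m σ j).ι t).2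
      have h3 : (pullback.fst (chartOpen m σ i).ι (chartOpen m σ j).ι ≫ (chartOpen m σ i).ι) t =
        (pullback.snd (chartOpen m σ i).ι (chartOpen m σ j).ι ≫ (chartOpen m σ j).ι) t := by
        rw [pullback.condition]
      exact mem_preimage_torus_iff.mpr (chartOpen_inf_le hσ₁ hσ₂ hm hij h1 (h3 ▸ h2))
  let ρ : (hypersurface m σ).left ⟶ (multiSpace n r).left := 𝒰.glueMorphisms f hf
  have hρ : ∀ i, (chartOpen m σ i).ι ≫ ρ =
      (chartOpen m σ i).ι ≫ (prX m σ).left ≫ (chart n i).left := fun i =>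
    𝒰.ι_glueMorphisms f _ i
  have hδ : ρ ≫ (delta n r).left = (prX m σ).left := by
    refine Scheme.Cover.hom_ext 𝒰 _ _ fun (i : Fin r) => ?_
    change (chartOpen m σ i).ι ≫ ρ ≫ (delta n r).left = (chartOpen m σ i).ι ≫ _
    have h : (chart n i).left ≫ (delta n r).left = 𝟙 _ :=
      congrArg CommaMorphism.left (chart_delta i)
    rw [← Category.assoc, hρ, Category.assoc, Category.assoc, h, Category.comp_id]
  refine ⟨Over.homMk ρ ?_, Over.OverMorphism.ext hδ, fun i => ?_⟩
  · rw [← Over.w (delta n r), ← Category.assoc, hδ]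
    exact Over.w (prX m σ)
  · ext p
    have hcov : p ∈ ⨆ i, chartOpen m σ i := by
      rw [(iSup_chartOpen hr hσ₁ hσ₂ hm).iSup_eq_top]
      trivial
    obtain ⟨j, hj⟩ := TopologicalSpace.Opens.mem_iSup.mp hcov
    have h1 : ρ p = (chart n j).left ((prX m σ).left p) :=
      congrArg (fun g : (chartOpen m σ j).toScheme ⟶ _ => g ⟨p, hj⟩) (hρ j)
    change ρ p ∈ chartRange n i ↔ p ∈ chartOpen m σ i
    rw [h1, chart_mem_chartRange_iff, overlap]
    split_ifs with hij
    · exact iff_of_true trivial (hij ▸ hj)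
    · exact ⟨fun h => mem_chartOpen_iff.mpr (Or.inl (mem_preimage_torus_iff.mp h)),
        fun h => mem_preimage_torus_iff.mpr (chartOpen_inf_le hσ₁ hσ₂ hm hij hj h)⟩

end StandardBundle

/-! ### Local triviality of the standard bundle -/

section Bundle

variable {n r : ℕ} {m : Fin n → ℕ} {σ : Fin r → Poly n}

lemma openIncl_mem {Z : CScheme} (U : Z.left.Opens) {T : CScheme} (u : T ⟶ openSub Z U)
    (t : T.left) : (u ≫ openIncl Z U).left t ∈ U :=
  Subtype.property (p := fun z => z ∈ U) (u.left t)

variable (m σ) in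
/-- The trivialization of the standard bundle over the `i`-th copy of `ℂⁿ`. -/
def trivialization (i : Fin r) :
    line (openSub (multiSpace n r) (chartRange n i)) ⟶ hypersurface m σ :=
  chartPoint m σ i
    (lineProj _ ≫ openIncl (multiSpace n r) (chartRange n i) ≫ delta n r) (lineCoord _)

lemma comp_trivialization {T : CScheme} (i : Fin r)
    (u : T ⟶ line (openSub (multiSpace n r) (chartRange n i))) :
    u ≫ trivialization m σ i = chartPoint m σ i
      ((u ≫ lineProj _) ≫ openIncl (multiSpace n r) (chartRange n i) ≫ delta n r)
      (pull u (lineCoord _)) := by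
  rw [trivialization, comp_chartPoint, Category.assoc]

lemma translation_equivariant_trivialization (hr : 0 < r) (i : Fin r) :
    (translation (openSub (multiSpace n r) (chartRange n i))).Equivariant
      (standardAction hr m σ) (trivialization m σ i) := by
  intro T s x
  rw [comp_trivialization, comp_trivialization, act_chartPoint]
  exact congrArg₂ _ (by rw [translation, linePair_proj]) (pull_linePair _ _)

/-- Checked on points: a T-point of the fibre product is a T-point of X lying in Xᵢ, and such a
point is the same as its image in ℂⁿ with a unique fibre coordinate. -/
lemma isPullback_trivialization
    (hσ₁ : ∀ i j, i ≠ j → MvPolynomial.eval 0 (σ i) ≠ MvPolynomial.eval 0 (σ j))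
    (hσ₂ : ∀ i, coordProd n ∣ σ i - MvPolynomial.C (MvPolynomial.eval 0 (σ i)))
    (hm : ∀ k, 1 < m k) {ρ : hypersurface m σ ⟶ multiSpace n r}
    (hδ : ρ ≫ delta n r = prX m σ) (hρ : ∀ i, ρ.left ⁻¹ᵁ chartRange n i = chartOpen m σ i)
    (i : Fin r) : IsPullback (trivialization m σ i) (lineProj _) ρ
      (openIncl (multiSpace n r) (chartRange n i)) := by
  have hmem : ∀ {T : CScheme} (q : T ⟶ hypersurface m σ) (t : T.left),
      (q ≫ ρ).left t ∈ chartRange n i ↔ q.left t ∈ chartOpen m σ i := fun q t => by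
    rw [← hρ]
    rfl
  have hw : trivialization m σ i ≫ ρ = lineProj _ ≫ openIncl (multiSpace n r) (chartRange n i) := by
    have h : (trivialization m σ i ≫ ρ) ≫ delta n r =
        (lineProj _ ≫ openIncl (multiSpace n r) (chartRange n i)) ≫ delta n r := by
      rw [Category.assoc, hδ, trivialization, chartPoint_prX, Category.assoc]
    -- Two maps with the same composite with δ may differ, but not when both land in the i-th copy.
    rw [eq_comp_delta_comp_chart (u := trivialization m σ i ≫ ρ) (i := i)
      fun t => (hmem _ t).mpr (affineMap_chartHom_mem hσ₁ hσ₂ hm i _),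
      eq_comp_delta_comp_chart (u := lineProj _ ≫ _) (openIncl_mem _ _), h]
  have key : ∀ (s : PullbackCone ρ (openIncl (multiSpace n r) (chartRange n i))) (t : Fn s.pt),
      linePair s.snd t ≫ trivialization m σ i =
        chartPoint m σ i (s.fst ≫ prX m σ) t := fun s t => by
    rw [comp_trivialization, linePair_proj, pull_linePair, ← hδ, ← Category.assoc, ← s.condition,
      Category.assoc]
  have hex : ∀ s : PullbackCone ρ (openIncl (multiSpace n r) (chartRange n i)),
      ∃! t, s.fst = chartPoint m σ i (s.fst ≫ prX m σ) t := fun s =>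
    existsUnique_eq_chartPoint s.fst i fun t => by
      rw [← hmem, s.condition]
      exact openIncl_mem _ _ t
  refine ⟨⟨hw⟩, ⟨PullbackCone.IsLimit.mk _ (fun s => linePair s.snd (hex s).choose)
    (fun s => ?_) (fun s => linePair_proj _ _) fun s l h1 h2 => ?_⟩⟩
  · rw [key]
    exact (hex s).choose_spec.1.symm
  · have hl : l = linePair s.snd (pull l (lineCoord _)) :=
      line_hom_ext (by rw [linePair_proj, h2]) (pull_linePair _ _).symm
    rw [hl]
    refine congrArg _ ((hex s).choose_spec.2 _ ?_)
    change s.fst = _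
    rw [← key, ← hl, h1]

theorem exists_standardBundle (hr : 0 < r)
    (hσ₁ : ∀ i j, i ≠ j → MvPolynomial.eval 0 (σ i) ≠ MvPolynomial.eval 0 (σ j))
    (hσ₂ : ∀ i, coordProd n ∣ σ i - MvPolynomial.C (MvPolynomial.eval 0 (σ i)))
    (hm : ∀ k, 1 < m k) : ∃ P : PrincipalBundle (hypersurface m σ) (multiSpace n r),
      IsStandard m σ P ∧ P.action = standardAction hr m σ := by
  obtain ⟨ρ, hδ, hρ⟩ := exists_standardProj hr hσ₁ hσ₂ hm
  let P : PrincipalBundle (hypersurface m σ) (multiSpace n r) :=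
    { proj := ρ
      action := standardAction hr m σ
      locally_trivial := fun z => by
        obtain ⟨i, hi⟩ := exists_mem_chartRange z
        exact ⟨chartRange n i, trivialization m σ i, hi,
          isPullback_trivialization hσ₁ hσ₂ hm hδ hρ i,
          translation_equivariant_trivialization hr i⟩ }
  refine ⟨P, ⟨hδ, fun i => ?_, fun s p k => ?_, fun s p => ?_⟩, rfl⟩
  · rw [← coe_chartOpen hσ₁ hσ₂ hm, ← hρ]
    rfl
  · change comorphism ((standardAction hr m σ).act s p) _ = comorphism p _
    rw [comorphism_standardAction, ← xHom_X, standardCoaction_xHom, Polynomial.eval₂_C]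
  · change comorphism ((standardAction hr m σ).act s p) _ =
      comorphism p _ + s * comorphism p _
    rw [comorphism_standardAction, standardCoaction_y, ← xHom_monom, Polynomial.eval₂_add,
      Polynomial.eval₂_mul, Polynomial.eval₂_C, Polynomial.eval₂_C, Polynomial.eval₂_X, mul_comm s]

end Bundle

/-! ### Gluing of morphisms of complex schemes -/

section Gluing

variable {Z W : CScheme}

instance (U : Z.left.Opens) : Mono (openIncl Z U) :=
  (Over.forget SpecC).mono_of_mono_map (inferInstanceAs (Mono U.ι))

lemma over_hom_ext_of_forall {f g : Z ⟶ W}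
    (h : ∀ z : Z.left, ∃ U : Z.left.Opens, z ∈ U ∧ openIncl Z U ≫ f = openIncl Z U ≫ g) :
    f = g := by
  apply Over.OverMorphism.ext
  refine Scheme.hom_ext_of_forall _ _ fun z => ?_
  obtain ⟨U, hz, hU⟩ := h z
  exact ⟨U, hz, congrArg CommaMorphism.left hU⟩

lemma exists_lift_openIncl {T : CScheme} (p : T ⟶ Z) (U : Z.left.Opens)
    (hp : ∀ t, p.left t ∈ U) : ∃ w : T ⟶ openSub Z U, w ≫ openIncl Z U = p := by
  have hr : Set.range p.left ⊆ Set.range U.ι := by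
    rw [Scheme.Opens.range_ι]
    rintro _ ⟨t, rfl⟩
    exact hp t
  let l : T.left ⟶ U.toScheme := IsOpenImmersion.lift U.ι p.left hr
  have h : l ≫ U.ι = p.left := IsOpenImmersion.lift_fac _ _ _
  refine ⟨Over.homMk l ?_, Over.OverMorphism.ext h⟩
  change l ≫ U.ι ≫ Z.hom = _
  rw [← Category.assoc, h, Over.w]

lemma exists_glue {ι : Type} {U : ι → Z.left.Opens} (hU : TopologicalSpace.IsOpenCover U)
    (φ : ∀ i, openSub Z (U i) ⟶ W)
    (h : ∀ (i j : ι) (T : CScheme) (u : T ⟶ openSub Z (U i)) (v : T ⟶ openSub Z (U j)),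
      u ≫ openIncl Z (U i) = v ≫ openIncl Z (U j) → u ≫ φ i = v ≫ φ j) :
    ∃ ψ : Z ⟶ W, ∀ i, openIncl Z (U i) ≫ ψ = φ i := by
  let 𝒰 := Z.left.openCoverOfIsOpenCover U hU
  let f : ∀ i : ι, (U i).toScheme ⟶ W.left := fun i => (φ i).left
  have hf : ∀ i j : ι, pullback.fst (U i).ι (U j).ι ≫ f i = pullback.snd (U i).ι (U j).ι ≫ f j := by
    intro i j
    let T : CScheme := Over.mk (pullback.fst (U i).ι (U j).ι ≫ (U i).ι ≫ Z.hom)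
    let u : T ⟶ openSub Z (U i) := Over.homMk (pullback.fst (U i).ι (U j).ι) rfl
    let v : T ⟶ openSub Z (U j) := Over.homMk (pullback.snd (U i).ι (U j).ι) (by
      change _ ≫ (U j).ι ≫ _ = pullback.fst (U i).ι (U j).ι ≫ (U i).ι ≫ Z.hom
      rw [pullback.condition_assoc])
    exact congrArg CommaMorphism.left
      (h i j T u v (Over.OverMorphism.ext pullback.condition))
  let ψ : Z.left ⟶ W.left := 𝒰.glueMorphisms f hf
  have hψ : ∀ i, (U i).ι ≫ ψ = (φ i).left := fun i => 𝒰.ι_glueMorphisms f _ i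
  refine ⟨Over.homMk ψ (Scheme.Cover.hom_ext 𝒰 _ _ fun (i : ι) => ?_), fun i =>
    Over.OverMorphism.ext (hψ i)⟩
  change (U i).ι ≫ ψ ≫ W.hom = (U i).ι ≫ Z.hom
  rw [← Category.assoc, hψ]
  exact Over.w (φ i)

end Gluing

/-! ### Principal bundles -/

namespace PrincipalBundle

variable {X Z W T : CScheme} (P : PrincipalBundle X Z)

/-- Two points in the same fibre are locally contained in a trivial part of the bundle. -/
lemma exists_local_lift {x y : T ⟶ X} (h : x ≫ P.proj = y ≫ P.proj) (t : T.left) :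
    ∃ (V : T.left.Opens) (S : CScheme) (e : line S ⟶ X) (u v : openSub T V ⟶ line S), t ∈ V ∧
      Mono e ∧ (translation S).Equivariant P.action e ∧ openIncl T V ≫ x = u ≫ e ∧
      openIncl T V ≫ y = v ≫ e ∧ u ≫ lineProj S = v ≫ lineProj S ∧
      ∃ i : S ⟶ Z, e ≫ P.proj = lineProj S ≫ i := by
  obtain ⟨U, e, ht, he, heq⟩ := P.locally_trivial ((x ≫ P.proj).left t)
  let V := (x ≫ P.proj).left ⁻¹ᵁ U
  obtain ⟨w, hw⟩ := exists_lift_openIncl (openIncl T V ≫ x ≫ P.proj) U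
    (fun t' => openIncl_mem V (𝟙 _) t')
  have hx : (openIncl T V ≫ x) ≫ P.proj = w ≫ openIncl Z U := by rw [hw, Category.assoc]
  have hy : (openIncl T V ≫ y) ≫ P.proj = w ≫ openIncl Z U := by rw [hw, Category.assoc, h]
  have : Mono e := he.mono_fst_of_mono
  exact ⟨V, _, e, he.lift _ _ hx, he.lift _ _ hy, ht, this, heq, (he.lift_fst _ _ hx).symm,
    (he.lift_fst _ _ hy).symm, (he.lift_snd _ _ hx).trans (he.lift_snd _ _ hy).symm, _, he.w⟩

lemma act_proj (s : Fn T) (x : T ⟶ X) : P.action.act s x ≫ P.proj = x ≫ P.proj := by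
  refine over_hom_ext_of_forall fun t => ?_
  obtain ⟨V, S, e, u, -, ht, -, heq, hx, -, -, i, hi⟩ := P.exists_local_lift (x := x) rfl t
  refine ⟨V, ht, ?_⟩
  rw [← Category.assoc, ← Category.assoc, P.action.act_natural, hx, ← heq, Category.assoc,
    Category.assoc, hi, ← Category.assoc, ← Category.assoc]
  congr 1
  exact linePair_proj _ _

/-- In a local trivialization a fixed point would satisfy t + 1 = t, hence 1 = 0 on a nonempty
scheme. -/
lemma act_one_ne [Nonempty T.left] (x : T ⟶ X) : P.action.act 1 x ≠ x := by
  intro h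
  obtain ⟨t⟩ := ‹Nonempty T.left›
  obtain ⟨V, S, e, u, -, ht, he, heq, hx, -⟩ := P.exists_local_lift (x := x) rfl t
  have h1 : (translation S).act 1 u = u := by
    rw [← cancel_mono e, heq, ← hx, ← map_one (pull (openIncl T V)), ← P.action.act_natural, h]
  have h2 := congrArg (fun w => pull w (lineCoord S)) h1
  have h3 : 1 + pull u (lineCoord S) = pull u (lineCoord S) := (pull_linePair _ _).symm.trans h2
  have : Nonempty (⊤ : (openSub T V).left.Opens) := ⟨⟨⟨t, ht⟩, trivial⟩⟩
  have : Nontrivial (Fn (openSub T V)) :=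
    Scheme.component_nontrivial (openSub T V).left ⊤
  exact one_ne_zero (add_eq_right.mp h3)

/-- An invariant morphism is constant along the fibres of the projection. -/
lemma comp_eq_of_proj_eq {g : X ⟶ W}
    (hg : ∀ {T : CScheme} (s : Fn T) (x : T ⟶ X), P.action.act s x ≫ g = x ≫ g)
    {x y : T ⟶ X} (h : x ≫ P.proj = y ≫ P.proj) : x ≫ g = y ≫ g := by
  refine over_hom_ext_of_forall fun t => ?_
  obtain ⟨V, S, e, u, v, ht, -, heq, hx, hy, huv, -⟩ := P.exists_local_lift h t
  refine ⟨V, ht, ?_⟩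
  -- Points of one fibre differ by the translation by the difference of their coordinates.
  have h1 : u = (translation S).act (pull u (lineCoord S) - pull v (lineCoord S)) v := by
    apply line_hom_ext
    · exact huv.trans (linePair_proj _ _).symm
    · exact ((pull_linePair _ _).trans (sub_add_cancel _ _)).symm
  rw [← Category.assoc, ← Category.assoc, hx, hy, h1, heq, hg]

lemma exists_local_section (z : Z.left) : ∃ (U : Z.left.Opens) (s : openSub Z U ⟶ X), z ∈ U ∧
    s ≫ P.proj = openIncl Z U := by
  obtain ⟨U, e, hz, he, -⟩ := P.locally_trivial z
  refine ⟨U, linePair (𝟙 _) 0 ≫ e, hz, ?_⟩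
  rw [Category.assoc, he.w, ← Category.assoc, linePair_proj, Category.id_comp]

instance : Epi P.proj := ⟨fun φ ψ h => by
  refine over_hom_ext_of_forall fun z => ?_
  obtain ⟨U, s, hz, hs⟩ := P.exists_local_section z
  exact ⟨U, hz, by rw [← hs, Category.assoc, h, Category.assoc]⟩⟩

/-- Invariant morphisms factor through the projection. -/
lemma exists_proj_comp_eq {g : X ⟶ W}
    (hg : ∀ {T : CScheme} (s : Fn T) (x : T ⟶ X), P.action.act s x ≫ g = x ≫ g) :
    ∃ φ : Z ⟶ W, P.proj ≫ φ = g := by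
  choose U s hz hs using P.exists_local_section
  have hU : TopologicalSpace.IsOpenCover U := by
    refine TopologicalSpace.Opens.ext (Set.eq_univ_of_forall fun z => ?_)
    exact TopologicalSpace.Opens.mem_iSup.mpr ⟨z, hz z⟩
  -- The composites of g with local sections agree on overlaps, since two sections take values in
  -- the same fibres and g is constant along them.
  obtain ⟨φ, hφ⟩ := exists_glue hU (fun z => s z ≫ g) fun i j T u v huv => by
    rw [← Category.assoc, ← Category.assoc]
    refine P.comp_eq_of_proj_eq hg ?_
    rw [Category.assoc, hs, huv, Category.assoc, hs]
  refine ⟨φ, over_hom_ext_of_forall fun x => ?_⟩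
  let V := P.proj.left ⁻¹ᵁ U (P.proj.left x)
  obtain ⟨w, hw⟩ := exists_lift_openIncl (openIncl X V ≫ P.proj) (U (P.proj.left x))
    (fun t' => openIncl_mem V (𝟙 _) t')
  refine ⟨V, hz _, ?_⟩
  rw [← Category.assoc, ← hw, Category.assoc, hφ, ← Category.assoc]
  refine P.comp_eq_of_proj_eq hg ?_
  rw [Category.assoc, hs, hw]

/-- The action determines the projection up to an automorphism of the base. -/
lemma exists_iso_of_action_eq_rescale {P P' : PrincipalBundle X Z} {c : ℂˣ}
    (h : P'.action = P.action.rescale c) :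
    ∃ φ : Z ≅ Z, P'.proj = P.proj ≫ φ.hom := by
  have h1 : ∀ {T : CScheme} (s : Fn T) (x : T ⟶ X), P.action.act s x ≫ P'.proj = x ≫ P'.proj :=
    fun {T} s x => by
      have hs : P.action.act s x = P'.action.act (const T (c⁻¹ : ℂˣ) * s) x := by
        rw [h]
        change _ = P.action.act (const T c * (const T (c⁻¹ : ℂˣ) * s)) x
        rw [← mul_assoc, ← map_mul, Units.mul_inv, map_one, one_mul]
      rw [hs, act_proj]
  have h2 : ∀ {T : CScheme} (s : Fn T) (x : T ⟶ X), P'.action.act s x ≫ P.proj = x ≫ P.proj :=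
    fun s x => by
      rw [h]
      exact P.act_proj _ _
  obtain ⟨φ, hφ⟩ := P.exists_proj_comp_eq h1
  obtain ⟨ψ, hψ⟩ := P'.exists_proj_comp_eq h2
  refine ⟨⟨φ, ψ, ?_, ?_⟩, hφ.symm⟩
  · rw [← cancel_epi P.proj, ← Category.assoc, hφ, hψ, Category.comp_id]
  · rw [← cancel_epi P'.proj, ← Category.assoc, hψ, hφ, Category.comp_id]

end PrincipalBundle

/-! ### Uniqueness of the bundle structure -/

lemma GaAction.coactionHom_rescale {B : Type} [CommRing B] [Algebra ℂ B]
    (a : GaAction (affineOver B)) (c : ℂˣ) (b : B) : (a.rescale c).coactionHom b =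
      (a.coactionHom b).eval₂ Polynomial.C (Polynomial.C (algebraMap ℂ B c) * Polynomial.X) := by
  apply (toFn_bijective (A := Polynomial B)).1
  rw [toFn_coactionHom]
  refine (a.comorphism_act _ _ b).trans ?_
  have h : comorphism (affineMap (Algebra.ofId B (Polynomial B) |>.restrictScalars ℂ)) =
      (toFn (Polynomial B)).comp Polynomial.C := RingHom.ext (comorphism_affineMap _)
  rw [h, Polynomial.hom_eval₂, map_mul, const_affineOver]
  rfl

/-- If an invariant function divides all values of the derivation, then it divides all higher
coefficients of the coaction. -/
lemma GaAction.coeff_coactionHom_mem {B : Type} [CommRing B] [Algebra ℂ B]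
    (a : GaAction (affineOver B)) {f : B} (hf : a.derivation f = 0)
    (h : ∀ b, f ∣ a.derivation b) (b : B) (j : ℕ) : f ∣ (a.coactionHom b).coeff (j + 1) := by
  obtain ⟨b', hb'⟩ := h b
  have h1 := a.coeff_coactionHom_succ b j
  rw [hb', map_mul, (a.coactionHom_eq_C_iff f).mpr hf, Polynomial.coeff_C_mul] at h1
  have h2 : algebraMap ℂ B ((j : ℂ) + 1)⁻¹ * ((j : B) + 1) = 1 := by
    have : ((j : B) + 1) = algebraMap ℂ B ((j : ℂ) + 1) := by simp
    rw [this, ← map_mul, inv_mul_cancel₀ (Nat.cast_add_one_ne_zero j), map_one]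
  refine ⟨algebraMap ℂ B ((j : ℂ) + 1)⁻¹ * (a.coactionHom b').coeff j, ?_⟩
  linear_combination algebraMap ℂ B ((j : ℂ) + 1)⁻¹ * h1 - (a.coactionHom b).coeff (j + 1) * h2

section Uniqueness

variable {n r : ℕ} {m : Fin n → ℕ} {σ : Fin r → Poly n}

lemma derivation_apply_prod (D : Derivation ℂ (CoordRing m σ) (CoordRing m σ))
    (hx : ∀ a, D (xHom m σ a) = 0) (s : Finset (Fin r)) :
    D (coord m σ Coord.y) ∣ D (∏ i ∈ s, (coord m σ Coord.y - xHom m σ (σ i))) := by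
  induction s using Finset.induction_on with
  | empty => rw [Finset.prod_empty, D.map_one_eq_zero]; exact dvd_zero _
  | insert i s hi ih =>
    rw [Finset.prod_insert hi, D.leibniz, map_sub, hx, sub_zero, smul_eq_mul, smul_eq_mul]
    exact dvd_add (ih.mul_left _) (dvd_mul_left _ _)

/-- Only z needs an argument: x^[m] D z is the derivative of ∏ (y - σᵢ), a multiple of D y = a
x^[m], and x^[m] cancels. -/
lemma dvd_derivation (hr : 0 < r) {D : Derivation ℂ (CoordRing m σ) (CoordRing m σ)}
    (hx : ∀ a, D (xHom m σ a) = 0) {a : Poly n}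
    (hy : D (coord m σ Coord.y) = xHom m σ (a * monom m)) (b : CoordRing m σ) :
    xHom m σ a ∣ D b := by
  have := coordRing_isDomain (m := m) (σ := σ) hr
  have hy' : xHom m σ a ∣ D (coord m σ Coord.y) := by
    rw [hy, map_mul]
    exact dvd_mul_right _ _
  have hz : xHom m σ a ∣ D (coord m σ Coord.z) := by
    have h := congrArg D (coord_relation m σ)
    rw [D.leibniz, hx, smul_zero, add_zero, smul_eq_mul] at h
    have h1 := derivation_apply_prod D hx Finset.univ
    rw [← h, hy, mul_comm a, map_mul] at h1
    exact (mul_dvd_mul_iff_left xHom_monom_ne_zero).mp h1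
  have hmul : ∀ b v, xHom m σ a ∣ D b → xHom m σ a ∣ D v → xHom m σ a ∣ D (b * v) := by
    intro b v hb hv
    rw [D.leibniz]
    exact dvd_add (hv.mul_left _) (hb.mul_left _)
  induction b using coordRing_induction with
  | hx b => rw [hx]; exact dvd_zero _
  | hadd b c hb hc => rw [map_add]; exact dvd_add hb hc
  | hmx b k hb => exact hmul _ _ hb (by rw [← xHom_X, hx]; exact dvd_zero _)
  | hmy b hb => exact hmul _ _ hb hy'
  | hmz b hb => exact hmul _ _ hb hz

/-- If the derivation of an action is divisible by a polynomial without inverse, then the action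
has fixed points. -/
lemma exists_fixed_point (hr : 0 < r) (A : GaAction (hypersurface m σ)) {a : Poly n}
    (ha : ¬ IsUnit a) (hx : A.derivation (xHom m σ a) = 0)
    (h : ∀ b, xHom m σ a ∣ A.derivation b) :
    ∃ (T : CScheme) (p : T ⟶ hypersurface m σ), Nonempty T.left ∧ ∀ s, A.act s p = p := by
  obtain ⟨I, hI, haI⟩ := exists_max_ideal_of_mem_nonunits ha
  let f : Poly n →ₐ[ℂ] Poly n ⧸ I := Ideal.Quotient.mkₐ ℂ I
  -- The point of X over a zero of a with y = σ₀(x) and z = 0. All higher coefficients of the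
  -- coaction are multiples of a, so they vanish there.
  let g : CoordRing m σ →ₐ[ℂ] Poly n ⧸ I := coordLift f (f (σ ⟨0, hr⟩)) 0 (by
    rw [mul_zero, Finset.prod_eq_zero (Finset.mem_univ ⟨0, hr⟩) (sub_self _)])
  have hg : g (xHom m σ a) = 0 :=
    (coordLift_xHom _ _ _ _ a).trans (Ideal.Quotient.eq_zero_iff_mem.mpr haI)
  have : Nontrivial (Poly n ⧸ I) := Ideal.Quotient.nontrivial_iff.mpr hI.ne_top
  refine ⟨affineOver (Poly n ⧸ I), affineMap g,
    inferInstanceAs (Nonempty (PrimeSpectrum (Poly n ⧸ I))), fun s => ?_⟩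
  apply affine_hom_ext
  intro b
  rw [A.comorphism_act, Polynomial.eval₂_eq_sum_range, Finset.sum_eq_single 0]
  · rw [pow_zero, mul_one, A.coeff_zero_coactionHom]
  · intro j _ hj
    obtain ⟨j, rfl⟩ := Nat.exists_eq_succ_of_ne_zero hj
    obtain ⟨c, hc⟩ := A.coeff_coactionHom_mem hx h b j
    rw [Nat.succ_eq_add_one, hc, map_mul, comorphism_affineMap, hg, map_zero, zero_mul, zero_mul]
  · intro h0
    exact absurd (Finset.mem_range.mpr (Nat.succ_pos _)) h0

lemma eq_rescale_standardAction (hr : 0 < r) (A : GaAction (hypersurface m σ)) {c : ℂˣ}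
    (hx : ∀ a, A.derivation (xHom m σ a) = 0)
    (hy : A.derivation (coord m σ Coord.y) = xHom m σ (MvPolynomial.C (c : ℂ) * monom m)) :
    A = (standardAction hr m σ).rescale c := by
  have := coordRing_isDomain (m := m) (σ := σ) hr
  have hx' : ∀ a, A.coactionHom (xHom m σ a) = Polynomial.C (xHom m σ a) := fun a =>
    (A.coactionHom_eq_C_iff _).mpr (hx a)
  have hstd : ∀ b, (standardAction hr m σ).coactionHom b = standardCoaction m σ b :=
    coactionHom_actionOfCoaction _ _ _
  have hc : xHom m σ (MvPolynomial.C (c : ℂ)) = algebraMap ℂ (CoordRing m σ) c :=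
    (xHom m σ).commutes _
  have hy' : A.coactionHom (coord m σ Coord.y) = Polynomial.C (coord m σ Coord.y) +
      Polynomial.C (xHom m σ (MvPolynomial.C (c : ℂ) * monom m)) * Polynomial.X := by
    ext j
    match j with
    | 0 => simp [A.coeff_zero_coactionHom]
    | 1 =>
      rw [← A.derivation_apply, hy]
      simp [Polynomial.coeff_C]
    -- D y lies in ℂ[x] and is therefore killed, so the exponential stops after the linear term.
    | j + 2 =>
      have h := A.coeff_coactionHom_succ (coord m σ Coord.y) (j + 1)
      rw [hy, hx', Polynomial.coeff_C_of_ne_zero j.succ_ne_zero] at h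
      have : CharZero (CoordRing m σ) :=
        charZero_of_injective_algebraMap (algebraMap ℂ _).injective
      rw [(mul_eq_zero.mp h).resolve_left (Nat.cast_add_one_ne_zero _)]
      simp
  apply GaAction.ext_coactionHom
  refine coordRing_ringHom_ext_of_mem_nonZeroDivisors (S := Polynomial (CoordRing m σ))
    (fun a => ?_) ?_ ?_
  · rw [hx', GaAction.coactionHom_rescale, hstd, standardCoaction_xHom, Polynomial.eval₂_C]
  · rw [hy', GaAction.coactionHom_rescale, hstd, standardCoaction_y, Polynomial.eval₂_add,
      Polynomial.eval₂_mul, Polynomial.eval₂_C, Polynomial.eval₂_C, Polynomial.eval₂_X, map_mul, hc,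
      Polynomial.C_mul]
    ring
  · rw [hx']
    simpa using xHom_monom_ne_zero

/-- The action of a principal bundle structure is standard up to an automorphism of `ℂ₊`. -/
theorem exists_action_eq_rescale (hr : 2 ≤ r) (hm : ∀ k, 1 < m k) {Z : CScheme}
    (P : PrincipalBundle (hypersurface m σ) Z) :
    ∃ c : ℂˣ, P.action = (standardAction (by omega) m σ).rescale c := by
  have hr0 : 0 < r := by omega
  have := coordRing_isDomain (m := m) (σ := σ) hr0
  have : Nonempty (hypersurface m σ).left :=
    inferInstanceAs (Nonempty (PrimeSpectrum (CoordRing m σ)))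
  have hne := GaAction.derivation_ne_zero (a := P.action) ⟨_, 1, 𝟙 _, P.act_one_ne _⟩
  have hx := map_xHom_eq_zero hr hm P.action.locallyNilpotent hne
  obtain ⟨a, ha⟩ := exists_map_y_eq hr0 P.action.locallyNilpotent hx
  -- A bundle action has no fixed points, so a cannot lie in a maximal ideal; units of ℂ[x] are the
  -- nonzero constants.
  have hu : IsUnit a := by
    by_contra hu
    obtain ⟨T, p, hT, hp⟩ := exists_fixed_point hr0 P.action hu (hx a) (dvd_derivation hr0 hx ha)
    exact P.act_one_ne p (hp 1)
  obtain ⟨c, hc, rfl⟩ := MvPolynomial.isUnit_iff_eq_C_of_isReduced.mp hu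
  exact ⟨hc.unit, eq_rescale_standardAction hr0 P.action hx ha⟩

end Uniqueness

end Danielewski

end

open CategoryTheory AlgebraicGeometry Danielewski in
theorem mainTheorem3 (n r : ℕ) (hn : 1 ≤ n) (hr : 2 ≤ r)
    (σ : Fin r → MvPolynomial (Fin n) ℂ)
    (hσ₁ : ∀ i j, i ≠ j → MvPolynomial.eval 0 (σ i) ≠ MvPolynomial.eval 0 (σ j))
    (hσ₂ : ∀ i, (∏ k, MvPolynomial.X k) ∣ σ i - MvPolynomial.C (MvPolynomial.eval 0 (σ i)))
    (m : Fin n → ℕ) (hm : ∀ k, 1 < m k) :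
    (∃ P : PrincipalBundle (hypersurface m σ) (multiSpace n r), IsStandard m σ P ∧
      ∀ P' : PrincipalBundle (hypersurface m σ) (multiSpace n r),
        ∃ (φ : multiSpace n r ≅ multiSpace n r) (c : ℂˣ),
          P'.proj = P.proj ≫ φ.hom ∧ P'.action = P.action.rescale c) ∧
    (∀ a : GaAction (hypersurface m σ), a.Nontrivial →
      ∃ e : a.quotient ≅ (affineN n).left, a.quotientMap ≫ e.hom = (prX m σ).left) := by
  have hr0 : 0 < r := by omega
  refine ⟨?_, fun a ha => exists_quotient_iso hr hm a ha⟩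
  obtain ⟨P, hP, hPa⟩ := exists_standardBundle hr0 hσ₁ hσ₂ hm
  refine ⟨P, hP, fun P' => ?_⟩
  obtain ⟨c, hc⟩ := exists_action_eq_rescale hr hm P'
  rw [← hPa] at hc
  obtain ⟨φ, hφ⟩ := PrincipalBundle.exists_iso_of_action_eq_rescale hc
  exact ⟨φ, c, hφ, hc⟩
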